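/- Let $G=(V,E)$ be an infinite graph. The firefighter game on $G$ with budget $\mathsf f:\{0,1,2,\dots\}\to\mathbb R$ starts with a finite set $B(0)\subset V$ of burning vertices. At every turn $t=1,2,\dots$ the player permanently protects a finite (possibly empty) set of non-burning vertices, subject to the constraint that, for every $t$, at most $\mathsf f(t)$ vertices in total have been protected by time $t$ (none are protected at time $0$); then all unprotected neighbours of burning vertices become burning, and burning vertices stay burning. The fire is contained if from some time on no new vertices start burning. A real number $c$ is called the critical protection rate of $G$, written $c=C(G)$, if - for $\mathsf f(t)=ct$ there is a finite starting set $B(0)$ for which no strategy of the player contains the fire, and - for every $\varepsilon>0$ and every finite starting set $B(0)\subset V$, there is a strategy that contains the fire for $\mathsf f(t)=(c+\varepsilon)t$. (There is at most one such $c$.) Write $\Box$ for the Cartesian and $\boxtimes$ for the strong product of graphs, let $\mathbb Z$ also denote the graph on the integers in which consecutive integers are adjacent, and let $[h]$ denote the path on $\{1,\dots,h\}$. Put $G_1=(\mathbb Z\,\Box\,\mathbb Z)\,\Box\,[h]$ and $G_2=(\mathbb Z\boxtimes\mathbb Z)\,\Box\,[h]$. **Theorem.** For every integer $h\ge 1$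 and every $q\in\{1,2\}$, the critical protection rate of $G_q$ exists and $C(G_q)=\tfrac32\,qh$. -/

import Mathlib

/-- The strong product `G ⊠ H`: distinct pairs that are equal or adjacent in each coordinate. -/
def SimpleGraph.strongProd {α β : Type*} (G : SimpleGraph α) (H : SimpleGraph β) :
    SimpleGraph (α × β) where
  Adj x y := x ≠ y ∧ (x.1 = y.1 ∨ G.Adj x.1 y.1) ∧ (x.2 = y.2 ∨ H.Adj x.2 y.2)
  symm := ⟨fun _ _ h =>
    ⟨h.1.symm, h.2.1.imp Eq.symm SimpleGraph.Adj.symm, h.2.2.imp Eq.symm SimpleGraph.Adj.symm⟩⟩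
  loopless := ⟨fun _ h => h.1 rfl⟩

namespace Firefighter

variable {V : Type*}

/-- The set of vertices burning at time `t`, for the initial fire `B₀`, when `P t` is the set of
vertices protected by time `t`: at each turn `t + 1` the set `P (t + 1)` is protected first, and
then the unprotected neighbours of burning vertices become burning. -/
def burning (G : SimpleGraph V) (B₀ : Finset V) (P : ℕ → Finset V) : ℕ → Set V
  | 0 => B₀
  | t + 1 => burning G B₀ P t ∪
      {v | v ∉ P (t + 1) ∧ ∃ u ∈ burning G B₀ P t, G.Adj u v}

/-- `P` is a legal way to play against the initial fire `B₀` with the budget `f`: nothing is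
protected before the first turn, protection is permanent, only non-burning vertices may be newly
protected, and at most `f t` vertices are protected by time `t`. The game is deterministic, so a
strategy against `B₀` amounts to such a sequence. -/
structure IsLegalPlay (G : SimpleGraph V) (f : ℕ → ℝ) (B₀ : Finset V) (P : ℕ → Finset V) :
    Prop where
  zero : P 0 = ∅
  mono : Monotone P
  notBurning : ∀ t, ∀ v ∈ P (t + 1), v ∉ P t → v ∉ burning G B₀ P t
  budget : ∀ t, ((P t).card : ℝ) ≤ f t

/-- Eventually no new burning vertices are generated. -/
def IsContained (G : SimpleGraph V) (B₀ : Finset V) (P : ℕ → Finset V) : Prop :=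
  ∃ T, ∀ t, T ≤ t → burning G B₀ P (t + 1) = burning G B₀ P t

/-- With the budget `f` the player can contain the fire started from `B₀`. -/
def CanContain (G : SimpleGraph V) (f : ℕ → ℝ) (B₀ : Finset V) : Prop :=
  ∃ P, IsLegalPlay G f B₀ P ∧ IsContained G B₀ P

/-- `c` is the critical protection rate of `G`: with the budget `c t` some finite initial fire
cannot be contained, while for every `ε > 0` every finite initial fire can be contained with the
budget `(c + ε) t`. -/
def IsCriticalProtectionRate (G : SimpleGraph V) (c : ℝ) : Prop :=
  (∃ B₀ : Finset V, ¬ CanContain G (fun t => c * t) B₀) ∧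
    ∀ ε : ℝ, 0 < ε → ∀ B₀ : Finset V, CanContain G (fun t => (c + ε) * t) B₀

/-- The graph `(ℤ □ ℤ) □ [h]`; here `SimpleGraph.hasse ℤ` joins consecutive integers, and the
layers are indexed by `0, …, h - 1`. -/
noncomputable def G₁ (h : ℕ) : SimpleGraph ((ℤ × ℤ) × Fin h) :=
  ((SimpleGraph.hasse ℤ).boxProd (SimpleGraph.hasse ℤ)).boxProd (SimpleGraph.pathGraph h)

/-- The graph `(ℤ ⊠ ℤ) □ [h]`. -/
noncomputable def G₂ (h : ℕ) : SimpleGraph ((ℤ × ℤ) × Fin h) :=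
  ((SimpleGraph.hasse ℤ).strongProd (SimpleGraph.hasse ℤ)).boxProd (SimpleGraph.pathGraph h)

end Firefighter

/-! Both graphs fit one model (`IsGrid`): a vertex is a cell `(i, u, v)` of a layer `i` with `u + v
+ π i` even. Inside a layer the fire spreads along diagonals; between layers that are adjacent in a
connected graph `Γ` it spreads with `u` or `v` shifted by 0 or 1. For `G₁` the plane is turned by 45
degrees, giving `h` layers; for `G₂` every layer is split by the parity of `x + y`, giving `2h`.
With `H` layers the rate is `3H/2`.

Containment (`IsGrid.canContain`). By time `t` the fire stays within distance `m = t + r` of the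
origin. Protect, in time, those boundary cells of a fixed rectangle that lie within this distance. A
line holds half a cell per unit length and layer. If the four sides lie at distances of very
different size, then one side within reach costs about `m` cells per layer, two or three cost about
`3m/2`, and all four cost little more than the distance of the last side. The excess is a constant
that `ε t` pays for.

Escape (`Fire.unbounded`). A large burning square is followed by a rectangle whose four sides, the
fronts, try to move outwards by one at each step. A row that spreads by `±1` gains at least one cell
in every layer where it burns, up to obstacles. A front is blocked when obstacles in the next `H`
rows nearly match its burning cells. The heart of the matter is that two fronts are never blocked at
once (`ProcessInv.not_blocked`). Three kinds of estimates, up to constants, give this: (1) `ledger`: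
the unburnt boundary cells of the rectangle number at most the obstacles inside, since pulling the
new boundary back to the old one towards burning pivots loses only at obstacles (`ringCount_step`).
(2) `verticalSum`, `horizontalSum`: the cells of two opposite fronts, plus obstacles inside and near
the other two sides, grow by `2H` per step, less `H` for each of the two that is blocked. (3) Width
and height grow by 2 per step, less 1 for each blocked front involved. If at most one front was
blocked per step so far, the combined left-hand sides are at least `4Ht - Ht = 3Ht` plus a multiple
of the initial size. If two fronts are blocked now, their burning cells are replaced by nearby
obstacles, and twice the total number of obstacles must exceed `3Ht` by more than the budget allows.
Since at most one front is ever blocked, the rectangle grows without bound, and each row that a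
front leaves contains fire.

Layers that burn nowhere in the row of a front spoil the gain. Then either many cells catch fire in
the row if the front waits (`Aligning`), or some layer gains many cells (`Gaining`), or a chain of
steps goes on in which sparseness spreads to a new layer each time. As the front was not shut, a
chain cannot make all layers sparse, so it has at most `H` steps (`FrontFire.chainInv_succ`). Such
steps are wasteful; the large gain ending a chain pays for them, with unfinished chains carried as a
bounded credit in `ledger`. -/

namespace Firefighter

/-! ### Counting on lines. -/

section

open Classical in
/-- The number of integers in `[l, h]` with the property `s`. -/
noncomputable def lineCount (s : ℤ → Prop) (l h : ℤ) : ℕ :=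
  ((Finset.Icc l h).filter s).card

open Classical in
theorem lineCount_mono {s s' : ℤ → Prop} {l h l' h' : ℤ} (hl : l' ≤ l) (hh : h ≤ h')
    (hs : ∀ x, l ≤ x → x ≤ h → s x → s' x) : lineCount s l h ≤ lineCount s' l' h' := by
  apply Finset.card_le_card
  intro x hx
  simp only [Finset.mem_filter, Finset.mem_Icc] at hx ⊢
  exact ⟨⟨by omega, by omega⟩, hs x hx.1.1 hx.1.2 hx.2⟩

theorem lineCount_eq_zero {s : ℤ → Prop} {l h : ℤ} :
    lineCount s l h = 0 ↔ ∀ x, l ≤ x → x ≤ h → ¬ s x := by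
  simp [lineCount, Finset.filter_eq_empty_iff]

theorem lineCount_pos {s : ℤ → Prop} {l h : ℤ} :
    0 < lineCount s l h ↔ ∃ x, l ≤ x ∧ x ≤ h ∧ s x := by
  rw [Nat.pos_iff_ne_zero, Ne, lineCount_eq_zero]
  push Not
  rfl

open Classical in
theorem lineCount_or_le (s s' : ℤ → Prop) (l h : ℤ) :
    lineCount (fun x => s x ∨ s' x) l h ≤ lineCount s l h + lineCount s' l h := by
  unfold lineCount
  refine le_trans (Finset.card_le_card ?_) (Finset.card_union_le _ _)
  intro x hx
  simp only [Finset.mem_filter, Finset.mem_union] at hx ⊢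
  tauto

open Classical in
theorem lineCount_add_lineCount_le {s s' s'' : ℤ → Prop} {l h : ℤ}
    (h1 : ∀ x, l ≤ x → x ≤ h → s x → s'' x) (h2 : ∀ x, l ≤ x → x ≤ h → s' x → s'' x)
    (hd : ∀ x, s x → ¬ s' x) :
    lineCount s l h + lineCount s' l h ≤ lineCount s'' l h := by
  unfold lineCount
  rw [← Finset.card_union_of_disjoint]
  · apply Finset.card_le_card
    intro x hx
    simp only [Finset.mem_union, Finset.mem_filter, Finset.mem_Icc] at hx ⊢
    rcases hx with hx | hx
    · exact ⟨hx.1, h1 x hx.1.1 hx.1.2 hx.2⟩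
    · exact ⟨hx.1, h2 x hx.1.1 hx.1.2 hx.2⟩
  · rw [Finset.disjoint_left]
    intro x hx hx'
    exact hd x (Finset.mem_filter.1 hx).2 (Finset.mem_filter.1 hx').2

/-- Shifting by `δ` keeps the count, when the range is shifted as well. -/
theorem lineCount_shift (s : ℤ → Prop) (l h δ : ℤ) :
    lineCount (fun x => s (x - δ)) (l + δ) (h + δ) = lineCount s l h := by
  classical
  unfold lineCount
  symm
  apply Finset.card_bij (fun x _ => x + δ)
  · intro x hx
    simp only [Finset.mem_filter, Finset.mem_Icc] at hx ⊢
    refine ⟨⟨by omega, by omega⟩, by simpa using hx.2⟩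
  · intro x _ y _ hxy
    simpa using hxy
  · intro y hy
    simp only [Finset.mem_filter, Finset.mem_Icc] at hy
    exact ⟨y - δ, by simp only [Finset.mem_filter, Finset.mem_Icc]; exact
      ⟨⟨by omega, by omega⟩, hy.2⟩, by simp⟩

/-- Enlarging the range by one at either end adds at most two. -/
theorem lineCount_enlarge (s : ℤ → Prop) {l h l' h' : ℤ} (hl : l - 1 ≤ l') (hh : h' ≤ h + 1) :
    lineCount s l' h' ≤ lineCount s l h + 2 := by
  classical
  unfold lineCount
  have : (Finset.Icc l' h').filter s ⊆ (Finset.Icc l h).filter s ∪ {l - 1, h + 1} := by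
    intro x hx
    simp only [Finset.mem_filter, Finset.mem_Icc, Finset.mem_union, Finset.mem_insert,
      Finset.mem_singleton] at hx ⊢
    by_cases h1 : x = l - 1
    · simp [h1]
    · by_cases h2 : x = h + 1
      · simp [h2]
      · exact Or.inl ⟨⟨by omega, by omega⟩, hx.2⟩
  refine (Finset.card_le_card this).trans ((Finset.card_union_le _ _).trans ?_)
  gcongr
  exact Finset.card_le_two

theorem lineCount_add_lineCount_not (s : ℤ → Prop) (l h : ℤ) :
    lineCount s l h + lineCount (fun x => ¬ s x) l h = (h + 1 - l).toNat := by
  classical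
  rw [← Int.card_Icc]
  unfold lineCount
  convert Finset.card_filter_add_card_filter_not (s := Finset.Icc l h) s

/-- A shift by one to the left sends the places of `s` to places of `s'`, except perhaps the
leftmost. Applied to the two parities, it shows that each takes half of a line up to rounding. -/
theorem lineCount_le_of_pred {s s' : ℤ → Prop} (hs : ∀ x, s x → s' (x - 1)) (l h : ℤ) :
    lineCount s l h ≤ lineCount s' l h + 1 := by
  classical
  unfold lineCount
  have : (Finset.Icc l h).filter s ⊆ insert l (((Finset.Icc l h).filter s').image (· + 1)) := by
    intro x hx
    simp only [Finset.mem_filter, Finset.mem_Icc, Finset.mem_insert, Finset.mem_image] at hx ⊢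
    by_cases hxl : x = l
    · exact Or.inl hxl
    · exact Or.inr ⟨x - 1, ⟨⟨by omega, by omega⟩, hs x hx.2⟩, by ring⟩
  exact (Finset.card_le_card this).trans ((Finset.card_insert_le _ _).trans
    (Nat.add_le_add_right Finset.card_image_le 1))

theorem lineCount_succ_right (s : ℤ → Prop) (l h : ℤ) :
    lineCount s l (h + 1) ≤ lineCount s l h + 1 := by
  classical
  unfold lineCount
  have : (Finset.Icc l (h + 1)).filter s ⊆ insert (h + 1) ((Finset.Icc l h).filter s) := by
    intro x hx
    simp only [Finset.mem_filter, Finset.mem_Icc, Finset.mem_insert] at hx ⊢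
    by_cases hxh : x = h + 1
    · exact Or.inl hxh
    · exact Or.inr ⟨⟨by omega, by omega⟩, hx.2⟩
  exact (Finset.card_le_card this).trans (Finset.card_insert_le _ _)

/-- A line of `h - l + 1` cells holds at least `(h - l) / 2` of either parity. -/
theorem le_two_mul_lineCount_parity (p l h : ℤ) :
    h - l ≤ 2 * (lineCount (fun x => Even (x + p)) l h : ℤ) := by
  have h1 := lineCount_add_lineCount_not (fun x => Even (x + p)) l h
  have h2 : lineCount (fun x => ¬ Even (x + p)) l h ≤ lineCount (fun x => Even (x + p)) l h + 1 :=
    lineCount_le_of_pred (fun x hx => by rw [Int.not_even_iff] at hx; rw [Int.even_iff]; omega) l h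
  omega

theorem two_mul_lineCount_parity_le (p l h : ℤ) (hlh : l ≤ h + 1) :
    2 * (lineCount (fun x => Even (x + p)) l h : ℤ) ≤ h - l + 2 := by
  have h1 := lineCount_add_lineCount_not (fun x => Even (x + p)) l h
  have h2 : lineCount (fun x => Even (x + p)) l h ≤ lineCount (fun x => ¬ Even (x + p)) l h + 1 :=
    lineCount_le_of_pred (fun x hx => by rw [Int.even_iff] at hx; rw [Int.not_even_iff]; omega) l h
  omega

open Classical in
/-- The spread of a nonempty set of integers by `± 1` gains at least one element. -/
theorem card_succ_le_card_spread (A : Finset ℤ) (hA : A.Nonempty) :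
    A.card + 1 ≤ (A.image (· - 1) ∪ A.image (· + 1)).card := by
  have h1 : A.max' hA + 1 ∉ A.image (· - 1) := by
    intro hx
    obtain ⟨y, hy, hxy⟩ := Finset.mem_image.1 hx
    have := A.le_max' y hy
    omega
  have h2 : insert (A.max' hA + 1) (A.image (· - 1)) ⊆ A.image (· - 1) ∪ A.image (· + 1) := by
    intro x hx
    rcases Finset.mem_insert.1 hx with rfl | hx
    · exact Finset.mem_union_right _ (Finset.mem_image_of_mem (· + 1) (A.max'_mem hA))
    · exact Finset.mem_union_left _ hx
  have h3 := Finset.card_le_card h2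
  rw [Finset.card_insert_of_notMem h1, Finset.card_image_of_injective _ (sub_left_injective)] at h3
  exact h3

open Classical in
/-- Growth of a row: the row `s` inside `[l, h]` spreads by `± 1` to burnt (`s'`) or protected
(`q`) places; only the two ends can leave the range `[l', h']`. -/
theorem lineCount_growth {s s' q : ℤ → Prop} {l h l' h' : ℤ} (hl : l' ≤ l) (hh : h ≤ h')
    (hdec : ∀ x, s x → s' (x - 1) ∨ q (x - 1)) (hinc : ∀ x, s x → s' (x + 1) ∨ q (x + 1))
    (hpos : 0 < lineCount s l h) :
    lineCount s l h + 1 ≤ lineCount s' l' h' + lineCount q l' h' +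
      (if l' = l ∧ s l then 1 else 0) + (if h' = h ∧ s h then 1 else 0) := by
  set A := (Finset.Icc l h).filter s with hA
  have hne : A.Nonempty := Finset.card_pos.1 hpos
  have h1 := card_succ_le_card_spread A hne
  have h2 : A.image (· - 1) ∪ A.image (· + 1) ⊆
      ((Finset.Icc l' h').filter s' ∪ (Finset.Icc l' h').filter q) ∪
      ((if l' = l ∧ s l then {l - 1} else ∅) ∪ (if h' = h ∧ s h then {h + 1} else ∅)) := by
    intro y hy
    have : ∃ x, (l ≤ x ∧ x ≤ h) ∧ s x ∧ (y = x - 1 ∨ y = x + 1) := by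
      rcases Finset.mem_union.1 hy with hy | hy
      · obtain ⟨x, hx, rfl⟩ := Finset.mem_image.1 hy
        simp only [hA, Finset.mem_filter, Finset.mem_Icc] at hx
        exact ⟨x, hx.1, hx.2, Or.inl rfl⟩
      · obtain ⟨x, hx, rfl⟩ := Finset.mem_image.1 hy
        simp only [hA, Finset.mem_filter, Finset.mem_Icc] at hx
        exact ⟨x, hx.1, hx.2, Or.inr rfl⟩
    obtain ⟨x, hx, hsx, hyx⟩ := this
    have hy' : s' y ∨ q y := by
      rcases hyx with rfl | rfl
      · exact hdec x hsx
      · exact hinc x hsx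
    by_cases hyl : y < l'
    · have e1 : x = l := by omega
      have e2 : l' = l := by omega
      have e3 : y = l - 1 := by omega
      subst e1
      simp [e2, hsx, e3]
    by_cases hyh : h' < y
    · have e1 : x = h := by omega
      have e2 : h' = h := by omega
      have e3 : y = h + 1 := by omega
      subst e1
      simp [e2, hsx, e3]
    apply Finset.mem_union_left
    rw [← Finset.filter_or]
    simp only [Finset.mem_filter, Finset.mem_Icc]
    exact ⟨⟨by omega, by omega⟩, hy'⟩
  have h3 := Finset.card_le_card h2
  have h4 := Finset.card_union_le ((Finset.Icc l' h').filter s' ∪ (Finset.Icc l' h').filter q)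
      ((if l' = l ∧ s l then {l - 1} else ∅) ∪ (if h' = h ∧ s h then {h + 1} else ∅))
  have h5 := Finset.card_union_le ((Finset.Icc l' h').filter s') ((Finset.Icc l' h').filter q)
  have h6 := Finset.card_union_le (if l' = l ∧ s l then {l - 1} else (∅ : Finset ℤ))
    (if h' = h ∧ s h then {h + 1} else ∅)
  have h7 : (if l' = l ∧ s l then {l - 1} else (∅ : Finset ℤ)).card =
      if l' = l ∧ s l then 1 else 0 := by split_ifs <;> simp
  have h8 : (if h' = h ∧ s h then {h + 1} else (∅ : Finset ℤ)).card =
      if h' = h ∧ s h then 1 else 0 := by split_ifs <;> simp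
  have h9 : lineCount s l h = A.card := rfl
  have h10 : lineCount s' l' h' = ((Finset.Icc l' h').filter s').card := rfl
  have h11 : lineCount q l' h' = ((Finset.Icc l' h').filter q).card := rfl
  omega

end

/-! ### Counting in rectangles; the abstract fire and its four fronts. -/

section

variable {Λ : Type*} [Fintype Λ]

open Classical in
/-- The number of cells `(i, u, v)` with `u ∈ [a, b]`, `v ∈ [c, d]` and the property `S`. -/
noncomputable def rectCount (S : Λ → ℤ → ℤ → Prop) (a b c d : ℤ) : ℕ :=
  (((Finset.univ : Finset Λ) ×ˢ (Finset.Icc a b ×ˢ Finset.Icc c d)).filter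
    (fun x => S x.1 x.2.1 x.2.2)).card

theorem rectCount_row (S : Λ → ℤ → ℤ → Prop) (a b c : ℤ) :
    rectCount S a b c c = ∑ i, lineCount (fun x => S i x c) a b := by
  classical
  unfold rectCount lineCount
  rw [← Finset.card_sigma]
  apply Finset.card_bij (fun x _ => ⟨x.1, x.2.1⟩)
  · rintro ⟨i, u, v⟩ hx
    simp only [Finset.mem_filter, Finset.mem_product, Finset.mem_univ, Finset.mem_Icc, true_and,
      Finset.mem_sigma] at hx ⊢
    obtain rfl : v = c := by omega
    exact ⟨hx.1.1, hx.2⟩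
  · rintro ⟨i, u, v⟩ hx ⟨i', u', v'⟩ hx' hxx
    simp only [Finset.mem_filter, Finset.mem_product, Finset.mem_univ, Finset.mem_Icc, true_and,
      Sigma.mk.injEq, heq_eq_eq, Prod.mk.injEq] at hx hx' hxx ⊢
    refine ⟨hxx.1, hxx.2, by omega⟩
  · rintro ⟨i, u⟩ hx
    simp only [Finset.mem_filter, Finset.mem_univ, Finset.mem_Icc, true_and,
      Finset.mem_sigma] at hx
    refine ⟨(i, u, c), ?_, rfl⟩
    simp only [Finset.mem_filter, Finset.mem_product, Finset.mem_univ, Finset.mem_Icc, true_and]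
    exact ⟨⟨hx.1, by omega⟩, hx.2⟩

theorem rectCount_swap (S : Λ → ℤ → ℤ → Prop) (a b c d : ℤ) :
    rectCount (fun i x y => S i y x) a b c d = rectCount S c d a b := by
  classical
  unfold rectCount
  apply Finset.card_bij (fun x _ => (x.1, x.2.2, x.2.1))
  · rintro ⟨i, u, v⟩ hx
    simp only [Finset.mem_filter, Finset.mem_product, Finset.mem_univ, Finset.mem_Icc,
      true_and] at hx ⊢
    exact ⟨hx.1.symm, hx.2⟩
  · rintro ⟨i, u, v⟩ hx ⟨i', u', v'⟩ hx' hxx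
    simp only [Prod.mk.injEq] at hxx ⊢
    tauto
  · rintro ⟨i, u, v⟩ hx
    simp only [Finset.mem_filter, Finset.mem_product, Finset.mem_univ, Finset.mem_Icc,
      true_and] at hx
    refine ⟨(i, v, u), ?_, rfl⟩
    simp only [Finset.mem_filter, Finset.mem_product, Finset.mem_univ, Finset.mem_Icc, true_and]
    exact ⟨hx.1.symm, hx.2⟩

theorem rectCount_neg_right (S : Λ → ℤ → ℤ → Prop) (a b c d : ℤ) :
    rectCount (fun i x y => S i x (-y)) a b c d = rectCount S a b (-d) (-c) := by
  classical
  unfold rectCount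
  apply Finset.card_bij (fun x _ => (x.1, x.2.1, -x.2.2))
  · rintro ⟨i, u, v⟩ hx
    simp only [Finset.mem_filter, Finset.mem_product, Finset.mem_univ, Finset.mem_Icc,
      true_and] at hx ⊢
    exact ⟨⟨hx.1.1, by omega, by omega⟩, hx.2⟩
  · rintro ⟨i, u, v⟩ hx ⟨i', u', v'⟩ hx' hxx
    simp only [Prod.mk.injEq, neg_inj] at hxx ⊢
    tauto
  · rintro ⟨i, u, v⟩ hx
    simp only [Finset.mem_filter, Finset.mem_product, Finset.mem_univ, Finset.mem_Icc,
      true_and] at hx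
    refine ⟨(i, u, -v), ?_, by simp⟩
    simp only [Finset.mem_filter, Finset.mem_product, Finset.mem_univ, Finset.mem_Icc, true_and,
      neg_neg]
    exact ⟨⟨hx.1.1, by omega, by omega⟩, hx.2⟩

theorem rectCount_col (S : Λ → ℤ → ℤ → Prop) (a c d : ℤ) :
    rectCount S a a c d = ∑ i, lineCount (fun y => S i a y) c d := by
  rw [← rectCount_swap, rectCount_row]

theorem rectCount_mono {S S' : Λ → ℤ → ℤ → Prop} {a b c d a' b' c' d' : ℤ}
    (hS : ∀ i u v, S i u v → S' i u v) (ha : a' ≤ a) (hb : b ≤ b') (hc : c' ≤ c) (hd : d ≤ d') :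
    rectCount S a b c d ≤ rectCount S' a' b' c' d' := by
  classical
  apply Finset.card_le_card
  rintro ⟨i, u, v⟩ hx
  simp only [Finset.mem_filter, Finset.mem_product, Finset.mem_univ, Finset.mem_Icc,
    true_and] at hx ⊢
  exact ⟨⟨⟨by omega, by omega⟩, by omega, by omega⟩, hS _ _ _ hx.2⟩

theorem rectCount_split_right (S : Λ → ℤ → ℤ → Prop) (a b : ℤ) {c m d : ℤ} (h1 : c ≤ m + 1)
    (h2 : m ≤ d) :
    rectCount S a b c d = rectCount S a b c m + rectCount S a b (m + 1) d := by
  classical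
  unfold rectCount
  rw [← Finset.card_union_of_disjoint]
  · congr 1
    ext ⟨i, u, v⟩
    simp only [Finset.mem_filter, Finset.mem_product, Finset.mem_univ, Finset.mem_Icc,
      true_and, Finset.mem_union]
    constructor
    · rintro ⟨⟨hu, hv⟩, hs⟩
      by_cases hvm : v ≤ m
      · exact Or.inl ⟨⟨hu, hv.1, hvm⟩, hs⟩
      · exact Or.inr ⟨⟨hu, by omega, hv.2⟩, hs⟩
    · rintro (⟨⟨hu, hv⟩, hs⟩ | ⟨⟨hu, hv⟩, hs⟩)
      · exact ⟨⟨hu, by omega⟩, hs⟩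
      · exact ⟨⟨hu, by omega⟩, hs⟩
  · rw [Finset.disjoint_left]
    rintro ⟨i, u, v⟩ hx hx'
    simp only [Finset.mem_filter, Finset.mem_product, Finset.mem_univ, Finset.mem_Icc,
      true_and] at hx hx'
    omega

theorem rectCount_split_left (S : Λ → ℤ → ℤ → Prop) {a m b : ℤ} (c d : ℤ) (h1 : a ≤ m + 1)
    (h2 : m ≤ b) :
    rectCount S a b c d = rectCount S a m c d + rectCount S (m + 1) b c d := by
  rw [← rectCount_swap S, ← rectCount_swap S, ← rectCount_swap S]
  exact rectCount_split_right _ _ _ h1 h2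

theorem rectCount_col_le (S : Λ → ℤ → ℤ → Prop) (a c d : ℤ) :
    rectCount S a a c d ≤ Fintype.card Λ * (d + 1 - c).toNat := by
  classical
  unfold rectCount
  refine (Finset.card_filter_le _ _).trans ?_
  simp [Finset.card_product]

/-- Enlarging a rectangle by a column at either side. -/
theorem rectCount_enlarge (S : Λ → ℤ → ℤ → Prop) {l h l' h' : ℤ} (c : ℤ) (n : ℕ) (hlh : l ≤ h)
    (hl : l - 1 ≤ l') (hh : h' ≤ h + 1) :
    rectCount S l' h' (c + 1) (c + n) ≤
      rectCount S l h (c + 1) (c + n) + 2 * (Fintype.card Λ * n) := by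
  have h1 : rectCount S l' h' (c + 1) (c + n) ≤ rectCount S (l - 1) (h + 1) (c + 1) (c + n) :=
    rectCount_mono (fun _ _ _ hs => hs) hl hh le_rfl le_rfl
  rw [rectCount_split_left S (m := l - 1) (a := l - 1) (b := h + 1) _ _ (by omega) (by omega),
    rectCount_split_left S (m := h) (a := l - 1 + 1) (b := h + 1) _ _ (by omega) (by omega)] at h1
  have h2 := rectCount_col_le S (l - 1) (c + 1) (c + n)
  have h3 := rectCount_col_le S (h + 1) (c + 1) (c + n)
  have h4 : (c + n + 1 - (c + 1)).toNat = n := by omega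
  rw [h4] at h2 h3
  simp only [sub_add_cancel] at h1
  omega

/-- A spreading fire `B` among obstacles `Q`, on the cells `(i, u, v)` of equal parity. -/
structure Fire (Γ : SimpleGraph Λ) (π : Λ → ℤ) (δ : Λ → Λ → ℤ) (B Q : ℕ → Λ → ℤ → ℤ → Prop) :
    Prop where
  monoB : ∀ t i u v, B t i u v → B (t + 1) i u v
  monoQ : ∀ t i u v, Q t i u v → Q (t + 1) i u v
  disj : ∀ t t' i u v, B t i u v → ¬ Q t' i u v
  lat : ∀ t i u v, B t i u v → Even (u + v + π i)
  -- The obstacles `Q t` stop the fire at all times up to `t + |Λ|`: they include protections still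
  -- to come. This lookahead allows a whole chain of steps to be measured against the obstacles at
  -- its start.
  diag : ∀ t t', t' ≤ t + Fintype.card Λ → ∀ i u v, B t' i u v → ∀ ε ε' : ℤ,
    (ε = 1 ∨ ε = -1) → (ε' = 1 ∨ ε' = -1) →
      B (t' + 1) i (u + ε) (v + ε') ∨ Q t i (u + ε) (v + ε')
  crossU : ∀ t t', t' ≤ t + Fintype.card Λ → ∀ i j, Γ.Adj i j → ∀ u v, B t' i u v →
      B (t' + 1) j (u + δ i j) v ∨ Q t j (u + δ i j) v
  crossV : ∀ t t', t' ≤ t + Fintype.card Λ → ∀ i j, Γ.Adj i j → ∀ u v, B t' i u v →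
      B (t' + 1) j u (v + δ i j) ∨ Q t j u (v + δ i j)
  shift : ∀ i j, δ i j = 0 ∨ δ i j = 1

/-- The four fronts of a fire (bottom, top, right, left) seen in coordinates: the first one runs
along the front, and the second one grows outwards. -/
def view (F : Fin 4) (S : Λ → ℤ → ℤ → Prop) : Λ → ℤ → ℤ → Prop :=
  match F with
  | 0 => fun i x r => S i x (-r)
  | 1 => fun i x r => S i x r
  | 2 => fun i x r => S i r x
  | 3 => fun i x r => S i (-r) x

/-- What a single front, in its own coordinates, uses of the fire. -/
structure FrontFire (Γ : SimpleGraph Λ) (δ : Λ → Λ → ℤ) (β κ : ℕ → Λ → ℤ → ℤ → Prop) :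
    Prop where
  out : ∀ t t', t' ≤ t + Fintype.card Λ → ∀ i x r, β t' i x r → ∀ ε : ℤ, (ε = 1 ∨ ε = -1) →
    β (t' + 1) i (x + ε) (r + 1) ∨ κ t i (x + ε) (r + 1)
  cross : ∀ t t', t' ≤ t + Fintype.card Λ → ∀ i j, Γ.Adj i j → ∀ x r, β t' i x r →
    β (t' + 1) j (x + δ i j) r ∨ κ t j (x + δ i j) r
  shift : ∀ i j, δ i j = 0 ∨ δ i j = 1

/-- A reflection or transposition turns each side into a row that moves upwards. Rows use the
crossings along `u` and columns those along `v`, which is why both are demanded. -/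
theorem Fire.front {Γ : SimpleGraph Λ} {π : Λ → ℤ} {δ : Λ → Λ → ℤ}
    {B Q : ℕ → Λ → ℤ → ℤ → Prop} (hf : Fire Γ π δ B Q) (F : Fin 4) :
    FrontFire Γ δ (fun t => view F (B t)) (fun t => view F (Q t)) := by
  fin_cases F
  · refine ⟨?_, fun t t' h i j hij x r => hf.crossU t t' h i j hij x _, hf.shift⟩
    intro t t' h i x r hb ε hε
    have := hf.diag t t' h i x (-r) hb ε (-1) hε (Or.inr rfl)
    rw [← neg_add] at this
    exact this
  · refine ⟨?_, fun t t' h i j hij x r => hf.crossU t t' h i j hij x _, hf.shift⟩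
    exact fun t t' h i x r hb ε hε => hf.diag t t' h i x r hb ε 1 hε (Or.inl rfl)
  · refine ⟨?_, fun t t' h i j hij x r => hf.crossV t t' h i j hij _ x, hf.shift⟩
    exact fun t t' h i x r hb ε hε => hf.diag t t' h i r x hb 1 ε (Or.inl rfl) hε
  · refine ⟨?_, fun t t' h i j hij x r => hf.crossV t t' h i j hij _ x, hf.shift⟩
    intro t t' h i x r hb ε hε
    have := hf.diag t t' h i (-r) x hb (-1) ε (Or.inr rfl) hε
    rw [← neg_add] at this
    exact this

end

/-! ### A single front: reasons to wait, and chains of wasteful steps. -/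

section

variable {Λ : Type*} [Fintype Λ]

/-- The number of cells that count as a substantial gain, for `H` layers. -/
def gainBound (H : ℕ) : ℕ := 28 * (H * H) + 25 * H + 1

/-- Growth of the size of the sparse layers per step of a chain. -/
def sparseStep (H : ℕ) : ℕ := 2 * gainBound H + 4

/-- Loss of the surplus of a front per step of a chain. -/
def surplusStep (H : ℕ) : ℕ := H + 2 * (H * H)

/-- The number of cells by which an obstacle may fail to hold a front that counts as shut. -/
def leakBound (H : ℕ) : ℕ := H * surplusStep H + H * (sparseStep H * H)

section Front

variable (Γ : SimpleGraph Λ) (δ : Λ → Λ → ℤ) (β κ : ℕ → Λ → ℤ → ℤ → Prop)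

/-- The number of burning cells of the layer `i` in the row `r`. -/
noncomputable def rowCount (t : ℕ) (r l h : ℤ) (i : Λ) : ℕ := lineCount (fun x => β t i x r) l h

/-- A free cell of the row `r` next to a burning one in another layer. -/
def Exposed (t : ℕ) (r l h : ℤ) (j : Λ) (x : ℤ) : Prop :=
  ¬ β t j x r ∧ ¬ κ t j x r ∧
    ∃ i, Γ.Adj i j ∧ l ≤ x - δ i j ∧ x - δ i j ≤ h ∧ β t i (x - δ i j) r

/-- The front should wait, since many cells of its row will start burning in the next step. -/
def Aligning (t : ℕ) (r l h : ℤ) : Prop :=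
  gainBound (Fintype.card Λ) ≤ ∑ j, lineCount (Exposed Γ δ β κ t r l h j) l h

/-- The front is (almost) stopped by obstacles in the rows close to it. -/
def Shut (t : ℕ) (r l h : ℤ) : Prop :=
  ∑ i, rowCount β t r l h i ≤
    rectCount (κ t) l h (r + 1) (r + Fintype.card Λ) + leakBound (Fintype.card Λ)

/-- Every layer burns somewhere in the row of the front. -/
def Full (t : ℕ) (r l h : ℤ) : Prop := ∀ i, 0 < rowCount β t r l h i

/-- In the next row, some layer has many more burning cells or obstacles than in this one. -/
def Gaining (t : ℕ) (r l h : ℤ) : Prop :=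
  ∃ i, rowCount β t r l h i + gainBound (Fintype.card Λ) ≤
    rowCount β (t + 1) (r + 1) l h i + rowCount κ (t + 1) (r + 1) l h i

/-- The front moves on by one row; `n` is the number of steps of the current chain. -/
def Advancing (t : ℕ) (r l h : ℤ) (n : ℕ) : Prop :=
  ¬ Aligning Γ δ β κ t r l h ∧ (0 < n ∨ ¬ Shut β κ t r l h)

/-- The front waits because it is shut. -/
def Blocked (t : ℕ) (r l h : ℤ) (n : ℕ) : Prop :=
  ¬ Aligning Γ δ β κ t r l h ∧ n = 0 ∧ Shut β κ t r l h

open Classical in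
/-- The length of the chain after a step. -/
noncomputable def nextChain (t : ℕ) (r l h : ℤ) (n : ℕ) : ℕ :=
  if Aligning Γ δ β κ t r l h then 0
  else if n = 0 ∧ (Shut β κ t r l h ∨ Full β t r l h) then 0
  else if Gaining β κ t r l h then 0
  else n + 1

/-- The invariant of a chain of `n` steps: more and more layers are sparse, although the front is
far from being shut. -/
def ChainInv (t : ℕ) (r l h : ℤ) (n : ℕ) : Prop :=
  -- The surplus is measured against the obstacles at the start `t₀` of the chain, in the rows of
  -- the original window not yet passed. Nothing is needed while aligning, as the chain is then
  -- dropped.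
  n ≤ Fintype.card Λ ∧ (0 < n → ¬ Aligning Γ δ β κ t r l h →
    (∃ S : Finset Λ, n + 1 ≤ S.card ∧
      ∀ i ∈ S, rowCount β t r l h i ≤ sparseStep (Fintype.card Λ) * n) ∧
    ∃ t₀, t = t₀ + n ∧ rectCount (κ t₀) l h (r + 1) (r + (Fintype.card Λ - n : ℕ)) +
      leakBound (Fintype.card Λ) < ∑ i, rowCount β t r l h i + surplusStep (Fintype.card Λ) * n)

variable {Γ δ β κ}

/-- In a chain the sparse layers are not all layers. -/
theorem sum_rowCount_le_of_sparse {t : ℕ} {r l h : ℤ} {C : ℕ}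
    (hS : ∀ i, rowCount β t r l h i ≤ C) :
    ∑ i, rowCount β t r l h i ≤ Fintype.card Λ * C := by
  simpa using Finset.sum_le_card_nsmul Finset.univ _ C (fun i _ => hS i)

/-- The total size of a front, up to one cell per layer, survives in the next row. -/
theorem FrontFire.sum_rowCount_le (hf : FrontFire Γ δ β κ) {t t₀ : ℕ} (ht : t ≤ t₀ + Fintype.card Λ)
    (r l h l' h' : ℤ) (hl : l' ≤ l) (hh : h ≤ h') :
    ∑ i, rowCount β t r l h i ≤ ∑ i, rowCount β (t + 1) (r + 1) l' h' i +
      rectCount (κ t₀) l h (r + 1) (r + 1) + Fintype.card Λ := by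
  rw [rectCount_row, ← Finset.card_univ, Finset.card_eq_sum_ones, ← Finset.sum_add_distrib,
    ← Finset.sum_add_distrib]
  apply Finset.sum_le_sum
  intro i _
  unfold rowCount
  have h0 : lineCount (fun x => β (t + 1) i x (r + 1)) l h ≤
      lineCount (fun x => β (t + 1) i x (r + 1)) l' h' :=
    lineCount_mono hl hh (fun _ _ _ hx => hx)
  by_cases hp : 0 < lineCount (fun x => β t i x r) l h
  -- In a fixed range the spread gains one cell and may lose one at either end, hence a net loss of
  -- at most one per layer.
  · have := lineCount_growth (s' := fun x => β (t + 1) i x (r + 1))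
      (q := fun x => κ t₀ i x (r + 1)) (le_refl l) (le_refl h)
      (fun x hx => by simpa [sub_eq_add_neg] using hf.out t₀ t ht i x r hx (-1) (Or.inr rfl))
      (fun x hx => hf.out t₀ t ht i x r hx 1 (Or.inl rfl)) hp
    split_ifs at this <;> omega
  · omega

/-- Neighbouring layers of a row have similar size, up to obstacles and exposed cells. -/
theorem FrontFire.rowCount_le_of_adj (hf : FrontFire Γ δ β κ) {t : ℕ} (r l h : ℤ)
    {i j : Λ} (hij : Γ.Adj j i) :
    rowCount β t r l h j ≤ rowCount β t r l h i + rowCount κ t r l h i +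
      lineCount (Exposed Γ δ β κ t r l h i) l h + 1 := by
  -- Copy the row of `j` to the layer `i`, shifted by `δ j i`. Every copied cell burns, is an
  -- obstacle or is exposed, and at most one copy leaves the range.
  unfold rowCount
  have h1 := lineCount_shift (fun x => β t j x r) l h (δ j i)
  have h2 : lineCount (fun x => l ≤ x - δ j i ∧ x - δ j i ≤ h ∧ β t j (x - δ j i) r) l (h + 1) ≤
      lineCount (fun x => (β t i x r ∨ κ t i x r) ∨ Exposed Γ δ β κ t r l h i x) l (h + 1) := by
    apply lineCount_mono le_rfl le_rfl
    intro x _ _ hx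
    by_contra hcon
    push Not at hcon
    exact hcon.2 ⟨hcon.1.1, hcon.1.2, j, hij, hx⟩
  have h3 : lineCount (fun x => β t j (x - δ j i) r) (l + δ j i) (h + δ j i) ≤
      lineCount (fun x => l ≤ x - δ j i ∧ x - δ j i ≤ h ∧ β t j (x - δ j i) r) l (h + 1) := by
    rcases hf.shift j i with h0 | h0 <;>
    exact lineCount_mono (by omega) (by omega) (fun x hx hx' hb => ⟨by omega, by omega, hb⟩)
  have h4 := lineCount_succ_right
    (fun x => (β t i x r ∨ κ t i x r) ∨ Exposed Γ δ β κ t r l h i x) l h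
  have h5 := lineCount_or_le (fun x => β t i x r ∨ κ t i x r)
    (Exposed Γ δ β κ t r l h i) l h
  have h6 := lineCount_or_le (fun x => β t i x r) (fun x => κ t i x r) l h
  omega

/-- A chain without gain goes on. -/
theorem FrontFire.chainInv_succ (hf : FrontFire Γ δ β κ)
    (hΓ : ∀ S : Finset Λ, S.Nonempty → S ≠ Finset.univ → ∃ i ∈ S, ∃ j ∉ S, Γ.Adj j i)
    {t : ℕ} {r l h l' h' : ℤ} {n : ℕ} (hlh : l ≤ h) (hl : l' ≤ l) (hl' : l - 1 ≤ l')
    (hh : h ≤ h') (hh' : h' ≤ h + 1) (hinv : ChainInv Γ δ β κ t r l h n)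
    (hadv : Advancing Γ δ β κ t r l h n) (hnf : ¬ (n = 0 ∧ Full β t r l h))
    (hng : ¬ Gaining β κ t r l h) : ChainInv Γ δ β κ (t + 1) (r + 1) l' h' (n + 1) := by
  classical
  -- A chain starts with a layer that does not burn in the row at all; it is the first sparse layer.
  obtain ⟨S, hSc, hS⟩ : ∃ S : Finset Λ, n + 1 ≤ S.card ∧
      ∀ i ∈ S, rowCount β t r l h i ≤ sparseStep (Fintype.card Λ) * n := by
    rcases Nat.eq_zero_or_pos n with rfl | hn
    · have : ¬ Full β t r l h := fun hf => hnf ⟨rfl, hf⟩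
      unfold Full at this
      push Not at this
      obtain ⟨z, hz⟩ := this
      exact ⟨{z}, by simp, by simpa using hz⟩
    · exact (hinv.2 hn hadv.1).1
  -- At the start, the surplus is the failure of `Shut`.
  obtain ⟨t₀, ht₀, hsur⟩ : ∃ t₀, t = t₀ + n ∧ rectCount (κ t₀) l h (r + 1) (r + ((Fintype.card Λ) - n : ℕ)) +
      leakBound (Fintype.card Λ) < ∑ i, rowCount β t r l h i + surplusStep (Fintype.card Λ) * n := by
    rcases Nat.eq_zero_or_pos n with rfl | hn
    · refine ⟨t, rfl, ?_⟩
      have := hadv.2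
      simp only [lt_self_iff_false, false_or, Shut, not_le] at this
      simpa using this
    · exact (hinv.2 hn hadv.1).2
  have hnH : n ≤ (Fintype.card Λ) := hinv.1
  have hSne : S.Nonempty := Finset.card_pos.1 (by omega)
  -- If all layers were sparse, the whole row would be too small for the surplus. The two summands
  -- of `leakBound` bound the surplus lost so far and the size of such a row.
  have hSu : S ≠ Finset.univ := by
    rintro rfl
    have h1 := sum_rowCount_le_of_sparse (fun i => hS i (Finset.mem_univ i))
    have h2 : surplusStep (Fintype.card Λ) * n ≤ (Fintype.card Λ) * surplusStep (Fintype.card Λ) := by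
      rw [mul_comm]; exact Nat.mul_le_mul_right _ hnH
    have h3 : (Fintype.card Λ) * (sparseStep (Fintype.card Λ) * n) ≤ (Fintype.card Λ) * (sparseStep (Fintype.card Λ) * (Fintype.card Λ)) :=
      Nat.mul_le_mul_left _ (Nat.mul_le_mul_left _ hnH)
    unfold leakBound at hsur
    omega
  have hSlt : S.card < (Fintype.card Λ) := by
    rw [← Finset.card_univ (α := Λ)]
    exact Finset.card_lt_card (Finset.ssubset_univ_iff.2 hSu)
  refine ⟨by omega, fun _ hna => ⟨?_, t₀, by omega, ?_⟩⟩
  -- Sparseness spreads along an edge of `Γ`: without a gain, the sparse layer has few burning cells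
  -- and obstacles in the next row, and since few cells are exposed the neighbour cannot have many
  -- more. The 4 in `sparseStep` covers the longer range.
  · obtain ⟨i, hi, j, hj, hji⟩ := hΓ S hSne hSu
    unfold Gaining at hng
    push Not at hng
    have hen : ∀ (σ : ℕ → Λ → ℤ → ℤ → Prop) (i : Λ), rowCount σ (t + 1) (r + 1) l' h' i ≤
        rowCount σ (t + 1) (r + 1) l h i + 2 := fun σ i => lineCount_enlarge _ hl' hh'
    have hstep : sparseStep (Fintype.card Λ) * (n + 1) = sparseStep (Fintype.card Λ) * n + 2 * gainBound (Fintype.card Λ) + 4 := by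
      rw [mul_add]; simp [sparseStep]; omega
    refine ⟨insert j S, by rw [Finset.card_insert_of_notMem hj]; omega, fun i' hi' => ?_⟩
    rw [hstep]
    rcases Finset.mem_insert.1 hi' with rfl | hi'
    · have h1 := hf.rowCount_le_of_adj (t := t + 1) (r + 1) l' h' hji
      have h2 := hng i
      have h3 := hen β i
      have h4 := hen κ i
      have h5 := hS i hi
      have h6 : lineCount (Exposed Γ δ β κ (t + 1) (r + 1) l' h' i) l' h' < gainBound (Fintype.card Λ) := by
        unfold Aligning at hna
        push Not at hna
        exact lt_of_le_of_lt (Finset.single_le_sum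
          (f := fun j => lineCount (Exposed Γ δ β κ (t + 1) (r + 1) l' h' j) l' h')
          (fun _ _ => Nat.zero_le _) (Finset.mem_univ i)) hna
      omega
    · have h2 := hng i'
      have h3 := hen β i'
      have h5 := hS i' hi'
      omega
  -- Cells of the row vanish only at obstacles of the first row of the window, which is now dropped.
  -- `surplusStep` covers one further cell per layer and the two columns by which the window may
  -- widen.
  · have h1 := hf.sum_rowCount_le (t := t) (t₀ := t₀) (by omega) r l h l' h' hl hh
    have h2 := rectCount_enlarge (κ t₀) (r + 1) ((Fintype.card Λ) - (n + 1)) hlh hl' hh'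
    have h3 := rectCount_split_right (κ t₀) l h (c := r + 1) (m := r + 1)
      (d := r + ((Fintype.card Λ) - n : ℕ)) (by omega) (by omega)
    have e : r + (((Fintype.card Λ) - n : ℕ) : ℤ) = r + 1 + (((Fintype.card Λ) - (n + 1) : ℕ) : ℤ) := by omega
    rw [e] at h3 hsur
    have h4 : (Fintype.card Λ) * ((Fintype.card Λ) - (n + 1)) ≤ (Fintype.card Λ) * (Fintype.card Λ) := Nat.mul_le_mul_left _ (by omega)
    have h5 : surplusStep (Fintype.card Λ) * (n + 1) = surplusStep (Fintype.card Λ) * n + (Fintype.card Λ) + 2 * ((Fintype.card Λ) * (Fintype.card Λ)) := by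
      rw [mul_add]; simp [surplusStep]; omega
    rw [h5]
    omega

/-- A front in a chain, or not shut, burns in its row. -/
theorem exists_of_advancing {t : ℕ} {r l h : ℤ} {n : ℕ} (hinv : ChainInv Γ δ β κ t r l h n)
    (hadv : Advancing Γ δ β κ t r l h n) : ∃ i x, β t i x r := by
  have hpos : 0 < ∑ i, rowCount β t r l h i := by
    rcases Nat.eq_zero_or_pos n with rfl | hn
    · have := hadv.2
      simp only [lt_self_iff_false, false_or, Shut, not_le] at this
      omega
    · obtain ⟨t₀, -, h⟩ := (hinv.2 hn hadv.1).2
      have h2 : surplusStep (Fintype.card Λ) * n ≤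
          Fintype.card Λ * surplusStep (Fintype.card Λ) := by
        rw [mul_comm]; exact Nat.mul_le_mul_right _ hinv.1
      unfold leakBound at h
      omega
  obtain ⟨i, -, hi⟩ := Finset.sum_pos_iff.1 hpos
  obtain ⟨x, -, -, hx⟩ := lineCount_pos.1 hi
  exact ⟨i, x, hx⟩

end Front

end

/-! ### Unburnt cells on the boundary of a growing rectangle: one side. -/

section

/-- Being on the boundary of the rectangle `[a, b] × [c, d]`. -/
def OnRing (a b c d u v : ℤ) : Prop := u = a ∨ u = b ∨ v = c ∨ v = d

open Classical in
/-- The number of boundary cells of `[a, b] × [c, d]` with the property `s`. -/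
noncomputable def ringCount (s : ℤ → ℤ → Prop) (a b c d : ℤ) : ℕ :=
  ((Finset.Icc a b ×ˢ Finset.Icc c d).filter
    (fun p => OnRing a b c d p.1 p.2 ∧ s p.1 p.2)).card

open Classical in
/-- The number of cells of `[a, b] × [c, d]` on the boundary of `[a', b'] × [c', d']` with the
property `s`. -/
noncomputable def innerCount (s : ℤ → ℤ → Prop) (a b c d a' b' c' d' : ℤ) : ℕ :=
  ((Finset.Icc a b ×ˢ Finset.Icc c d).filter
    (fun p => OnRing a' b' c' d' p.1 p.2 ∧ s p.1 p.2)).card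

/-- The corners of the new ring are assigned to the new rows, so new columns are counted on the old
range only. The estimates for columns follow the same convention. -/
theorem ringCount_split (z : ℤ → ℤ → Prop) {a b c d a' b' c' d' : ℤ}
    (ha : a' = a ∨ a' = a - 1) (hb : b' = b ∨ b' = b + 1) (hc : c' = c ∨ c' = c - 1)
    (hd : d' = d ∨ d' = d + 1) (hcd : c ≤ d) (hab : a ≤ b) :
    ringCount z a' b' c' d' =
      (if c' = c then 0 else lineCount (fun u => z u (c - 1)) a' b') +
      (if d' = d then 0 else lineCount (fun u => z u (d + 1)) a' b') +
      (if b' = b then 0 else lineCount (fun v => z (b + 1) v) c d) +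
      (if a' = a then 0 else lineCount (fun v => z (a - 1) v) c d) +
      innerCount z a b c d a' b' c' d' := by
  classical
  unfold ringCount innerCount
  set R := (Finset.Icc a' b' ×ˢ Finset.Icc c' d').filter
    (fun p => OnRing a' b' c' d' p.1 p.2 ∧ z p.1 p.2) with hR
  have memR : ∀ u v, (u, v) ∈ R ↔ (((a' ≤ u ∧ u ≤ b') ∧ c' ≤ v ∧ v ≤ d') ∧
      OnRing a' b' c' d' u v ∧ z u v) := by
    intro u v
    simp only [hR, Finset.mem_filter, Finset.mem_product, Finset.mem_Icc]
  have e1 := Finset.card_filter_add_card_filter_not (s := R) (fun p => p.2 < c)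
  have e2 := Finset.card_filter_add_card_filter_not (s := R.filter (fun p => ¬ p.2 < c))
    (fun p => d < p.2)
  have e3 := Finset.card_filter_add_card_filter_not
    (s := (R.filter (fun p => ¬ p.2 < c)).filter (fun p => ¬ d < p.2)) (fun p => b < p.1)
  have e4 := Finset.card_filter_add_card_filter_not
    (s := ((R.filter (fun p => ¬ p.2 < c)).filter (fun p => ¬ d < p.2)).filter
      (fun p => ¬ b < p.1)) (fun p => p.1 < a)
  have f1 : (R.filter (fun p => p.2 < c)).card =
      if c' = c then 0 else lineCount (fun u => z u (c - 1)) a' b' := by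
    split_ifs with h
    · rw [Finset.card_eq_zero, Finset.filter_eq_empty_iff]
      rintro ⟨u, v⟩ hx
      rw [memR] at hx
      simp only
      omega
    · symm
      unfold lineCount
      apply Finset.card_bij (fun u _ => (u, c - 1))
      · intro u hu
        simp only [Finset.mem_filter, Finset.mem_Icc, memR, OnRing] at hu ⊢
        exact ⟨⟨⟨hu.1, by omega, by omega⟩, by omega, hu.2⟩, by omega⟩
      · intro u _ u' _ h
        simpa using h
      · rintro ⟨u, v⟩ hx
        simp only [Finset.mem_filter, memR] at hx
        obtain rfl : v = c - 1 := by omega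
        exact ⟨u, by simp only [Finset.mem_filter, Finset.mem_Icc]; exact ⟨hx.1.1.1, hx.1.2.2⟩,
          rfl⟩
  have f2 : ((R.filter (fun p => ¬ p.2 < c)).filter (fun p => d < p.2)).card =
      if d' = d then 0 else lineCount (fun u => z u (d + 1)) a' b' := by
    split_ifs with h
    · rw [Finset.card_eq_zero, Finset.filter_eq_empty_iff]
      rintro ⟨u, v⟩ hx
      rw [Finset.mem_filter, memR] at hx
      simp only
      omega
    · symm
      unfold lineCount
      apply Finset.card_bij (fun u _ => (u, d + 1))
      · intro u hu
        simp only [Finset.mem_filter, Finset.mem_Icc, memR, OnRing] at hu ⊢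
        exact ⟨⟨⟨⟨hu.1, by omega, by omega⟩, by omega, hu.2⟩, by omega⟩, by omega⟩
      · intro u _ u' _ h
        simpa using h
      · rintro ⟨u, v⟩ hx
        simp only [Finset.mem_filter, memR] at hx
        obtain rfl : v = d + 1 := by omega
        exact ⟨u, by simp only [Finset.mem_filter, Finset.mem_Icc]; exact
          ⟨hx.1.1.1.1, hx.1.1.2.2⟩, rfl⟩
  have f3 : (((R.filter (fun p => ¬ p.2 < c)).filter (fun p => ¬ d < p.2)).filter
      (fun p => b < p.1)).card = if b' = b then 0 else lineCount (fun v => z (b + 1) v) c d := by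
    split_ifs with h
    · rw [Finset.card_eq_zero, Finset.filter_eq_empty_iff]
      rintro ⟨u, v⟩ hx
      rw [Finset.mem_filter, Finset.mem_filter, memR] at hx
      simp only
      omega
    · symm
      unfold lineCount
      apply Finset.card_bij (fun v _ => (b + 1, v))
      · intro v hv
        simp only [Finset.mem_filter, Finset.mem_Icc, memR, OnRing] at hv ⊢
        exact ⟨⟨⟨⟨⟨by omega, by omega⟩, by omega, hv.2⟩, by omega⟩, by omega⟩, by omega⟩
      · intro u _ u' _ h
        simpa using h
      · rintro ⟨u, v⟩ hx
        simp only [Finset.mem_filter, memR] at hx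
        obtain rfl : u = b + 1 := by omega
        exact ⟨v, by simp only [Finset.mem_filter, Finset.mem_Icc]; exact
          ⟨⟨by omega, by omega⟩, hx.1.1.1.2.2⟩, rfl⟩
  have f4 : ((((R.filter (fun p => ¬ p.2 < c)).filter (fun p => ¬ d < p.2)).filter
      (fun p => ¬ b < p.1)).filter (fun p => p.1 < a)).card =
      if a' = a then 0 else lineCount (fun v => z (a - 1) v) c d := by
    split_ifs with h
    · rw [Finset.card_eq_zero, Finset.filter_eq_empty_iff]
      rintro ⟨u, v⟩ hx
      rw [Finset.mem_filter, Finset.mem_filter, Finset.mem_filter, memR] at hx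
      simp only
      omega
    · symm
      unfold lineCount
      apply Finset.card_bij (fun v _ => (a - 1, v))
      · intro v hv
        simp only [Finset.mem_filter, Finset.mem_Icc, memR, OnRing] at hv ⊢
        exact ⟨⟨⟨⟨⟨⟨by omega, by omega⟩, by omega, hv.2⟩, by omega⟩, by omega⟩, by omega⟩,
          by omega⟩
      · intro u _ u' _ h
        simpa using h
      · rintro ⟨u, v⟩ hx
        simp only [Finset.mem_filter, memR] at hx
        obtain rfl : u = a - 1 := by omega
        exact ⟨v, by simp only [Finset.mem_filter, Finset.mem_Icc]; exact
          ⟨⟨by omega, by omega⟩, hx.1.1.1.1.2.2⟩, rfl⟩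
  have f5 : (((R.filter (fun p => ¬ p.2 < c)).filter (fun p => ¬ d < p.2)).filter
      (fun p => ¬ b < p.1)).filter (fun p => ¬ p.1 < a) =
      (Finset.Icc a b ×ˢ Finset.Icc c d).filter
        (fun p => OnRing a' b' c' d' p.1 p.2 ∧ z p.1 p.2) := by
    ext ⟨u, v⟩
    simp only [Finset.mem_filter, memR, Finset.mem_product, Finset.mem_Icc]
    constructor
    · rintro ⟨⟨⟨⟨⟨h1, h2, h3⟩, h4⟩, h5⟩, h6⟩, h7⟩
      exact ⟨⟨⟨by omega, by omega⟩, by omega, by omega⟩, h2, h3⟩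
    · rintro ⟨h1, h2, h3⟩
      exact ⟨⟨⟨⟨⟨⟨⟨by omega, by omega⟩, by omega, by omega⟩, h2, h3⟩, by omega⟩, by omega⟩,
        by omega⟩, by omega⟩
  rw [f5] at e4
  omega

/-- The push away from the pivot `p`, undone. -/
def pull (p x : ℤ) : ℤ := if p < x then x - 1 else x + 1

/-- A pivot of the row `s` in `[l, h]`: a burning place, or, if there is none, an inner place of
the parity `par` of the next row. -/
def IsPivot (s par : ℤ → Prop) (l h p : ℤ) : Prop :=
  (s p ∧ l ≤ p ∧ p ≤ h ∧ ¬ par p) ∨ ((∀ x, l ≤ x → x ≤ h → ¬ s x) ∧ l < p ∧ p < h ∧ par p)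

/-- If nothing burns in the range, one of `l + 1` and `l + 2` has the right parity, and a length of
at least 3 makes both of them inner places. -/
theorem exists_isPivot {s : ℤ → Prop} {q l h : ℤ} (hlh : l + 3 ≤ h)
    (hs : ∀ x, s x → ¬ Even (x + q)) : ∃ p, IsPivot s (fun x => Even (x + q)) l h p := by
  by_cases hex : ∃ x, l ≤ x ∧ x ≤ h ∧ s x
  · obtain ⟨x, h1, h2, h3⟩ := hex
    exact ⟨x, Or.inl ⟨h3, h1, h2, hs x h3⟩⟩
  · push Not at hex
    by_cases he : Even (l + 1 + q)
    · exact ⟨l + 1, Or.inr ⟨hex, by omega, by omega, he⟩⟩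
    · refine ⟨l + 2, Or.inr ⟨hex, by omega, by omega, ?_⟩⟩
      show Even (l + 2 + q)
      rw [Int.not_even_iff] at he
      rw [Int.even_iff]
      omega

/-- The admissible bounds for the loss at a side of the ring that advances: `k`, `k'` and `q` are
the numbers of burning cells before and after the step, and of obstacles. -/
def IsSideLoss (k k' q : ℕ) (x : ℤ) : Prop := (k : ℤ) + 1 ≤ x + k' ∨ (0 < k ∧ (q : ℤ) ≤ x)

/-- Cells with unburnt pull-back are charged to the old side. The others arise by pushing the
burning cells away from the pivot; as the pivot is pushed both ways, there are at most one more of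
them than burning cells. This gives the first bound on the loss. If something burns, the pivot does,
and an unburnt cell whose pull-back burns is an obstacle; this gives the second. -/
theorem side_le {s₀ s₁ q par : ℤ → Prop} {l h l' h' p x : ℤ} (hl : l - 1 ≤ l') (hh : h' ≤ h + 1)
    (hp : IsPivot s₀ par l h p) (hs₁ : ∀ x, s₁ x → par x)
    (hq : ∀ x, s₀ (pull p x) → s₁ x ∨ q x)
    (hx : IsSideLoss (lineCount s₀ l h) (lineCount s₁ l' h') (lineCount q l' h') x) :
    (lineCount (fun x => par x ∧ ¬ s₁ x) l' h' : ℤ) ≤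
      lineCount (fun x => par x ∧ x ≠ p ∧ ¬ s₀ (pull p x)) l' h' + x := by
  classical
  rcases hx with hx | ⟨hk, hx⟩
  · have h1 : lineCount (fun x => par x ∧ ¬ s₁ x) l' h' + lineCount s₁ l' h' ≤
        lineCount par l' h' :=
      lineCount_add_lineCount_le (fun _ _ _ h => h.1) (fun x _ _ h => hs₁ x h) (fun _ h => h.2)
    have h2 : lineCount par l' h' ≤
        lineCount (fun x => par x ∧ x ≠ p ∧ ¬ s₀ (pull p x)) l' h' +
        lineCount (fun x => par x ∧ (x = p ∨ s₀ (pull p x))) l' h' := by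
      refine le_trans (lineCount_mono le_rfl le_rfl (fun x _ _ hx => ?_)) (lineCount_or_le _ _ _ _)
      tauto
    have h3 : lineCount (fun x => par x ∧ (x = p ∨ s₀ (pull p x))) l' h' ≤
        lineCount s₀ l h + 1 := by
      rcases hp with ⟨hp1, hp2, hp3, hp4⟩ | ⟨hp1, hp2, hp3, hp4⟩
      · have h4 : lineCount (fun x => par x ∧ (x = p ∨ s₀ (pull p x))) l' h' ≤
            (((Finset.Icc l h).filter s₀).image
              (fun y => if y < p then y - 1 else y + 1) ∪ {p - 1}).card := by
          apply Finset.card_le_card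
          intro x hx
          simp only [Finset.mem_filter, Finset.mem_Icc, Finset.mem_union, Finset.mem_image,
            Finset.mem_singleton] at hx ⊢
          obtain ⟨hx1, hx2, hx3⟩ := hx
          have hxp : x ≠ p := fun h => hp4 (h ▸ hx2)
          have hx4 : s₀ (pull p x) := hx3.resolve_left hxp
          by_cases hlt : p < x
          · left
            rw [pull, if_pos hlt] at hx4
            exact ⟨x - 1, ⟨⟨by omega, by omega⟩, hx4⟩, by rw [if_neg (by omega)]; ring⟩
          · rw [pull, if_neg hlt] at hx4
            by_cases hxx : x = p - 1
            · exact Or.inr hxx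
            · left
              exact ⟨x + 1, ⟨⟨by omega, by omega⟩, hx4⟩, by rw [if_pos (by omega)]; ring⟩
        refine h4.trans ((Finset.card_union_le _ _).trans ?_)
        simp only [Finset.card_singleton]
        exact Nat.add_le_add_right Finset.card_image_le 1
      · have h4 : lineCount (fun x => par x ∧ (x = p ∨ s₀ (pull p x))) l' h' ≤
            ({p} : Finset ℤ).card := by
          apply Finset.card_le_card
          intro x hx
          simp only [Finset.mem_filter, Finset.mem_Icc, Finset.mem_singleton] at hx ⊢
          obtain ⟨hx1, hx2, hx3⟩ := hx
          by_contra hxp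
          have hx4 : s₀ (pull p x) := hx3.resolve_left hxp
          refine hp1 _ ?_ ?_ hx4
          · unfold pull; split_ifs <;> omega
          · unfold pull; split_ifs <;> omega
        simpa using h4.trans (by simp)
    omega
  · have hp' : ¬ par p := by
      rcases hp with hp | hp
      · exact hp.2.2.2
      · obtain ⟨y, hy1, hy2, hy3⟩ := lineCount_pos.1 hk
        exact absurd hy3 (hp.1 y hy1 hy2)
    have h1 : lineCount (fun x => par x ∧ ¬ s₁ x) l' h' ≤
        lineCount (fun x => par x ∧ x ≠ p ∧ ¬ s₀ (pull p x)) l' h' + lineCount q l' h' := by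
      refine le_trans (lineCount_mono le_rfl le_rfl (fun x _ _ hx => ?_)) (lineCount_or_le _ _ _ _)
      by_cases h0 : s₀ (pull p x)
      · exact Or.inr ((hq x h0).resolve_left hx.2)
      · exact Or.inl ⟨hx.1, fun h => hp' (h ▸ hx.1), h0⟩
    omega

end

/-! ### Unburnt cells on the boundary of a growing rectangle: all four sides. -/

section

/-- Places next to the pivot are excluded, because the pivot burns or has the parity of `x`. So an
unburnt pull-back stays strictly on its side of the pivot. -/
theorem IsPivot.pull_cases {s : ℤ → Prop} {q l h p x : ℤ}
    (hp : IsPivot s (fun x => Even (x + q)) l h p) (hx : Even (x + q)) (hne : x ≠ p)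
    (hs : ¬ s (pull p x)) :
    (p + 1 < x ∧ pull p x = x - 1) ∨ (x < p - 1 ∧ pull p x = x + 1) := by
  rcases hp with ⟨hp1, -, -, -⟩ | ⟨-, -, -, hp1⟩
  · have : pull p x ≠ p := fun h => hs (by rw [h]; exact hp1)
    unfold pull at this ⊢
    split_ifs at this ⊢ <;> omega
  · have hp1 : Even (p + q) := hp1
    rw [Int.even_iff] at hx hp1
    unfold pull
    split_ifs <;> omega

theorem IsPivot.mem {s par : ℤ → Prop} {l h p : ℤ} (hp : IsPivot s par l h p) : l ≤ p ∧ p ≤ h := by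
  rcases hp with hp | hp
  · exact ⟨hp.2.1, hp.2.2.1⟩
  · exact ⟨hp.2.1.le, hp.2.2.1.le⟩

theorem innerCount_eq_add (z s : ℤ → ℤ → Prop) (a b c d a' b' c' d' : ℤ) :
    innerCount z a b c d a' b' c' d' =
      innerCount (fun u v => z u v ∧ ¬ s u v) a b c d a' b' c' d' +
      innerCount (fun u v => z u v ∧ s u v) a b c d a' b' c' d' := by
  classical
  unfold innerCount
  rw [← Finset.card_union_of_disjoint]
  · congr 1
    ext x
    simp only [Finset.mem_filter, Finset.mem_union]
    tauto
  · rw [Finset.disjoint_left]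
    intro x hx hx'
    simp only [Finset.mem_filter] at hx hx'
    tauto

theorem innerCount_congr {z s : ℤ → ℤ → Prop} {a b c d : ℤ} (a' b' c' d' : ℤ)
    (h : ∀ u v, a ≤ u → u ≤ b → c ≤ v → v ≤ d → (z u v ↔ s u v)) :
    innerCount z a b c d a' b' c' d' = innerCount s a b c d a' b' c' d' := by
  classical
  unfold innerCount
  congr 1
  ext ⟨u, v⟩
  simp only [Finset.mem_filter, Finset.mem_product, Finset.mem_Icc]
  constructor
  · rintro ⟨h1, h2, h3⟩
    exact ⟨h1, h2, (h u v h1.1.1 h1.1.2 h1.2.1 h1.2.2).1 h3⟩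
  · rintro ⟨h1, h2, h3⟩
    exact ⟨h1, h2, (h u v h1.1.1 h1.1.2 h1.2.1 h1.2.2).2 h3⟩

theorem lineCount_congr {s s' : ℤ → Prop} {l h : ℤ} (hs : ∀ x, l ≤ x → x ≤ h → (s x ↔ s' x)) :
    lineCount s l h = lineCount s' l h :=
  le_antisymm (lineCount_mono le_rfl le_rfl fun x h1 h2 => (hs x h1 h2).1)
    (lineCount_mono le_rfl le_rfl fun x h1 h2 => (hs x h1 h2).2)

/-- The admissible bounds for the loss at a side of the ring, which advances iff `adv`. -/
def IsLoss (adv : Prop) (k k' q : ℕ) (x : ℤ) : Prop :=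
  (adv → IsSideLoss k k' q x) ∧ (¬ adv → 0 ≤ x)

/-- The cell `(u, v)` on the boundary of an enlargement of the rectangle `[a, b] × [c, d]` is pulled
back to the cell `(u₁, v₁)` on the boundary of the rectangle itself, towards the given pivots. -/
def PullsTo (a b c d pS pN pE pW u v u₁ v₁ : ℤ) : Prop :=
  (v < c ∧ v₁ = c ∧ (pS + 1 < u ∧ u₁ = u - 1 ∨ u < pS - 1 ∧ u₁ = u + 1)) ∨
  (d < v ∧ v₁ = d ∧ (pN + 1 < u ∧ u₁ = u - 1 ∨ u < pN - 1 ∧ u₁ = u + 1)) ∨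
  (c ≤ v ∧ v ≤ d ∧ b < u ∧ u₁ = b ∧ (pE + 1 < v ∧ v₁ = v - 1 ∨ v < pE - 1 ∧ v₁ = v + 1)) ∨
  (c ≤ v ∧ v ≤ d ∧ u < a ∧ u₁ = a ∧ (pW + 1 < v ∧ v₁ = v - 1 ∨ v < pW - 1 ∧ v₁ = v + 1)) ∨
  (a ≤ u ∧ u ≤ b ∧ c ≤ v ∧ v ≤ d ∧ u₁ = u ∧ v₁ = v)

-- Moving strictly towards an inner pivot, a cell of an advanced side can land on a corner of the
-- old rectangle only if it is the new corner diagonally outside. Hence pull-backs from different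
-- sides, and cells that stay in place, never collide.
set_option maxHeartbeats 1000000 in
theorem PullsTo.injective {a b c d a' b' c' d' pS pN pE pW u v w y u₁ v₁ : ℤ}
    (ha : a' = a ∨ a' = a - 1) (hb : b' = b ∨ b' = b + 1) (hc : c' = c ∨ c' = c - 1)
    (hd : d' = d ∨ d' = d + 1) (hab : a + 3 ≤ b) (hcd : c + 3 ≤ d)
    (hS : a ≤ pS ∧ pS ≤ b) (hN : a ≤ pN ∧ pN ≤ b) (hE : c ≤ pE ∧ pE ≤ d) (hW : c ≤ pW ∧ pW ≤ d)
    (hu : a' ≤ u) (hu' : u ≤ b') (hv : c' ≤ v) (hv' : v ≤ d') (hr : OnRing a' b' c' d' u v)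
    (hw : a' ≤ w) (hw' : w ≤ b') (hy : c' ≤ y) (hy' : y ≤ d') (hr' : OnRing a' b' c' d' w y)
    (h : PullsTo a b c d pS pN pE pW u v u₁ v₁) (h' : PullsTo a b c d pS pN pE pW w y u₁ v₁) :
    u = w ∧ v = y := by
  unfold OnRing at hr hr'
  unfold PullsTo at h h'
  rcases h with h | h | h | h | h <;> rcases h' with h' | h' | h' | h' | h' <;> omega

/-- The number of unburnt boundary cells of a growing rectangle, in a single layer. -/
theorem ringCount_step {π : ℤ} {b₀ b₁ q : ℤ → ℤ → Prop} {a b c d a' b' c' d' xS xN xE xW : ℤ}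
    (ha : a' = a ∨ a' = a - 1) (hb : b' = b ∨ b' = b + 1) (hc : c' = c ∨ c' = c - 1)
    (hd : d' = d ∨ d' = d + 1) (hab : a + 3 ≤ b) (hcd : c + 3 ≤ d)
    (hlat₀ : ∀ u v, b₀ u v → Even (u + v + π)) (hlat₁ : ∀ u v, b₁ u v → Even (u + v + π))
    (hmono : ∀ u v, b₀ u v → b₁ u v)
    (hdiag : ∀ u v, b₀ u v → ∀ ε ε' : ℤ, (ε = 1 ∨ ε = -1) → (ε' = 1 ∨ ε' = -1) →
      b₁ (u + ε) (v + ε') ∨ q (u + ε) (v + ε'))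
    (hS : IsLoss (c' ≠ c) (lineCount (fun u => b₀ u c) a b)
      (lineCount (fun u => b₁ u (c - 1)) a' b') (lineCount (fun u => q u (c - 1)) a' b') xS)
    (hN : IsLoss (d' ≠ d) (lineCount (fun u => b₀ u d) a b)
      (lineCount (fun u => b₁ u (d + 1)) a' b') (lineCount (fun u => q u (d + 1)) a' b') xN)
    (hE : IsLoss (b' ≠ b) (lineCount (fun v => b₀ b v) c d)
      (lineCount (fun v => b₁ (b + 1) v) c d) (lineCount (fun v => q (b + 1) v) c d) xE)
    (hW : IsLoss (a' ≠ a) (lineCount (fun v => b₀ a v) c d)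
      (lineCount (fun v => b₁ (a - 1) v) c d) (lineCount (fun v => q (a - 1) v) c d) xW) :
    (ringCount (fun u v => Even (u + v + π) ∧ ¬ b₁ u v) a' b' c' d' : ℤ) +
      innerCount (fun u v => (Even (u + v + π) ∧ ¬ b₀ u v) ∧ b₁ u v) a b c d a' b' c' d' ≤
      ringCount (fun u v => Even (u + v + π) ∧ ¬ b₀ u v) a b c d + xS + xN + xE + xW := by
  classical
  obtain ⟨pS, hpS⟩ := exists_isPivot (s := fun u => b₀ u c) (q := c - 1 + π) (l := a) (h := b) hab
    (fun x hx => by have := hlat₀ _ _ hx; rw [Int.even_iff] at this ⊢; omega)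
  obtain ⟨pN, hpN⟩ := exists_isPivot (s := fun u => b₀ u d) (q := d + 1 + π) (l := a) (h := b) hab
    (fun x hx => by have := hlat₀ _ _ hx; rw [Int.even_iff] at this ⊢; omega)
  obtain ⟨pE, hpE⟩ := exists_isPivot (s := fun v => b₀ b v) (q := b + 1 + π) (l := c) (h := d) hcd
    (fun x hx => by have := hlat₀ _ _ hx; rw [Int.even_iff] at this ⊢; omega)
  obtain ⟨pW, hpW⟩ := exists_isPivot (s := fun v => b₀ a v) (q := a - 1 + π) (l := c) (h := d) hcd
    (fun x hx => by have := hlat₀ _ _ hx; rw [Int.even_iff] at this ⊢; omega)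
  have hmS := hpS.mem
  have hmN := hpN.mem
  have hmE := hpE.mem
  have hmW := hpW.mem
  -- `g` pulls the new ring back to the old one, each advanced side towards its pivot, and `z`
  -- selects the cells that `g` sends to unburnt ones. Injectivity bounds `z` by the old unburnt
  -- ring, and `side_le` compares the new unburnt ring with `z` side by side.
  let g : ℤ × ℤ → ℤ × ℤ := fun p =>
    if p.2 < c then (pull pS p.1, c) else if d < p.2 then (pull pN p.1, d)
    else if b < p.1 then (b, pull pE p.2) else if p.1 < a then (a, pull pW p.2) else p
  let z : ℤ → ℤ → Prop := fun u v => Even (u + v + π) ∧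
    (if v < c then u ≠ pS ∧ ¬ b₀ (pull pS u) c else if d < v then u ≠ pN ∧ ¬ b₀ (pull pN u) d
    else if b < u then v ≠ pE ∧ ¬ b₀ b (pull pE v) else if u < a then v ≠ pW ∧ ¬ b₀ a (pull pW v)
    else ¬ b₀ u v)
  have hgc : ∀ u v, z u v → a' ≤ u → u ≤ b' → c' ≤ v → v ≤ d' →
      PullsTo a b c d pS pN pE pW u v (g (u, v)).1 (g (u, v)).2 := by
    rintro u v ⟨he, hz⟩ hu hu' hv hv'
    unfold PullsTo
    simp only [g]
    split_ifs at hz ⊢ with h1 h2 h3 h4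
    · exact Or.inl ⟨h1, rfl, hpS.pull_cases (by rw [Int.even_iff] at he ⊢; omega) hz.1 hz.2⟩
    · exact Or.inr (Or.inl ⟨h2, rfl,
        hpN.pull_cases (by rw [Int.even_iff] at he ⊢; omega) hz.1 hz.2⟩)
    · exact Or.inr (Or.inr (Or.inl ⟨by omega, by omega, h3, rfl,
        hpE.pull_cases (by rw [Int.even_iff] at he ⊢; omega) hz.1 hz.2⟩))
    · exact Or.inr (Or.inr (Or.inr (Or.inl ⟨by omega, by omega, h4, rfl,
        hpW.pull_cases (by rw [Int.even_iff] at he ⊢; omega) hz.1 hz.2⟩)))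
    · exact Or.inr (Or.inr (Or.inr (Or.inr ⟨by omega, by omega, by omega, by omega, rfl, rfl⟩)))
  have hgz : ∀ u v, z u v → a' ≤ u → u ≤ b' → c' ≤ v → v ≤ d' →
      Even ((g (u, v)).1 + (g (u, v)).2 + π) ∧ ¬ b₀ (g (u, v)).1 (g (u, v)).2 := by
    intro u v hz hu hu' hv hv'
    refine ⟨?_, ?_⟩
    · have he := hz.1
      have hh := hgc u v hz hu hu' hv hv'
      unfold PullsTo at hh
      rw [Int.even_iff] at he ⊢
      omega
    · have hz := hz.2
      simp only [g]
      split_ifs at hz ⊢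
      · exact hz.2
      · exact hz.2
      · exact hz.2
      · exact hz.2
      · exact hz
  have key : ringCount z a' b' c' d' ≤
      ringCount (fun u v => Even (u + v + π) ∧ ¬ b₀ u v) a b c d := by
    unfold ringCount
    apply Finset.card_le_card_of_injOn g
    · rintro ⟨u, v⟩ hx
      simp only [Finset.coe_filter, Finset.mem_product, Finset.mem_Icc, Set.mem_ofPred_eq] at hx ⊢
      obtain ⟨⟨⟨hu, hu'⟩, hv, hv'⟩, hr, hz⟩ := hx
      have hh := hgc u v hz hu hu' hv hv'
      unfold PullsTo at hh
      unfold OnRing at hr ⊢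
      exact ⟨⟨⟨by omega, by omega⟩, by omega, by omega⟩, by omega, hgz u v hz hu hu' hv hv'⟩
    · rintro ⟨u, v⟩ hx ⟨w, y⟩ hy hxy
      simp only [Finset.coe_filter, Finset.mem_product, Finset.mem_Icc, Set.mem_ofPred_eq] at hx hy
      obtain ⟨⟨⟨hu, hu'⟩, hv, hv'⟩, hr, hz⟩ := hx
      obtain ⟨⟨⟨hw, hw'⟩, hy, hy'⟩, hr', hz'⟩ := hy
      have hh := hgc u v hz hu hu' hv hv'
      have hh' := hgc w y hz' hw hw' hy hy'
      rw [← hxy] at hh'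
      have := PullsTo.injective ha hb hc hd hab hcd hmS hmN hmE hmW hu hu' hv hv' hr hw hw' hy hy' hr'
        hh hh'
      rw [this.1, this.2]
  rw [ringCount_split z ha hb hc hd (by omega) (by omega)] at key
  rw [ringCount_split _ ha hb hc hd (by omega) (by omega)]
  have iz : innerCount z a b c d a' b' c' d' =
      innerCount (fun u v => Even (u + v + π) ∧ ¬ b₀ u v) a b c d a' b' c' d' := by
    apply innerCount_congr
    intro u v h1 h2 h3 h4
    simp only [z]
    rw [if_neg (by omega), if_neg (by omega), if_neg (by omega), if_neg (by omega)]
  have i1 := innerCount_eq_add (fun u v => Even (u + v + π) ∧ ¬ b₀ u v) b₁ a b c d a' b' c' d'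
  have i2 : innerCount (fun u v => (Even (u + v + π) ∧ ¬ b₀ u v) ∧ ¬ b₁ u v) a b c d a' b' c' d' =
      innerCount (fun u v => Even (u + v + π) ∧ ¬ b₁ u v) a b c d a' b' c' d' :=
    innerCount_congr _ _ _ _ (fun u v _ _ _ _ => by have := hmono u v; tauto)
  have sS : (↑(if c' = c then 0 else
      lineCount (fun u => Even (u + (c - 1) + π) ∧ ¬ b₁ u (c - 1)) a' b') : ℤ) ≤
      ↑(if c' = c then 0 else lineCount (fun u => z u (c - 1)) a' b') + xS := by
    split_ifs with h
    · simpa using hS.2 (by simpa using h)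
    · have := side_le (q := fun u => q u (c - 1)) (s₁ := fun u => b₁ u (c - 1)) (l' := a') (h' := b')
        (by omega) (by omega) hpS
        (fun x hx => by have := hlat₁ _ _ hx; rwa [add_assoc] at this)
        (fun x hx => ?_) (hS.1 h)
      · refine (Int.ofNat_le.2 (lineCount_congr ?_).le).trans (this.trans
          (add_le_add_left (Int.ofNat_le.2 (lineCount_congr ?_).le) _))
        · intro x _ _
          rw [add_assoc]
        · intro x _ _
          simp only [z]
          rw [if_pos (by omega), add_assoc x]
      · have h1 := hdiag _ _ hx
        unfold pull at h1
        split_ifs at h1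
        · simpa [sub_eq_add_neg] using h1 1 (-1) (Or.inl rfl) (Or.inr rfl)
        · simpa [sub_eq_add_neg] using h1 (-1) (-1) (Or.inr rfl) (Or.inr rfl)
  have sN : (↑(if d' = d then 0 else
      lineCount (fun u => Even (u + (d + 1) + π) ∧ ¬ b₁ u (d + 1)) a' b') : ℤ) ≤
      ↑(if d' = d then 0 else lineCount (fun u => z u (d + 1)) a' b') + xN := by
    split_ifs with h
    · simpa using hN.2 (by simpa using h)
    · have := side_le (q := fun u => q u (d + 1)) (s₁ := fun u => b₁ u (d + 1)) (l' := a') (h' := b')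
        (by omega) (by omega) hpN
        (fun x hx => by have := hlat₁ _ _ hx; rwa [add_assoc] at this)
        (fun x hx => ?_) (hN.1 h)
      · refine (Int.ofNat_le.2 (lineCount_congr ?_).le).trans (this.trans
          (add_le_add_left (Int.ofNat_le.2 (lineCount_congr ?_).le) _))
        · intro x _ _
          rw [add_assoc]
        · intro x _ _
          simp only [z]
          rw [if_neg (by omega), if_pos (by omega), add_assoc x]
      · have h1 := hdiag _ _ hx
        unfold pull at h1
        split_ifs at h1
        · simpa using h1 1 1 (Or.inl rfl) (Or.inl rfl)
        · simpa using h1 (-1) 1 (Or.inr rfl) (Or.inl rfl)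
  have sE : (↑(if b' = b then 0 else
      lineCount (fun v => Even (b + 1 + v + π) ∧ ¬ b₁ (b + 1) v) c d) : ℤ) ≤
      ↑(if b' = b then 0 else lineCount (fun v => z (b + 1) v) c d) + xE := by
    split_ifs with h
    · simpa using hE.2 (by simpa using h)
    · have := side_le (q := fun v => q (b + 1) v) (s₁ := fun v => b₁ (b + 1) v) (l' := c) (h' := d)
        (by omega) (by omega) hpE
        (fun x hx => by have := hlat₁ _ _ hx; rwa [add_comm (b + 1), add_assoc] at this)
        (fun x hx => ?_) (hE.1 h)
      · refine (Int.ofNat_le.2 (lineCount_congr ?_).le).trans (this.trans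
          (add_le_add_left (Int.ofNat_le.2 (lineCount_congr ?_).le) _))
        · intro x _ _
          rw [add_comm (b + 1), add_assoc]
        · intro x _ _
          simp only [z]
          rw [if_neg (by omega), if_neg (by omega), if_pos (by omega),
            add_comm (b + 1) x, add_assoc x]
      · have h1 := hdiag _ _ hx
        unfold pull at h1
        split_ifs at h1
        · simpa using h1 1 1 (Or.inl rfl) (Or.inl rfl)
        · simpa using h1 1 (-1) (Or.inl rfl) (Or.inr rfl)
  have sW : (↑(if a' = a then 0 else
      lineCount (fun v => Even (a - 1 + v + π) ∧ ¬ b₁ (a - 1) v) c d) : ℤ) ≤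
      ↑(if a' = a then 0 else lineCount (fun v => z (a - 1) v) c d) + xW := by
    split_ifs with h
    · simpa using hW.2 (by simpa using h)
    · have := side_le (q := fun v => q (a - 1) v) (s₁ := fun v => b₁ (a - 1) v) (l' := c) (h' := d)
        (by omega) (by omega) hpW
        (fun x hx => by have := hlat₁ _ _ hx; rwa [add_comm (a - 1), add_assoc] at this)
        (fun x hx => ?_) (hW.1 h)
      · refine (Int.ofNat_le.2 (lineCount_congr ?_).le).trans (this.trans
          (add_le_add_left (Int.ofNat_le.2 (lineCount_congr ?_).le) _))
        · intro x _ _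
          rw [add_comm (a - 1), add_assoc]
        · intro x _ _
          simp only [z]
          rw [if_neg (by omega), if_neg (by omega), if_neg (by omega), if_pos (by omega),
            add_comm (a - 1) x, add_assoc x]
      · have h1 := hdiag _ _ hx
        unfold pull at h1
        split_ifs at h1
        · simpa [sub_eq_add_neg] using h1 (-1) 1 (Or.inr rfl) (Or.inl rfl)
        · simpa [sub_eq_add_neg] using h1 (-1) (-1) (Or.inr rfl) (Or.inr rfl)
  omega

end

/-! ### The sizes of two opposite fronts. -/

section

variable {Λ : Type*} [Fintype Λ]

/-- The number of cells of the row `v` with `u ∈ [a, b]`. -/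
noncomputable def rowSum (S : Λ → ℤ → ℤ → Prop) (v a b : ℤ) : ℕ :=
  ∑ i, lineCount (fun u => S i u v) a b

/-- The number of cells of the column `u` with `v ∈ [c, d]`. -/
noncomputable def colSum (S : Λ → ℤ → ℤ → Prop) (u c d : ℤ) : ℕ :=
  ∑ i, lineCount (fun v => S i u v) c d

theorem rectCount_eq_rowSum (S : Λ → ℤ → ℤ → Prop) (a b c : ℤ) :
    rectCount S a b c c = rowSum S c a b := rectCount_row S a b c

theorem rectCount_eq_colSum (S : Λ → ℤ → ℤ → Prop) (a c d : ℤ) :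
    rectCount S a a c d = colSum S a c d := rectCount_col S a c d

/-- The obstacles in the cells gained by a growing rectangle. -/
theorem rectCount_grow (Q : Λ → ℤ → ℤ → Prop) {a b c d a' b' c' d' : ℤ}
    (ha : a' = a ∨ a' = a - 1) (hb : b' = b ∨ b' = b + 1) (hc : c' = c ∨ c' = c - 1)
    (hd : d' = d ∨ d' = d + 1) (hab : a ≤ b) (hcd : c ≤ d) :
    rectCount Q a' b' c' d' = rectCount Q a b c d +
      (if c' = c then 0 else rowSum Q (c - 1) a' b') +
      (if d' = d then 0 else rowSum Q (d + 1) a' b') +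
      (if b' = b then 0 else colSum Q (b + 1) c d) +
      (if a' = a then 0 else colSum Q (a - 1) c d) := by
  have e1 : rectCount Q a' b' c' d' =
      (if c' = c then 0 else rowSum Q (c - 1) a' b') + rectCount Q a' b' c d' := by
    split_ifs with h
    · rw [h, zero_add]
    · obtain rfl : c' = c - 1 := by omega
      rw [rectCount_split_right Q a' b' (m := c - 1) (by omega) (by omega), rectCount_eq_rowSum,
        sub_add_cancel]
  have e2 : rectCount Q a' b' c d' =
      (if d' = d then 0 else rowSum Q (d + 1) a' b') + rectCount Q a' b' c d := by
    split_ifs with h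
    · rw [h, zero_add]
    · obtain rfl : d' = d + 1 := by omega
      rw [rectCount_split_right Q a' b' (m := d) (by omega) (by omega), rectCount_eq_rowSum,
        add_comm]
  have e3 : rectCount Q a' b' c d =
      (if a' = a then 0 else colSum Q (a - 1) c d) + rectCount Q a b' c d := by
    split_ifs with h
    · rw [h, zero_add]
    · obtain rfl : a' = a - 1 := by omega
      rw [rectCount_split_left Q (m := a - 1) _ _ (by omega) (by omega), rectCount_eq_colSum,
        sub_add_cancel]
  have e4 : rectCount Q a b' c d =
      (if b' = b then 0 else colSum Q (b + 1) c d) + rectCount Q a b c d := by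
    split_ifs with h
    · rw [h, zero_add]
    · obtain rfl : b' = b + 1 := by omega
      rw [rectCount_split_left Q (m := b) _ _ (by omega) (by omega), rectCount_eq_colSum,
        add_comm]
  omega

open Classical in
/-- The number of layers that burn somewhere in a row. -/
noncomputable def liveLayers (S : Λ → ℤ → ℤ → Prop) (v a b : ℤ) : ℕ :=
  ∑ i, if 0 < lineCount (fun u => S i u v) a b then 1 else 0

open Classical in
/-- The number of layers in which a given cell burns. -/
noncomputable def cellCount (S : Λ → ℤ → ℤ → Prop) (u v : ℤ) : ℕ :=
  ∑ i, if S i u v then 1 else 0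

theorem cellCount_le (S : Λ → ℤ → ℤ → Prop) (u v : ℤ) : cellCount S u v ≤ Fintype.card Λ := by
  classical
  unfold cellCount
  rw [← Finset.card_univ, Finset.card_eq_sum_ones]
  exact Finset.sum_le_sum fun i _ => by split_ifs <;> simp

/-- An advancing row grows in every layer that is not empty, except if it touches a waiting side. -/
theorem rowSum_growth {B B' Q : Λ → ℤ → ℤ → Prop} {v w a b a' b' : ℤ} (ha : a' ≤ a) (hb : b ≤ b')
    (hdiag : ∀ i u, B i u v → ∀ ε : ℤ, (ε = 1 ∨ ε = -1) → B' i (u + ε) w ∨ Q i (u + ε) w) :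
    rowSum B v a b + liveLayers B v a b ≤ rowSum B' w a' b' + rowSum Q w a' b' +
      (if a' = a then cellCount B a v else 0) + (if b' = b then cellCount B b v else 0) := by
  classical
  unfold rowSum liveLayers cellCount
  have : ∀ i, lineCount (fun u => B i u v) a b +
      (if 0 < lineCount (fun u => B i u v) a b then 1 else 0) ≤
      lineCount (fun u => B' i u w) a' b' + lineCount (fun u => Q i u w) a' b' +
      (if a' = a then (if B i a v then 1 else 0) else 0) +
      (if b' = b then (if B i b v then 1 else 0) else 0) := by
    intro i
    by_cases hp : 0 < lineCount (fun u => B i u v) a b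
    · have := lineCount_growth (s' := fun u => B' i u w) (q := fun u => Q i u w) ha hb
        (fun x hx => by simpa [sub_eq_add_neg] using hdiag i x hx (-1) (Or.inr rfl))
        (fun x hx => hdiag i x hx 1 (Or.inl rfl)) hp
      rw [ite_and, ite_and] at this
      rw [if_pos hp]
      exact this
    · rw [if_neg hp]
      omega
  have h2 := Finset.sum_le_sum (s := Finset.univ) fun i _ => this i
  simp only [Finset.sum_add_distrib] at h2
  split_ifs at h2 ⊢ <;> try simp only [Finset.sum_const_zero] at h2
  all_goals exact h2

/-- A waiting column gains the corner cells passed by the advancing rows. -/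
theorem colSum_wait {B B' : Λ → ℤ → ℤ → Prop} {a c d c' d' : ℤ} (hcd : c < d)
    (hc : c' = c ∨ c' = c - 1) (hd : d' = d ∨ d' = d + 1) (hmono : ∀ i u v, B i u v → B' i u v) :
    colSum B a (c + 1) (d - 1) + (if c' = c then 0 else cellCount B a c) +
      (if d' = d then 0 else cellCount B a d) ≤ colSum B' a (c' + 1) (d' - 1) := by
  classical
  have h1 : colSum B a (c' + 1) (d' - 1) ≤ colSum B' a (c' + 1) (d' - 1) :=
    Finset.sum_le_sum fun i _ => lineCount_mono le_rfl le_rfl fun x _ _ h => hmono i a x h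
  have hcell : ∀ v, colSum B a v v = cellCount B a v := by
    intro v
    refine Finset.sum_congr rfl fun i _ => ?_
    unfold lineCount
    rw [Finset.Icc_self, Finset.filter_singleton]
    split_ifs <;> simp
  refine le_trans (le_of_eq ?_) h1
  have e1 : colSum B a (c' + 1) (d' - 1) = (if c' = c then 0 else cellCount B a c) +
      colSum B a (c + 1) (d' - 1) := by
    split_ifs with h
    · rw [h, zero_add]
    · obtain rfl : c' = c - 1 := by omega
      rw [← hcell, ← rectCount_eq_colSum, ← rectCount_eq_colSum, ← rectCount_eq_colSum,
        rectCount_split_right B a a (m := c) (by omega) (by omega), sub_add_cancel]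
  have e2 : colSum B a (c + 1) (d' - 1) = (if d' = d then 0 else cellCount B a d) +
      colSum B a (c + 1) (d - 1) := by
    split_ifs with h
    · rw [h, zero_add]
    · obtain rfl : d' = d + 1 := by omega
      rw [← hcell, ← rectCount_eq_colSum, ← rectCount_eq_colSum, ← rectCount_eq_colSum,
        rectCount_split_right B a a (c := c + 1) (m := d - 1) (by omega) (by omega),
        sub_add_cancel, add_sub_cancel_right, add_comm]
  omega

/-- An advancing column loses nothing, up to obstacles, unless both rows wait. -/
theorem colSum_advance {B B' Q : Λ → ℤ → ℤ → Prop} {a w c d c' d' : ℤ}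
    (hc : c' = c ∨ c' = c - 1) (hd : d' = d ∨ d' = d + 1)
    (hdiag : ∀ i v, B i a v → ∀ ε : ℤ, (ε = 1 ∨ ε = -1) → B' i w (v + ε) ∨ Q i w (v + ε)) :
    colSum B a (c + 1) (d - 1) ≤ colSum B' w (c' + 1) (d' - 1) + colSum Q w c d +
      (if c' = c ∧ d' = d then Fintype.card Λ else 0) := by
  classical
  have hmain : ∀ i, lineCount (fun v => B i a v) (c + 1) (d - 1) ≤
      lineCount (fun v => B' i w v) (c' + 1) (d' - 1) + lineCount (fun v => Q i w v) c d +
        (if c' = c ∧ d' = d then 1 else 0) := by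
    intro i
    have key : ∀ ε : ℤ, (ε = 1 ∨ ε = -1) → lineCount (fun v => B i a v) (c + 1) (d - 1) ≤
        lineCount (fun v => B' i w v) (c + 1 + ε) (d - 1 + ε) + lineCount (fun v => Q i w v) c d := by
      intro ε hε
      rw [← lineCount_shift _ (c + 1) (d - 1) ε]
      have h1 : lineCount (fun v => B i a (v - ε)) (c + 1 + ε) (d - 1 + ε) ≤
          lineCount (fun v => B' i w v ∨ Q i w v) (c + 1 + ε) (d - 1 + ε) := by
        refine lineCount_mono le_rfl le_rfl fun v _ _ hv => ?_
        simpa using hdiag i _ hv ε hε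
      refine h1.trans ((lineCount_or_le _ _ _ _).trans (Nat.add_le_add_left ?_ _))
      exact lineCount_mono (by omega) (by omega) fun v _ _ hv => hv
    rcases hc with hc | hc
    · rcases hd with hd | hd
      · rw [if_pos ⟨hc, hd⟩]
        have h1 := key (-1) (Or.inr rfl)
        have h2 : lineCount (fun v => B' i w v) (c + 1 + -1) (d - 1 + -1) ≤
            lineCount (fun v => B' i w v) (c' + 1) (d' - 1) + 1 := by
          have h3 := lineCount_or_le (fun v => v = c) (fun v => c' + 1 ≤ v ∧ v ≤ d' - 1 ∧ B' i w v)
            (c + 1 + -1) (d - 1 + -1)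
          have h4 : lineCount (fun v => B' i w v) (c + 1 + -1) (d - 1 + -1) ≤
            lineCount (fun v => v = c ∨ c' + 1 ≤ v ∧ v ≤ d' - 1 ∧ B' i w v) (c + 1 + -1)
              (d - 1 + -1) := by
            refine lineCount_mono le_rfl le_rfl fun v h5 h6 hv => ?_
            by_cases hvc : v = c
            · exact Or.inl hvc
            · exact Or.inr ⟨by omega, by omega, hv⟩
          have h5 : lineCount (fun v => v = c) (c + 1 + -1) (d - 1 + -1) ≤ 1 := by
            unfold lineCount
            rw [Finset.card_le_one]
            intro x hx y hy
            simp only [Finset.mem_filter] at hx hy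
            omega
          have h6 : lineCount (fun v => c' + 1 ≤ v ∧ v ≤ d' - 1 ∧ B' i w v) (c + 1 + -1)
              (d - 1 + -1) ≤ lineCount (fun v => B' i w v) (c' + 1) (d' - 1) := by
            unfold lineCount
            apply Finset.card_le_card
            intro x hx
            simp only [Finset.mem_filter, Finset.mem_Icc] at hx ⊢
            exact ⟨⟨hx.2.1, hx.2.2.1⟩, hx.2.2.2⟩
          omega
        omega
      · have h1 := key 1 (Or.inl rfl)
        have h2 : lineCount (fun v => B' i w v) (c + 1 + 1) (d - 1 + 1) ≤
            lineCount (fun v => B' i w v) (c' + 1) (d' - 1) :=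
          lineCount_mono (by omega) (by omega) fun v _ _ hv => hv
        omega
    · have h1 := key (-1) (Or.inr rfl)
      have h2 : lineCount (fun v => B' i w v) (c + 1 + -1) (d - 1 + -1) ≤
          lineCount (fun v => B' i w v) (c' + 1) (d' - 1) :=
        lineCount_mono (by omega) (by omega) fun v _ _ hv => hv
      omega
  have h2 := Finset.sum_le_sum (s := Finset.univ) fun i _ => hmain i
  simp only [Finset.sum_add_distrib] at h2
  unfold colSum
  split_ifs at h2 ⊢ <;> simpa using h2

/-- The contribution of a column to `oppositeSum`: its size, cut off by the obstacles near it. -/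
noncomputable def cutCol (B Q : Λ → ℤ → ℤ → Prop) (M : ℕ) (a w₁ w₂ c d : ℤ) : ℕ :=
  min (rectCount Q w₁ w₂ c d + M) (colSum B a (c + 1) (d - 1))

/-- A waiting column takes over the corner cells that the advancing rows lose there. The cut-off
does not swallow them: without alignment a waiting column is shut, and `M` leaves room for two more
cells per layer. When the column advances, `hcover` says that obstacles leaving the strip beside it
lie on the new column, which becomes part of the rectangle. -/
theorem cutCol_step {B B' Q Q' : Λ → ℤ → ℤ → Prop} {M N : ℕ} {a a' w₁ w₂ w₁' w₂' c d c' d' : ℤ}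
    {wait align : Prop} [Decidable wait] [Decidable align]
    (hcd : c < d) (hc : c' = c ∨ c' = c - 1) (hd : d' = d ∨ d' = d + 1)
    (hmono : ∀ i u v, B i u v → B' i u v) (hmonoQ : ∀ i u v, Q i u v → Q' i u v)
    (hM : N + 2 * Fintype.card Λ ≤ M)
    (hw : wait → a' = a ∧ w₁' = w₁ ∧ w₂' = w₂)
    (hshut : wait → ¬ align → colSum B a c d ≤ rectCount Q w₁ w₂ c d + N)
    (hadv : ¬ wait → (∀ i v, B i a v → ∀ ε : ℤ, (ε = 1 ∨ ε = -1) →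
      B' i a' (v + ε) ∨ Q' i a' (v + ε)))
    (hcover : ¬ wait → rectCount Q w₁ w₂ c d ≤ rectCount Q' w₁' w₂' c d + colSum Q' a' c d) :
    cutCol B Q M a w₁ w₂ c d +
      (if wait then (if c' = c then 0 else cellCount B a c) +
        (if d' = d then 0 else cellCount B a d) else 0) ≤
      cutCol B' Q' M a' w₁' w₂' c' d' + (if wait then 0 else colSum Q' a' c d) +
        (if align then 2 * Fintype.card Λ else 0) +
        (if c' = c ∧ d' = d then Fintype.card Λ else 0) := by
  have hcol : colSum B a (c + 1) (d - 1) ≤ colSum B a c d :=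
    Finset.sum_le_sum fun i _ => lineCount_mono (by omega) (by omega) fun _ _ _ h => h
  have hq : ∀ x y, rectCount Q' x y c d ≤ rectCount Q' x y c' d' := fun x y =>
    rectCount_mono (fun _ _ _ h => h) le_rfl le_rfl (by omega) (by omega)
  have hq' : ∀ x y, rectCount Q x y c d ≤ rectCount Q' x y c d := fun x y =>
    rectCount_mono hmonoQ le_rfl le_rfl le_rfl le_rfl
  unfold cutCol
  by_cases h : wait
  · obtain ⟨rfl, rfl, rfl⟩ := hw h
    have h1 := colSum_wait (a := a') hcd hc hd hmono
    have h2 := cellCount_le B a' c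
    have h3 := cellCount_le B a' d
    have h4 := hq w₁' w₂'
    have h5 := hq' w₁' w₂'
    rw [if_pos h, if_pos h]
    by_cases hal : align
    · rw [if_pos hal]
      split_ifs at h1 ⊢ <;> omega
    · have h6 := hshut h hal
      rw [if_neg hal]
      split_ifs at h1 ⊢ <;> omega
  · have h1 := colSum_advance hc hd (hadv h)
    have h2 := hcover h
    have h4 := hq w₁' w₂'
    rw [if_neg h, if_neg h]
    split_ifs at h1 ⊢ <;> omega

/-- The size of the lower and the upper row of a rectangle, with the obstacles inside and at the
other two sides. -/
noncomputable def oppositeSum (B Q : Λ → ℤ → ℤ → Prop) (M : ℕ) (a b c d : ℤ) : ℕ :=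
  rowSum B c a b + rowSum B d a b + rectCount Q a b c d +
    cutCol B Q M a (a - Fintype.card Λ) (a - 1) c d +
    cutCol B Q M b (b + 1) (b + Fintype.card Λ) c d

/-- An advancing row gains one cell in each live layer. What it loses to obstacles reappears as
obstacles inside the rectangle, and what it loses at an end next to a waiting column reappears in
`cutCol`. -/
theorem oppositeSum_step {B B' Q Q' : Λ → ℤ → ℤ → Prop} {M N : ℕ} {a b c d a' b' c' d' : ℤ}
    {alignW alignE : Prop} [Decidable alignW] [Decidable alignE]
    (ha : a' = a ∨ a' = a - 1) (hb : b' = b ∨ b' = b + 1) (hc : c' = c ∨ c' = c - 1)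
    (hd : d' = d ∨ d' = d + 1) (hab : a ≤ b) (hcd : c < d)
    (hmono : ∀ i u v, B i u v → B' i u v) (hmonoQ : ∀ i u v, Q i u v → Q' i u v)
    (hdiag : ∀ i u v, B i u v → ∀ ε ε' : ℤ, (ε = 1 ∨ ε = -1) → (ε' = 1 ∨ ε' = -1) →
      B' i (u + ε) (v + ε') ∨ Q' i (u + ε) (v + ε'))
    (hM : N + 2 * Fintype.card Λ ≤ M)
    (hW : a' = a → ¬ alignW →
      colSum B a c d ≤ rectCount Q (a - Fintype.card Λ) (a - 1) c d + N)
    (hE : b' = b → ¬ alignE →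
      colSum B b c d ≤ rectCount Q (b + 1) (b + Fintype.card Λ) c d + N) :
    oppositeSum B Q M a b c d + (if c' = c then 0 else liveLayers B c a b) +
      (if d' = d then 0 else liveLayers B d a b) ≤
      oppositeSum B' Q' M a' b' c' d' + (if alignW then 2 * Fintype.card Λ else 0) +
        (if alignE then 2 * Fintype.card Λ else 0) +
        (if c' = c ∧ d' = d then 2 * Fintype.card Λ else 0) := by
  have h1 := cutCol_step (a := a) (a' := a') (w₁ := a - Fintype.card Λ) (w₂ := a - 1)
    (w₁' := a' - Fintype.card Λ) (w₂' := a' - 1) (wait := a' = a) (align := alignW) hcd hc hd hmono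
    hmonoQ hM (fun h => by simp [h]) hW
    (fun h i v hv ε hε => by
      obtain rfl : a' = a - 1 := by omega
      exact hdiag i a v hv (-1) ε (Or.inr rfl) hε)
    (fun h => by
      obtain rfl : a' = a - 1 := by omega
      have h2 := rectCount_split_left Q' (a := a - 1 - Fintype.card Λ) (m := a - 1 - 1) (b := a - 1)
        c d (by omega) (by omega)
      rw [sub_add_cancel, rectCount_eq_colSum] at h2
      rw [← h2]
      exact rectCount_mono hmonoQ (by omega) le_rfl le_rfl le_rfl)
  have h2 := cutCol_step (a := b) (a' := b') (w₁ := b + 1) (w₂ := b + Fintype.card Λ)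
    (w₁' := b' + 1) (w₂' := b' + Fintype.card Λ) (wait := b' = b) (align := alignE) hcd hc hd hmono
    hmonoQ hM (fun h => by simp [h]) hE
    (fun h i v hv ε hε => by
      obtain rfl : b' = b + 1 := by omega
      exact hdiag i b v hv 1 ε (Or.inl rfl) hε)
    (fun h => by
      obtain rfl : b' = b + 1 := by omega
      have h2 := rectCount_split_left Q' (a := b + 1) (m := b + 1) (b := b + 1 + Fintype.card Λ)
        c d (by omega) (by omega)
      rw [rectCount_eq_colSum] at h2
      rw [add_comm (rectCount Q' _ _ _ _), ← h2]
      exact rectCount_mono hmonoQ le_rfl (by omega) le_rfl le_rfl)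
  have hQ := rectCount_grow Q' ha hb hc hd hab hcd.le
  have hQ0 : rectCount Q a b c d ≤ rectCount Q' a b c d :=
    rectCount_mono hmonoQ le_rfl le_rfl le_rfl le_rfl
  have hS : rowSum B c a b + (if c' = c then 0 else liveLayers B c a b) ≤
      rowSum B' c' a' b' + (if c' = c then 0 else rowSum Q' (c - 1) a' b' +
      (if a' = a then cellCount B a c else 0) + (if b' = b then cellCount B b c else 0)) := by
    split_ifs with h
    · rw [h]
      exact Finset.sum_le_sum fun i _ => lineCount_mono (by omega) (by omega) fun u _ _ => hmono i u c
    all_goals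
      obtain rfl : c' = c - 1 := by omega
      have h3 := rowSum_growth (B := B) (B' := B') (Q := Q') (v := c) (w := c - 1) (a := a) (b := b)
        (a' := a') (b' := b') (by omega) (by omega)
        (fun i u hu ε hε => hdiag i u c hu ε (-1) hε (Or.inr rfl))
      split_ifs at h3
      omega
  have hN : rowSum B d a b + (if d' = d then 0 else liveLayers B d a b) ≤
      rowSum B' d' a' b' + (if d' = d then 0 else rowSum Q' (d + 1) a' b' +
      (if a' = a then cellCount B a d else 0) + (if b' = b then cellCount B b d else 0)) := by
    split_ifs with h
    · rw [h]
      exact Finset.sum_le_sum fun i _ => lineCount_mono (by omega) (by omega) fun u _ _ => hmono i u d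
    all_goals
      obtain rfl : d' = d + 1 := by omega
      have h3 := rowSum_growth (B := B) (B' := B') (Q := Q') (v := d) (w := d + 1) (a := a) (b := b)
        (a' := a') (b' := b') (by omega) (by omega)
        (fun i u hu ε hε => hdiag i u d hu ε 1 hε (Or.inl rfl))
      split_ifs at h3
      omega
  unfold oppositeSum
  have eA : (if a' = a then 0 else colSum Q' a' c d) = if a' = a then 0 else colSum Q' (a - 1) c d := by
    split_ifs with h
    · rfl
    · rw [show a' = a - 1 by omega]
  have eB : (if b' = b then 0 else colSum Q' b' c d) = if b' = b then 0 else colSum Q' (b + 1) c d := by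
    split_ifs with h
    · rfl
    · rw [show b' = b + 1 by omega]
  rw [eA] at h1
  rw [eB] at h2
  clear eA eB hW hE hdiag
  by_cases p1 : a' = a <;> by_cases p2 : b' = b <;> by_cases p3 : c' = c <;> by_cases p4 : d' = d <;>
    simp only [p1, p2, p3, p4, if_true, if_false, and_true, and_false] at * <;>
    omega

end

/-! ### The balance of a single front. -/

section

variable {Λ : Type*} [Fintype Λ]

theorem IsLoss.congr {adv adv' : Prop} {k k' q : ℕ} {x : ℤ} (h : IsLoss adv k k' q x)
    (ha : adv' ↔ adv) : IsLoss adv' k k' q x := by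
  rwa [IsLoss, ha]

section Front

variable {Γ : SimpleGraph Λ} {δ : Λ → Λ → ℤ} {β κ : ℕ → Λ → ℤ → ℤ → Prop}

variable (Γ δ β κ) in
/-- The steps of a front that may cost the fire something: waiting for other layers, and steps of a
chain. -/
def Wasting (t : ℕ) (r l h : ℤ) (n : ℕ) : Prop :=
  Aligning Γ δ β κ t r l h ∨
    (Advancing Γ δ β κ t r l h n ∧ ¬ (n = 0 ∧ Full β t r l h))

open Classical in
/-- The balance of a front: its loss at the ring is paid for by obstacles and by the chain. -/
theorem exists_isLoss {t : ℕ} {r l h l' h' : ℤ} {n : ℕ} (hn : n ≤ Fintype.card Λ) (hl : l' ≤ l)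
    (hh : h ≤ h') : ∃ x : Λ → ℤ,
    (∀ i, IsLoss (Advancing Γ δ β κ t r l h n) (rowCount β t r l h i)
      (rowCount β (t + 1) (r + 1) l' h' i) (rowCount κ (t + 1) (r + 1) l' h' i) (x i)) ∧
    ∑ i, x i + 7 * Fintype.card Λ * n +
        6 * Fintype.card Λ * (if Wasting Γ δ β κ t r l h n then 1 else 0) ≤
      (if Advancing Γ δ β κ t r l h n then
        ((∑ i, rowCount κ (t + 1) (r + 1) l' h' i : ℕ) : ℤ) else 0) +
      7 * Fintype.card Λ * nextChain Γ δ β κ t r l h n +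
      (if Aligning Γ δ β κ t r l h then
        7 * (Fintype.card Λ * Fintype.card Λ) + 6 * Fintype.card Λ else 0) := by
  set H := Fintype.card Λ with hH
  have hn' : 7 * (H : ℤ) * n ≤ 7 * (H * H) := by
    have : H * n ≤ H * H := Nat.mul_le_mul_left _ hn
    have : (H : ℤ) * n ≤ H * H := by exact_mod_cast this
    linarith
  by_cases hadv : Advancing Γ δ β κ t r l h n
  swap
  -- A waiting front loses nothing at the ring. Aligning forfeits the credit of a chain, at most
  -- `7H²`, and counts as waste worth `6H`; both go into the last term.
  · refine ⟨fun _ => 0, fun i => ⟨fun h => absurd h hadv, fun _ => le_rfl⟩, ?_⟩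
    by_cases hal : Aligning Γ δ β κ t r l h
    · rw [if_neg hadv, if_pos hal, if_pos (show Wasting Γ δ β κ t r l h n from Or.inl hal)]
      simp only [Finset.sum_const_zero, nextChain, if_pos hal]
      push_cast
      linarith
    · have hnz : n = 0 := by
        by_contra h0
        exact hadv ⟨hal, Or.inl (Nat.pos_of_ne_zero h0)⟩
      rw [if_neg hadv, if_neg hal, if_neg (show ¬ Wasting Γ δ β κ t r l h n from fun h => h.elim hal fun h => hadv h.1)]
      simp only [Finset.sum_const_zero, hnz]
      have : (0 : ℤ) ≤ 7 * H * (nextChain Γ δ β κ t r l h 0 : ℕ) := by positivity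
      simpa using this
  have hal := hadv.1
  simp only [if_pos hadv, if_neg hal, Nat.cast_zero, add_zero]
  set k := fun i => rowCount β t r l h i with hk
  set k' := fun i => rowCount β (t + 1) (r + 1) l' h' i with hk'
  set q := fun i => rowCount κ (t + 1) (r + 1) l' h' i with hq
  -- When every layer burns, the loss is only the obstacles met, and they enter the rectangle.
  by_cases hgood : n = 0 ∧ Full β t r l h
  · refine ⟨fun i => q i, fun i => ⟨fun _ => Or.inr ⟨hgood.2 i, le_rfl⟩, fun h => absurd hadv h⟩, ?_⟩
    rw [if_neg (show ¬ Wasting Γ δ β κ t r l h n from fun h => h.elim hal fun h => h.2 hgood), hgood.1]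
    have : (0 : ℤ) ≤ 7 * H * (nextChain Γ δ β κ t r l h 0 : ℕ) := by positivity
    push_cast
    linarith
  rw [if_pos (show Wasting Γ δ β κ t r l h n from Or.inr ⟨hadv, hgood⟩)]
  have hns : ¬ (n = 0 ∧ (Shut β κ t r l h ∨ Full β t r l h)) := by
    rintro ⟨h0, h1 | h1⟩
    · rcases hadv.2 with h2 | h2
      · omega
      · exact h2 h1
    · exact hgood ⟨h0, h1⟩
  -- The default loss: the obstacles where the layer burns, and at most one cell where it does not.
  let y : Λ → ℤ := fun i => if 0 < k i then (q i : ℤ) else 1 - k' i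
  have hy : ∀ i, IsSideLoss (k i) (k' i) (q i) (y i) := by
    intro i
    by_cases h0 : 0 < k i
    · simp only [y, if_pos h0]
      exact Or.inr ⟨h0, le_rfl⟩
    · simp only [y, if_neg h0]
      left
      omega
  have hyq : ∀ i, y i ≤ q i + 1 := by
    intro i
    simp only [y]
    split_ifs <;> omega
  by_cases hgain : Gaining β κ t r l h
  · simp only [nextChain, if_neg hal, if_neg hns, if_pos hgain]
    obtain ⟨i₀, hi₀⟩ := hgain
    have hi₁ : k i₀ + gainBound H ≤ k' i₀ + q i₀ :=
      hi₀.trans (Nat.add_le_add (lineCount_mono hl hh fun _ _ _ h => h)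
        (lineCount_mono hl hh fun _ _ _ h => h))
    -- In the gaining layer the true change of size is used instead. It is negative enough to repay
    -- the credit `7Hn`, the waste `6H` and one cell for each layer.
    let x : Λ → ℤ := fun i => if i = i₀ then k i + 1 - k' i else y i
    refine ⟨x, fun i => ⟨fun _ => ?_, fun h => absurd hadv h⟩, ?_⟩
    · by_cases h0 : i = i₀
      · simp only [x, if_pos h0]
        exact Or.inl (by simp only [hk, hk']; omega)
      · simp only [x, if_neg h0]
        exact hy i
    · have h1 : ((q i₀ : ℤ) + 1 - x i₀) ≤ ∑ i, ((q i : ℤ) + 1 - x i) := by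
        apply Finset.single_le_sum (f := fun i => ((q i : ℤ) + 1 - x i)) _ (Finset.mem_univ i₀)
        intro i _
        by_cases h0 : i = i₀
        · simp only [x, if_pos h0]
          subst h0
          unfold gainBound at hi₁
          omega
        · simp only [x, if_neg h0]
          have := hyq i
          omega
      rw [Finset.sum_sub_distrib, Finset.sum_add_distrib] at h1
      simp only [Finset.sum_const, Finset.card_univ, nsmul_eq_mul, mul_one, x, if_true,
        ← hH] at h1
      unfold gainBound at hi₁
      have h2 : ((k i₀ : ℕ) : ℤ) + (28 * (H * H) + 25 * H + 1) ≤ k' i₀ + q i₀ := by exact_mod_cast hi₁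
      push_cast
      have h3 : (0 : ℤ) ≤ (H : ℤ) * H := by positivity
      simp only [x]
      linarith
  -- The chain gets longer: the new credit `7H` is the waste `6H` plus one lost cell for each of the
  -- `H` layers.
  · simp only [nextChain, if_neg hal, if_neg hns, if_neg hgain]
    refine ⟨y, fun i => ⟨fun _ => hy i, fun h => absurd hadv h⟩, ?_⟩
    have h1 : ∑ i, y i ≤ ∑ i, ((q i : ℤ) + 1) := Finset.sum_le_sum fun i _ => hyq i
    rw [Finset.sum_add_distrib] at h1
    simp only [Finset.sum_const, Finset.card_univ, nsmul_eq_mul, mul_one, ← hH] at h1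
    push_cast
    linarith

end Front

theorem lineCount_le_innerCount_row {s : ℤ → Prop} {z : ℤ → ℤ → Prop} {a b c d a' b' c' d' v : ℤ}
    (hv : c ≤ v ∧ v ≤ d) (hv' : v = c' ∨ v = d') (hs : ∀ x, s x → z x v) :
    lineCount s a b ≤ innerCount z a b c d a' b' c' d' := by
  classical
  unfold lineCount innerCount
  apply Finset.card_le_card_of_injOn (fun x => (x, v))
  · intro x hx
    simp only [Finset.coe_filter, Finset.mem_Icc, Finset.mem_product, Set.mem_ofPred_eq] at hx ⊢
    refine ⟨⟨hx.1, hv⟩, ?_, hs x hx.2⟩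
    unfold OnRing
    tauto
  · intro x _ y _ h
    simpa using h

theorem lineCount_le_innerCount_col {s : ℤ → Prop} {z : ℤ → ℤ → Prop} {a b c d a' b' c' d' u : ℤ}
    (hu : a ≤ u ∧ u ≤ b) (hu' : u = a' ∨ u = b') (hs : ∀ x, s x → z u x) :
    lineCount s c d ≤ innerCount z a b c d a' b' c' d' := by
  classical
  unfold lineCount innerCount
  apply Finset.card_le_card_of_injOn (fun x => (u, x))
  · intro x hx
    simp only [Finset.coe_filter, Finset.mem_Icc, Finset.mem_product, Set.mem_ofPred_eq] at hx ⊢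
    refine ⟨⟨hu, hx.1⟩, ?_, hs x hx.2⟩
    unfold OnRing
    tauto
  · intro x _ y _ h
    simpa using h

end

/-! ### Four fronts at once, and the ledger. -/

section

variable {Λ : Type*} [Fintype Λ]

/-- The number of unburnt cells on the boundary of a rectangle. -/
noncomputable def ringSum (π : Λ → ℤ) (S : Λ → ℤ → ℤ → Prop) (a b c d : ℤ) : ℕ :=
  ∑ i, ringCount (fun u v => Even (u + v + π i) ∧ ¬ S i u v) a b c d

/-- The lower end of a front, where `p F` is the distance of the front `F` from the origin. -/
def frontLow (p : Fin 4 → ℤ) (F : Fin 4) : ℤ := ![-p 3, -p 3, -p 0, -p 0] F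

/-- The upper end of a front. -/
def frontHigh (p : Fin 4 → ℤ) (F : Fin 4) : ℤ := ![p 2, p 2, p 1, p 1] F

section Fronts

variable (Γ : SimpleGraph Λ) (δ : Λ → Λ → ℤ) (B Q : ℕ → Λ → ℤ → ℤ → Prop)

/-- `Aligning` for one of the fronts at the distances `p`. -/
def FrontAligning (t : ℕ) (p : Fin 4 → ℤ) (F : Fin 4) : Prop :=
  Aligning Γ δ (fun t => view F (B t)) (fun t => view F (Q t)) t (p F) (frontLow p F)
    (frontHigh p F)

/-- `Shut` for one of the fronts at the distances `p`. -/
def FrontShut (t : ℕ) (p : Fin 4 → ℤ) (F : Fin 4) : Prop :=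
  Shut (fun t => view F (B t)) (fun t => view F (Q t)) t (p F) (frontLow p F) (frontHigh p F)

/-- `Full` for one of the fronts at the distances `p`. -/
def FrontFull (t : ℕ) (p : Fin 4 → ℤ) (F : Fin 4) : Prop :=
  Full (fun t => view F (B t)) t (p F) (frontLow p F) (frontHigh p F)

/-- `Advancing` for one of the fronts at the distances `p`, with chains `n`. -/
def FrontAdvancing (t : ℕ) (p : Fin 4 → ℤ) (n : Fin 4 → ℕ) (F : Fin 4) : Prop :=
  Advancing Γ δ (fun t => view F (B t)) (fun t => view F (Q t)) t (p F) (frontLow p F)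
    (frontHigh p F) (n F)

/-- `Blocked` for one of the fronts at the distances `p`, with chains `n`. -/
def FrontBlocked (t : ℕ) (p : Fin 4 → ℤ) (n : Fin 4 → ℕ) (F : Fin 4) : Prop :=
  Blocked Γ δ (fun t => view F (B t)) (fun t => view F (Q t)) t (p F) (frontLow p F)
    (frontHigh p F) (n F)

/-- `Wasting` for one of the fronts at the distances `p`, with chains `n`. -/
def FrontWasting (t : ℕ) (p : Fin 4 → ℤ) (n : Fin 4 → ℕ) (F : Fin 4) : Prop :=
  Wasting Γ δ (fun t => view F (B t)) (fun t => view F (Q t)) t (p F) (frontLow p F)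
    (frontHigh p F) (n F)

open Classical in
/-- The distances of the fronts after a step. -/
noncomputable def nextPos (t : ℕ) (p : Fin 4 → ℤ) (n : Fin 4 → ℕ) (F : Fin 4) : ℤ :=
  if FrontAdvancing Γ δ B Q t p n F then p F + 1 else p F

/-- The chains of the fronts after a step. -/
noncomputable def nextChains (t : ℕ) (p : Fin 4 → ℤ) (n : Fin 4 → ℕ) (F : Fin 4) : ℕ :=
  nextChain Γ δ (fun t => view F (B t)) (fun t => view F (Q t)) t (p F) (frontLow p F)
    (frontHigh p F) (n F)

/-- The number of cells in the rectangle between the fronts. -/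
noncomputable def boxCount (S : Λ → ℤ → ℤ → Prop) (p : Fin 4 → ℤ) : ℕ :=
  rectCount S (-p 3) (p 2) (-p 0) (p 1)

/-- The obstacles inside, against the unburnt boundary, with a credit for chains. -/
noncomputable def ledger (π : Λ → ℤ) (t : ℕ) (p : Fin 4 → ℤ) (n : Fin 4 → ℕ) : ℤ :=
  boxCount (Q t) p - ringSum π (B t) (-p 3) (p 2) (-p 0) (p 1) + 7 * Fintype.card Λ * ∑ F, (n F : ℤ)

open Classical in
/-- The number of fronts with a wasting step. -/
noncomputable def waste (t : ℕ) (p : Fin 4 → ℤ) (n : Fin 4 → ℕ) : ℕ :=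
  ∑ F, if FrontWasting Γ δ B Q t p n F then 1 else 0

end Fronts

variable {Γ : SimpleGraph Λ} {π : Λ → ℤ} {δ : Λ → Λ → ℤ} {B Q : ℕ → Λ → ℤ → ℤ → Prop}

theorem nextPos_cases (t : ℕ) (p : Fin 4 → ℤ) (n : Fin 4 → ℕ) (F : Fin 4) :
    nextPos Γ δ B Q t p n F = p F ∨ nextPos Γ δ B Q t p n F = p F + 1 := by
  unfold nextPos
  split_ifs <;> simp

theorem nextPos_ne_iff {t : ℕ} {p : Fin 4 → ℤ} {n : Fin 4 → ℕ} {F : Fin 4} :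
    nextPos Γ δ B Q t p n F ≠ p F ↔ FrontAdvancing Γ δ B Q t p n F := by
  unfold nextPos
  split_ifs with h <;> simp [h]

theorem neg_nextPos_ne_iff {t : ℕ} {p : Fin 4 → ℤ} {n : Fin 4 → ℕ} {F : Fin 4} :
    -nextPos Γ δ B Q t p n F ≠ -p F ↔ FrontAdvancing Γ δ B Q t p n F := by
  rw [Ne, neg_inj, ← nextPos_ne_iff]

theorem nextPos_eq_iff {t : ℕ} {p : Fin 4 → ℤ} {n : Fin 4 → ℕ} {F : Fin 4} :
    nextPos Γ δ B Q t p n F = p F ↔ ¬ FrontAdvancing Γ δ B Q t p n F := by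
  rw [← nextPos_ne_iff, not_not]

/-- Cells that start burning in the row of an aligning front. -/
theorem Fire.le_newly_of_aligning (hf : Fire Γ π δ B Q) {t : ℕ} {p : Fin 4 → ℤ} {n : Fin 4 → ℕ}
    (hw : -p 3 ≤ p 2) (hh : -p 0 ≤ p 1) {F : Fin 4} (hF : FrontAligning Γ δ B Q t p F) :
    gainBound (Fintype.card Λ) ≤ ∑ i, innerCount
      (fun u v => (Even (u + v + π i) ∧ ¬ B t i u v) ∧ B (t + 1) i u v)
      (-p 3) (p 2) (-p 0) (p 1) (-nextPos Γ δ B Q t p n 3) (nextPos Γ δ B Q t p n 2)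
      (-nextPos Γ δ B Q t p n 0) (nextPos Γ δ B Q t p n 1) := by
  have hstay : nextPos Γ δ B Q t p n F = p F := if_neg fun h => h.1 hF
  refine le_trans hF (Finset.sum_le_sum fun j _ => ?_)
  -- An exposed cell is not among the obstacles even with lookahead, so it burns after this step.
  have hex : ∀ x, Exposed Γ δ (fun t => view F (B t)) (fun t => view F (Q t)) t (p F)
      (frontLow p F) (frontHigh p F) j x →
      ¬ view F (B t) j x (p F) ∧ view F (B (t + 1)) j x (p F) := by
    rintro x ⟨h1, h2, i, hij, -, -, h3⟩
    have h4 := (hf.front F).cross t t (by omega) i j hij _ _ h3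
    rw [sub_add_cancel] at h4
    exact ⟨h1, h4.resolve_right h2⟩
  fin_cases F
  · refine lineCount_le_innerCount_row (v := -p 0) ⟨le_rfl, hh⟩
      (Or.inl (congrArg Neg.neg hstay.symm)) fun x hx => ?_
    have := hex x hx
    exact ⟨⟨hf.lat _ _ _ _ this.2, this.1⟩, this.2⟩
  · refine lineCount_le_innerCount_row (v := p 1) ⟨hh, le_rfl⟩ (Or.inr hstay.symm) fun x hx => ?_
    have := hex x hx
    exact ⟨⟨hf.lat _ _ _ _ this.2, this.1⟩, this.2⟩
  · refine lineCount_le_innerCount_col (u := p 2) ⟨hw, le_rfl⟩ (Or.inr hstay.symm) fun x hx => ?_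
    have := hex x hx
    exact ⟨⟨hf.lat _ _ _ _ this.2, this.1⟩, this.2⟩
  · refine lineCount_le_innerCount_col (u := -p 3) ⟨le_rfl, hw⟩
      (Or.inl (congrArg Neg.neg hstay.symm)) fun x hx => ?_
    have := hex x hx
    exact ⟨⟨hf.lat _ _ _ _ this.2, this.1⟩, this.2⟩

/-- New obstacles in the rectangle offset the losses at the ring, and the gains that end chains
repay their credit. What remains is a profit of `6H` for every wasting front. -/
theorem Fire.ledger_step (hf : Fire Γ π δ B Q) {t : ℕ} {p : Fin 4 → ℤ} {n : Fin 4 → ℕ}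
    (hw : -p 3 + 3 ≤ p 2) (hh : -p 0 + 3 ≤ p 1) (hn : ∀ F, n F ≤ Fintype.card Λ) :
    ledger B Q π t p n + 6 * Fintype.card Λ * waste Γ δ B Q t p n ≤
      ledger B Q π (t + 1) (nextPos Γ δ B Q t p n) (nextChains Γ δ B Q t p n) := by
  classical
  set p' := nextPos Γ δ B Q t p n with hp'
  have hc0 := nextPos_cases (Γ := Γ) (δ := δ) (B := B) (Q := Q) t p n 0
  have hc1 := nextPos_cases (Γ := Γ) (δ := δ) (B := B) (Q := Q) t p n 1
  have hc2 := nextPos_cases (Γ := Γ) (δ := δ) (B := B) (Q := Q) t p n 2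
  have hc3 := nextPos_cases (Γ := Γ) (δ := δ) (B := B) (Q := Q) t p n 3
  rw [← hp'] at hc0 hc1 hc2 hc3
  obtain ⟨x0, hx0, hs0⟩ := exists_isLoss (Γ := Γ) (δ := δ) (β := fun t => view 0 (B t))
    (κ := fun t => view 0 (Q t)) (t := t) (r := p 0) (l := -p 3) (h := p 2) (l' := -p' 3)
    (h' := p' 2) (hn 0) (by omega) (by omega)
  obtain ⟨x1, hx1, hs1⟩ := exists_isLoss (Γ := Γ) (δ := δ) (β := fun t => view 1 (B t))
    (κ := fun t => view 1 (Q t)) (t := t) (r := p 1) (l := -p 3) (h := p 2) (l' := -p' 3)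
    (h' := p' 2) (hn 1) (by omega) (by omega)
  -- Columns keep their old range here, since the new corners already belong to the rows.
  obtain ⟨x2, hx2, hs2⟩ := exists_isLoss (Γ := Γ) (δ := δ) (β := fun t => view 2 (B t))
    (κ := fun t => view 2 (Q t)) (t := t) (r := p 2) (l := -p 0) (h := p 1) (l' := -p 0)
    (h' := p 1) (hn 2) (by omega) (by omega)
  obtain ⟨x3, hx3, hs3⟩ := exists_isLoss (Γ := Γ) (δ := δ) (β := fun t => view 3 (B t))
    (κ := fun t => view 3 (Q t)) (t := t) (r := p 3) (l := -p 0) (h := p 1) (l' := -p 0)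
    (h' := p 1) (hn 3) (by omega) (by omega)
  have e0 : -(p 0 + 1) = -p 0 - 1 := by ring
  have e3 : -(p 3 + 1) = -p 3 - 1 := by ring
  replace hs0 : ∑ i, x0 i + 7 * Fintype.card Λ * n 0 +
      6 * Fintype.card Λ * (if FrontWasting Γ δ B Q t p n 0 then 1 else 0) ≤
      (if FrontAdvancing Γ δ B Q t p n 0 then
        (rowSum (Q (t + 1)) (-p 0 - 1) (-p' 3) (p' 2) : ℤ) else 0) +
      7 * Fintype.card Λ * nextChains Γ δ B Q t p n 0 +
      (if FrontAligning Γ δ B Q t p 0 then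
        7 * (Fintype.card Λ * Fintype.card Λ) + 6 * Fintype.card Λ else 0 : ℕ) := by
    rw [← e0]; exact hs0
  replace hs1 : ∑ i, x1 i + 7 * Fintype.card Λ * n 1 +
      6 * Fintype.card Λ * (if FrontWasting Γ δ B Q t p n 1 then 1 else 0) ≤
      (if FrontAdvancing Γ δ B Q t p n 1 then
        (rowSum (Q (t + 1)) (p 1 + 1) (-p' 3) (p' 2) : ℤ) else 0) +
      7 * Fintype.card Λ * nextChains Γ δ B Q t p n 1 +
      (if FrontAligning Γ δ B Q t p 1 then
        7 * (Fintype.card Λ * Fintype.card Λ) + 6 * Fintype.card Λ else 0 : ℕ) := hs1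
  replace hs2 : ∑ i, x2 i + 7 * Fintype.card Λ * n 2 +
      6 * Fintype.card Λ * (if FrontWasting Γ δ B Q t p n 2 then 1 else 0) ≤
      (if FrontAdvancing Γ δ B Q t p n 2 then
        (colSum (Q (t + 1)) (p 2 + 1) (-p 0) (p 1) : ℤ) else 0) +
      7 * Fintype.card Λ * nextChains Γ δ B Q t p n 2 +
      (if FrontAligning Γ δ B Q t p 2 then
        7 * (Fintype.card Λ * Fintype.card Λ) + 6 * Fintype.card Λ else 0 : ℕ) := hs2
  replace hs3 : ∑ i, x3 i + 7 * Fintype.card Λ * n 3 +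
      6 * Fintype.card Λ * (if FrontWasting Γ δ B Q t p n 3 then 1 else 0) ≤
      (if FrontAdvancing Γ δ B Q t p n 3 then
        (colSum (Q (t + 1)) (-p 3 - 1) (-p 0) (p 1) : ℤ) else 0) +
      7 * Fintype.card Λ * nextChains Γ δ B Q t p n 3 +
      (if FrontAligning Γ δ B Q t p 3 then
        7 * (Fintype.card Λ * Fintype.card Λ) + 6 * Fintype.card Λ else 0 : ℕ) := by
    rw [← e3]; exact hs3
  simp only [rowCount, view, neg_add, ← sub_eq_add_neg] at hx0 hx1 hx2 hx3
  have hring : ∀ i, _ := fun i => ringCount_step (π := π i) (b₀ := B t i) (b₁ := B (t + 1) i)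
    (q := Q (t + 1) i) (a := -p 3) (b := p 2) (c := -p 0) (d := p 1) (a' := -p' 3) (b' := p' 2)
    (c' := -p' 0) (d' := p' 1) (by omega) (by omega) (by omega) (by omega) hw hh
    (fun u v => hf.lat t i u v) (fun u v => hf.lat (t + 1) i u v) (fun u v => hf.monoB t i u v)
    (fun u v hb ε ε' h1 h2 => (hf.diag t t (by omega) i u v hb ε ε' h1 h2).imp_right
      (hf.monoQ t i _ _))
    ((hx0 i).congr neg_nextPos_ne_iff) ((hx1 i).congr nextPos_ne_iff)
    ((hx2 i).congr nextPos_ne_iff) ((hx3 i).congr neg_nextPos_ne_iff)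
  have hsum := Finset.sum_le_sum (s := Finset.univ) fun i _ => hring i
  simp only [Finset.sum_add_distrib] at hsum
  have hbox := rectCount_grow (Q (t + 1)) (a := -p 3) (b := p 2) (c := -p 0) (d := p 1)
    (a' := -p' 3) (b' := p' 2) (c' := -p' 0) (d' := p' 1) (by omega) (by omega) (by omega)
    (by omega) (by omega) (by omega)
  have hbox0 : rectCount (Q t) (-p 3) (p 2) (-p 0) (p 1) ≤
      rectCount (Q (t + 1)) (-p 3) (p 2) (-p 0) (p 1) :=
    rectCount_mono (hf.monoQ t) le_rfl le_rfl le_rfl le_rfl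
  have hite : ∀ (F : Fin 4) (x e e' : ℤ), (e' ≠ e ↔ FrontAdvancing Γ δ B Q t p n F) →
      (if e' = e then 0 else x) = if FrontAdvancing Γ δ B Q t p n F then x else 0 := by
    intro F x e e' h
    rw [← ite_not, if_congr h rfl rfl]
  zify at hbox hbox0
  rw [hite 0 _ _ (-p' 0) neg_nextPos_ne_iff, hite 1 _ _ (p' 1) nextPos_ne_iff, hite 2 _ _ (p' 2) nextPos_ne_iff,
    hite 3 _ _ (-p' 3) neg_nextPos_ne_iff] at hbox
  unfold ledger waste boxCount ringSum
  simp only [Fin.sum_univ_four]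
  push_cast
  -- All four fronts may align at once, at a cost of `28H² + 24H`. The newly burning cells of a
  -- single aligning front already suffice, by the choice of `gainBound`.
  have hpay : ((if FrontAligning Γ δ B Q t p 0 then
        7 * (Fintype.card Λ * Fintype.card Λ) + 6 * Fintype.card Λ else 0 : ℕ) : ℤ) +
      (if FrontAligning Γ δ B Q t p 1 then
        7 * (Fintype.card Λ * Fintype.card Λ) + 6 * Fintype.card Λ else 0 : ℕ) +
      (if FrontAligning Γ δ B Q t p 2 then
        7 * (Fintype.card Λ * Fintype.card Λ) + 6 * Fintype.card Λ else 0 : ℕ) +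
      (if FrontAligning Γ δ B Q t p 3 then
        7 * (Fintype.card Λ * Fintype.card Λ) + 6 * Fintype.card Λ else 0 : ℕ) ≤
      ∑ i, (innerCount (fun u v => (Even (u + v + π i) ∧ ¬ B t i u v) ∧ B (t + 1) i u v)
        (-p 3) (p 2) (-p 0) (p 1) (-p' 3) (p' 2) (-p' 0) (p' 1) : ℤ) := by
    by_cases hex : ∃ F, FrontAligning Γ δ B Q t p F
    · obtain ⟨F, hF⟩ := hex
      have h1 := hf.le_newly_of_aligning (n := n) (by omega) (by omega) hF
      zify at h1
      refine le_trans ?_ h1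
      rw [gainBound]
      have h2 : (0 : ℤ) ≤ (Fintype.card Λ : ℤ) * Fintype.card Λ := by positivity
      have h3 : (0 : ℤ) ≤ (Fintype.card Λ : ℤ) := by positivity
      push_cast
      split_ifs <;> linarith
    · push Not at hex
      simp only [hex, if_false]
      positivity
  linarith

end

/-! ### Growth of the vertical and the horizontal sum. -/

section

variable {Λ : Type*} [Fintype Λ]

variable {Γ : SimpleGraph Λ} {π : Λ → ℤ} {δ : Λ → Λ → ℤ} {B Q : ℕ → Λ → ℤ → ℤ → Prop}

section Shut

variable {t : ℕ} {p : Fin 4 → ℤ}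

theorem FrontShut.bottom (h : FrontShut B Q t p 0) : rowSum (B t) (-p 0) (-p 3) (p 2) ≤
    rectCount (Q t) (-p 3) (p 2) (-p 0 - Fintype.card Λ) (-p 0 - 1) +
      leakBound (Fintype.card Λ) := by
  have h1 : rowSum (B t) (-p 0) (-p 3) (p 2) ≤
      rectCount (fun i x r => Q t i x (-r)) (-p 3) (p 2) (p 0 + 1) (p 0 + Fintype.card Λ) +
        leakBound (Fintype.card Λ) := h
  rwa [rectCount_neg_right, neg_add, neg_add, ← sub_eq_add_neg, ← sub_eq_add_neg] at h1

theorem FrontShut.top (h : FrontShut B Q t p 1) : rowSum (B t) (p 1) (-p 3) (p 2) ≤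
    rectCount (Q t) (-p 3) (p 2) (p 1 + 1) (p 1 + Fintype.card Λ) +
      leakBound (Fintype.card Λ) := h

theorem FrontShut.right (h : FrontShut B Q t p 2) : colSum (B t) (p 2) (-p 0) (p 1) ≤
    rectCount (Q t) (p 2 + 1) (p 2 + Fintype.card Λ) (-p 0) (p 1) +
      leakBound (Fintype.card Λ) := by
  rw [← rectCount_swap]
  exact h

theorem FrontShut.left (h : FrontShut B Q t p 3) : colSum (B t) (-p 3) (-p 0) (p 1) ≤
    rectCount (Q t) (-p 3 - Fintype.card Λ) (-p 3 - 1) (-p 0) (p 1) +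
      leakBound (Fintype.card Λ) := by
  have h1 : colSum (B t) (-p 3) (-p 0) (p 1) ≤
      rectCount (fun i x r => Q t i (-r) x) (-p 0) (p 1) (p 3 + 1) (p 3 + Fintype.card Λ) +
        leakBound (Fintype.card Λ) := h
  rwa [rectCount_neg_right (fun i x r => Q t i r x), rectCount_swap, neg_add, neg_add,
    ← sub_eq_add_neg, ← sub_eq_add_neg] at h1

end Shut

/-- The cut-off of `oppositeSum` that is used for a fire with `H` layers. -/
def cutBound (H : ℕ) : ℕ := leakBound H + 2 * H

/-- `oppositeSum` for the bottom and the top of the rectangle between the fronts. -/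
noncomputable def verticalSum (B Q : Λ → ℤ → ℤ → Prop) (p : Fin 4 → ℤ) : ℕ :=
  oppositeSum B Q (cutBound (Fintype.card Λ)) (-p 3) (p 2) (-p 0) (p 1)

/-- `oppositeSum` for the left and the right side of the rectangle between the fronts. -/
noncomputable def horizontalSum (B Q : Λ → ℤ → ℤ → Prop) (p : Fin 4 → ℤ) : ℕ :=
  oppositeSum (fun i u v => B i v u) (fun i u v => Q i v u) (cutBound (Fintype.card Λ))
    (-p 0) (p 1) (-p 3) (p 2)

section Step

variable {t : ℕ} {p : Fin 4 → ℤ} {n : Fin 4 → ℕ}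

/-- Alignment and a shut front without a running chain are the only reasons to wait. -/
theorem frontBlocked_of_waiting {F : Fin 4} (h1 : ¬ FrontAdvancing Γ δ B Q t p n F)
    (h2 : ¬ FrontAligning Γ δ B Q t p F) : FrontBlocked Γ δ B Q t p n F := by
  refine ⟨h2, ?_⟩
  by_contra h3
  refine h1 ⟨h2, ?_⟩
  by_contra h4
  push Not at h4
  exact h3 ⟨by omega, h4.2⟩

theorem FrontBlocked.shut {F : Fin 4} (h : FrontBlocked Γ δ B Q t p n F) :
    FrontShut B Q t p F := h.2.2

theorem frontShut_of_nextPos_eq {F : Fin 4} (h1 : nextPos Γ δ B Q t p n F = p F)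
    (h2 : ¬ FrontAligning Γ δ B Q t p F) : FrontShut B Q t p F :=
  (frontBlocked_of_waiting (fun h => nextPos_ne_iff.2 h h1) h2).shut

theorem liveLayers_of_full {S : Λ → ℤ → ℤ → Prop} {v a b : ℤ}
    (h : ∀ i, 0 < lineCount (fun u => S i u v) a b) : liveLayers S v a b = Fintype.card Λ := by
  unfold liveLayers
  rw [Finset.sum_congr rfl fun i _ => if_pos (h i)]
  simp

open Classical in
theorem le_waste (F F' : Fin 4) (hne : F ≠ F') :
    (if FrontWasting Γ δ B Q t p n F then 1 else 0) +
      (if FrontWasting Γ δ B Q t p n F' then 1 else 0) ≤ waste Γ δ B Q t p n := by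
  unfold waste
  rw [← Finset.sum_pair (f := fun F => if FrontWasting Γ δ B Q t p n F then 1 else 0) hne]
  exact Finset.sum_le_sum_of_subset (Finset.subset_univ _)

open Classical in
/-- What a step of two opposite fronts `F` and `F'` with the other two `F₁` and `F₂` yields, given
the gain of their sizes. -/
theorem gain_of_step {F F' F₁ F₂ : Fin 4} {T T' x x' : ℕ}
    (hF : F ≠ F') (hF' : F ≠ F₁) (hF₂ : F ≠ F₂) (hF₁ : F' ≠ F₁) (hF₃ : F' ≠ F₂) (hF₄ : F₁ ≠ F₂)
    (hx : FrontFull B t p F → x = Fintype.card Λ) (hx' : FrontFull B t p F' → x' = Fintype.card Λ)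
    (hblk : ¬ (FrontBlocked Γ δ B Q t p n F ∧ FrontBlocked Γ δ B Q t p n F'))
    (hT : T + (if FrontAdvancing Γ δ B Q t p n F then x else 0) +
      (if FrontAdvancing Γ δ B Q t p n F' then x' else 0) ≤
      T' + (if FrontAligning Γ δ B Q t p F₁ then 2 * Fintype.card Λ else 0) +
        (if FrontAligning Γ δ B Q t p F₂ then 2 * Fintype.card Λ else 0) +
        (if ¬ FrontAdvancing Γ δ B Q t p n F ∧ ¬ FrontAdvancing Γ δ B Q t p n F' then
          2 * Fintype.card Λ else 0)) :
    T + 2 * Fintype.card Λ ≤ T' + Fintype.card Λ *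
      ((if FrontBlocked Γ δ B Q t p n F then 1 else 0) +
        (if FrontBlocked Γ δ B Q t p n F' then 1 else 0)) +
      4 * Fintype.card Λ * waste Γ δ B Q t p n := by
  set H := Fintype.card Λ with hH
  have hw : waste Γ δ B Q t p n = (if FrontWasting Γ δ B Q t p n F then 1 else 0) +
      (if FrontWasting Γ δ B Q t p n F' then 1 else 0) +
      (if FrontWasting Γ δ B Q t p n F₁ then 1 else 0) +
      (if FrontWasting Γ δ B Q t p n F₂ then 1 else 0) := by
    unfold waste
    have : (Finset.univ : Finset (Fin 4)) = {F, F', F₁, F₂} := by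
      symm
      apply Finset.eq_univ_of_card
      rw [Finset.card_insert_of_notMem (by simp [*]), Finset.card_insert_of_notMem (by simp [*]),
        Finset.card_pair hF₄]
      simp
    rw [this, Finset.sum_insert (by simp [*]), Finset.sum_insert (by simp [*]),
      Finset.sum_pair hF₄]
    ring
  have hal : ∀ F, FrontAligning Γ δ B Q t p F → FrontWasting Γ δ B Q t p n F := fun F h => Or.inl h
  have hna : ∀ F, FrontAligning Γ δ B Q t p F → ¬ FrontAdvancing Γ δ B Q t p n F :=
    fun F h h' => h'.1 h
  have hnb : ∀ F, FrontAligning Γ δ B Q t p F → ¬ FrontBlocked Γ δ B Q t p n F :=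
    fun F h h' => h'.1 h
  have hab : ∀ F, FrontAdvancing Γ δ B Q t p n F → ¬ FrontBlocked Γ δ B Q t p n F := by
    rintro F h ⟨-, h1, h2⟩
    rcases h.2 with h3 | h3
    · omega
    · exact h3 h2
  have hbl : ∀ F, ¬ FrontAdvancing Γ δ B Q t p n F → ¬ FrontAligning Γ δ B Q t p F →
      FrontBlocked Γ δ B Q t p n F := fun F h h' => frontBlocked_of_waiting h h'
  have hful : ∀ F, FrontAdvancing Γ δ B Q t p n F → ¬ FrontWasting Γ δ B Q t p n F →
      FrontFull B t p F := by
    intro F h h'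
    by_contra h3
    exact h' (Or.inr ⟨h, fun h4 => h3 h4.2⟩)
  have s1 : ∀ F, (if FrontAligning Γ δ B Q t p F then 2 * H else 0) ≤
      2 * H * (if FrontWasting Γ δ B Q t p n F then 1 else 0) := by
    intro F
    by_cases h : FrontAligning Γ δ B Q t p F
    · simp [if_pos h, if_pos (hal F h)]
    · simp [if_neg h]
  -- Each front yields `H`: it advances in all layers, or it is blocked, or it wastes the step.
  have s2 : ∀ F y, (FrontFull B t p F → y = H) →
      H ≤ (if FrontAdvancing Γ δ B Q t p n F then y else 0) +
        H * (if FrontBlocked Γ δ B Q t p n F then 1 else 0) +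
        H * (if FrontWasting Γ δ B Q t p n F then 1 else 0) := by
    intro F y hy
    by_cases h1 : FrontWasting Γ δ B Q t p n F
    · rw [if_pos h1]
      omega
    · by_cases h2 : FrontAdvancing Γ δ B Q t p n F
      · rw [if_pos h2, hy (hful F h2 h1)]
        omega
      · rw [if_pos (hbl F h2 fun h3 => h1 (hal F h3))]
        omega
  have s3 : (if ¬ FrontAdvancing Γ δ B Q t p n F ∧ ¬ FrontAdvancing Γ δ B Q t p n F' then
      2 * H else 0) ≤ 2 * H * ((if FrontWasting Γ δ B Q t p n F then 1 else 0) +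
      (if FrontWasting Γ δ B Q t p n F' then 1 else 0)) := by
    split_ifs with h1 h2 h3 h3 <;> try omega
    exfalso
    exact hblk ⟨hbl F h1.1 fun h => h2 (hal F h), hbl F' h1.2 fun h => h3 (hal F' h)⟩
  have a1 := s1 F₁
  have a2 := s1 F₂
  have a3 := s2 F x hx
  have a4 := s2 F' x' hx'
  rw [hw]
  generalize (if FrontWasting Γ δ B Q t p n F then 1 else 0) = w1 at *
  generalize (if FrontWasting Γ δ B Q t p n F' then 1 else 0) = w2 at *
  generalize (if FrontWasting Γ δ B Q t p n F₁ then 1 else 0) = w3 at *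
  generalize (if FrontWasting Γ δ B Q t p n F₂ then 1 else 0) = w4 at *
  generalize (if FrontBlocked Γ δ B Q t p n F then 1 else 0) = b1 at *
  generalize (if FrontBlocked Γ δ B Q t p n F' then 1 else 0) = b2 at *
  have z1 : 0 ≤ H * w1 := Nat.zero_le _
  have z2 : 0 ≤ H * w2 := Nat.zero_le _
  have z3 : 0 ≤ H * w3 := Nat.zero_le _
  have z4 : 0 ≤ H * w4 := Nat.zero_le _
  nlinarith

-- A left or right side that waits without aligning is shut, as `oppositeSum_step` requires.
open Classical in
theorem Fire.verticalSum_step (hf : Fire Γ π δ B Q) (hw : -p 3 ≤ p 2) (hh : -p 0 < p 1)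
    (hblk : ¬ (FrontBlocked Γ δ B Q t p n 0 ∧ FrontBlocked Γ δ B Q t p n 1)) :
    verticalSum (B t) (Q t) p + 2 * Fintype.card Λ ≤
      verticalSum (B (t + 1)) (Q (t + 1)) (nextPos Γ δ B Q t p n) + Fintype.card Λ *
      ((if FrontBlocked Γ δ B Q t p n 0 then 1 else 0) +
        (if FrontBlocked Γ δ B Q t p n 1 then 1 else 0)) +
      4 * Fintype.card Λ * waste Γ δ B Q t p n := by
  have hc0 := nextPos_cases (Γ := Γ) (δ := δ) (B := B) (Q := Q) t p n 0
  have hc1 := nextPos_cases (Γ := Γ) (δ := δ) (B := B) (Q := Q) t p n 1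
  have hc2 := nextPos_cases (Γ := Γ) (δ := δ) (B := B) (Q := Q) t p n 2
  have hc3 := nextPos_cases (Γ := Γ) (δ := δ) (B := B) (Q := Q) t p n 3
  refine gain_of_step (F := 0) (F' := 1) (F₁ := 3) (F₂ := 2) (by decide) (by decide) (by decide)
    (by decide) (by decide) (by decide) (x := liveLayers (B t) (-p 0) (-p 3) (p 2))
    (x' := liveLayers (B t) (p 1) (-p 3) (p 2)) (fun h => liveLayers_of_full h)
    (fun h => liveLayers_of_full h) hblk ?_
  have := oppositeSum_step (B := B t) (B' := B (t + 1)) (Q := Q t) (Q' := Q (t + 1))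
    (M := cutBound (Fintype.card Λ)) (N := leakBound (Fintype.card Λ))
    (a := -p 3) (b := p 2) (c := -p 0) (d := p 1) (a' := -nextPos Γ δ B Q t p n 3)
    (b' := nextPos Γ δ B Q t p n 2) (c' := -nextPos Γ δ B Q t p n 0)
    (d' := nextPos Γ δ B Q t p n 1) (alignW := FrontAligning Γ δ B Q t p 3)
    (alignE := FrontAligning Γ δ B Q t p 2) (by omega) (by omega) (by omega) (by omega) hw hh
    (hf.monoB t) (hf.monoQ t)
    (fun i u v hb ε ε' h1 h2 => (hf.diag t t (by omega) i u v hb ε ε' h1 h2).imp_right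
      (hf.monoQ t i _ _)) le_rfl
    (fun h1 h2 => (frontShut_of_nextPos_eq (neg_injective h1) h2).left)
    (fun h1 h2 => (frontShut_of_nextPos_eq h1 h2).right)
  simp only [neg_inj, nextPos_eq_iff, ite_not] at this
  unfold verticalSum
  convert this

open Classical in
theorem Fire.horizontalSum_step (hf : Fire Γ π δ B Q) (hw : -p 3 < p 2) (hh : -p 0 ≤ p 1)
    (hblk : ¬ (FrontBlocked Γ δ B Q t p n 3 ∧ FrontBlocked Γ δ B Q t p n 2)) :
    horizontalSum (B t) (Q t) p + 2 * Fintype.card Λ ≤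
      horizontalSum (B (t + 1)) (Q (t + 1)) (nextPos Γ δ B Q t p n) + Fintype.card Λ *
      ((if FrontBlocked Γ δ B Q t p n 3 then 1 else 0) +
        (if FrontBlocked Γ δ B Q t p n 2 then 1 else 0)) +
      4 * Fintype.card Λ * waste Γ δ B Q t p n := by
  have hc0 := nextPos_cases (Γ := Γ) (δ := δ) (B := B) (Q := Q) t p n 0
  have hc1 := nextPos_cases (Γ := Γ) (δ := δ) (B := B) (Q := Q) t p n 1
  have hc2 := nextPos_cases (Γ := Γ) (δ := δ) (B := B) (Q := Q) t p n 2
  have hc3 := nextPos_cases (Γ := Γ) (δ := δ) (B := B) (Q := Q) t p n 3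
  refine gain_of_step (F := 3) (F' := 2) (F₁ := 0) (F₂ := 1) (by decide) (by decide) (by decide)
    (by decide) (by decide) (by decide)
    (x := liveLayers (fun i u v => B t i v u) (-p 3) (-p 0) (p 1))
    (x' := liveLayers (fun i u v => B t i v u) (p 2) (-p 0) (p 1)) (fun h => liveLayers_of_full h)
    (fun h => liveLayers_of_full h) hblk ?_
  have := oppositeSum_step (B := fun i u v => B t i v u) (B' := fun i u v => B (t + 1) i v u)
    (Q := fun i u v => Q t i v u) (Q' := fun i u v => Q (t + 1) i v u)
    (M := cutBound (Fintype.card Λ)) (N := leakBound (Fintype.card Λ))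
    (a := -p 0) (b := p 1) (c := -p 3) (d := p 2) (a' := -nextPos Γ δ B Q t p n 0)
    (b' := nextPos Γ δ B Q t p n 1) (c' := -nextPos Γ δ B Q t p n 3)
    (d' := nextPos Γ δ B Q t p n 2) (alignW := FrontAligning Γ δ B Q t p 0)
    (alignE := FrontAligning Γ δ B Q t p 1) (by omega) (by omega) (by omega) (by omega) hh hw
    (fun i u v => hf.monoB t i v u) (fun i u v => hf.monoQ t i v u)
    (fun i u v hb ε ε' h1 h2 => (hf.diag t t (by omega) i v u hb ε' ε h2 h1).imp_right
      (hf.monoQ t i _ _)) le_rfl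
    (fun h1 h2 => by
      rw [rectCount_swap]
      exact (frontShut_of_nextPos_eq (neg_injective h1) h2).bottom)
    (fun h1 h2 => by
      rw [rectCount_swap]
      exact (frontShut_of_nextPos_eq h1 h2).top)
  simp only [neg_inj, nextPos_eq_iff, ite_not] at this
  unfold horizontalSum
  convert this

end Step

end

/-! ### Width and height in terms of burning and unburnt boundary cells. -/

section

theorem card_add_card_le_of_inter {α : Type*} [DecidableEq α] {X Y Z : Finset α} {k : ℕ}
    (hX : X ⊆ Z) (hY : Y ⊆ Z) (hk : (X ∩ Y).card ≤ k) : X.card + Y.card ≤ Z.card + k := by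
  rw [← Finset.card_union_add_card_inter]
  exact Nat.add_le_add (Finset.card_le_card (Finset.union_subset hX hY)) hk

open Classical in
theorem lineCount_row_eq_card (z : ℤ → ℤ → Prop) (v a b : ℤ) :
    lineCount (fun u => z u v) a b =
      (((Finset.Icc a b).filter (fun u => z u v)).image (fun u => (u, v))).card := by
  rw [Finset.card_image_of_injective _ fun x y h => (Prod.ext_iff.1 h).1]
  rfl

open Classical in
theorem lineCount_col_eq_card (z : ℤ → ℤ → Prop) (u c d : ℤ) :
    lineCount (fun v => z u v) c d =
      (((Finset.Icc c d).filter (fun v => z u v)).image (fun v => (u, v))).card := by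
  rw [Finset.card_image_of_injective _ fun x y h => (Prod.ext_iff.1 h).2]
  rfl

open Classical in
theorem image_row_subset_ring (z : ℤ → ℤ → Prop) {v a b c d : ℤ} (hcd : c ≤ d)
    (hv : v = c ∨ v = d) :
    ((Finset.Icc a b).filter (fun u => z u v)).image (fun u => (u, v)) ⊆
      (Finset.Icc a b ×ˢ Finset.Icc c d).filter
        (fun p => OnRing a b c d p.1 p.2 ∧ z p.1 p.2) := by
  rintro ⟨x, y⟩ hx
  simp only [Finset.mem_image, Finset.mem_filter, Finset.mem_Icc, Finset.mem_product,
    Prod.mk.injEq] at hx ⊢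
  obtain ⟨u, ⟨hu, hz⟩, rfl, rfl⟩ := hx
  exact ⟨⟨hu, by omega, by omega⟩, by unfold OnRing; omega, hz⟩

open Classical in
theorem image_col_subset_ring (z : ℤ → ℤ → Prop) {u a b c d : ℤ} (hab : a ≤ b)
    (hu : u = a ∨ u = b) :
    ((Finset.Icc c d).filter (fun v => z u v)).image (fun v => (u, v)) ⊆
      (Finset.Icc a b ×ˢ Finset.Icc c d).filter
        (fun p => OnRing a b c d p.1 p.2 ∧ z p.1 p.2) := by
  rintro ⟨x, y⟩ hx
  simp only [Finset.mem_image, Finset.mem_filter, Finset.mem_Icc, Finset.mem_product,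
    Prod.mk.injEq] at hx ⊢
  obtain ⟨v, ⟨hv, hz⟩, rfl, rfl⟩ := hx
  exact ⟨⟨⟨by omega, by omega⟩, hv⟩, by unfold OnRing; omega, hz⟩

theorem row_add_row_le_ringCount (z : ℤ → ℤ → Prop) {a b c d : ℤ} (hcd : c < d) :
    lineCount (fun u => z u c) a b + lineCount (fun u => z u d) a b ≤ ringCount z a b c d := by
  classical
  rw [lineCount_row_eq_card, lineCount_row_eq_card]
  refine card_add_card_le_of_inter (k := 0) (image_row_subset_ring z hcd.le (Or.inl rfl))
    (image_row_subset_ring z hcd.le (Or.inr rfl)) ?_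
  rw [Nat.le_zero, Finset.card_eq_zero, ← Finset.disjoint_iff_inter_eq_empty, Finset.disjoint_left]
  rintro ⟨x, y⟩ hx hy
  simp only [Finset.mem_image, Prod.mk.injEq] at hx hy
  obtain ⟨-, -, -, h1⟩ := hx
  obtain ⟨-, -, -, h2⟩ := hy
  omega

theorem col_add_col_le_ringCount (z : ℤ → ℤ → Prop) {a b c d : ℤ} (hab : a < b) :
    lineCount (fun v => z a v) c d + lineCount (fun v => z b v) c d ≤ ringCount z a b c d := by
  classical
  rw [lineCount_col_eq_card, lineCount_col_eq_card]
  refine card_add_card_le_of_inter (k := 0) (image_col_subset_ring z hab.le (Or.inl rfl))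
    (image_col_subset_ring z hab.le (Or.inr rfl)) ?_
  rw [Nat.le_zero, Finset.card_eq_zero, ← Finset.disjoint_iff_inter_eq_empty, Finset.disjoint_left]
  rintro ⟨x, y⟩ hx hy
  simp only [Finset.mem_image, Prod.mk.injEq] at hx hy
  obtain ⟨-, -, h1, -⟩ := hx
  obtain ⟨-, -, h2, -⟩ := hy
  omega

theorem row_add_col_le_ringCount (z : ℤ → ℤ → Prop) {a b c d u v : ℤ} (hab : a ≤ b) (hcd : c ≤ d)
    (hv : v = c ∨ v = d) (hu : u = a ∨ u = b) :
    lineCount (fun x => z x v) a b + lineCount (fun y => z u y) c d ≤ ringCount z a b c d + 1 := by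
  classical
  rw [lineCount_row_eq_card, lineCount_col_eq_card]
  refine card_add_card_le_of_inter (image_row_subset_ring z hcd hv)
    (image_col_subset_ring z hab hu) ?_
  rw [Finset.card_le_one]
  rintro ⟨x, y⟩ hx ⟨x', y'⟩ hx'
  simp only [Finset.mem_inter, Finset.mem_image, Prod.mk.injEq] at hx hx' ⊢
  obtain ⟨⟨-, -, -, h1⟩, -, -, h2, -⟩ := hx
  obtain ⟨⟨-, -, -, h3⟩, -, -, h4, -⟩ := hx'
  omega

theorem ringCount_eq_zero {z : ℤ → ℤ → Prop} {a b c d : ℤ}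
    (h : ∀ u v, a ≤ u ∧ u ≤ b → c ≤ v ∧ v ≤ d → ¬ z u v) : ringCount z a b c d = 0 := by
  classical
  unfold ringCount
  rw [Finset.card_eq_zero, Finset.filter_eq_empty_iff]
  rintro ⟨u, v⟩ hx ⟨-, hz⟩
  simp only [Finset.mem_product, Finset.mem_Icc] at hx
  exact h u v hx.1 hx.2 hz

/-- Burning and unburnt cells of a line make up half of it. -/
theorem length_le_burnt_add_unburnt (s : ℤ → Prop) (q l h : ℤ) :
    h - l ≤ 2 * (lineCount s l h + lineCount (fun x => Even (x + q) ∧ ¬ s x) l h : ℤ) := by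
  have h1 := le_two_mul_lineCount_parity q l h
  have h2 : lineCount (fun x => Even (x + q)) l h ≤
      lineCount (fun x => s x ∨ Even (x + q) ∧ ¬ s x) l h :=
    lineCount_mono le_rfl le_rfl fun x _ _ hx => by tauto
  have h3 := lineCount_or_le s (fun x => Even (x + q) ∧ ¬ s x) l h
  omega

variable {Λ : Type*} [Fintype Λ]

theorem length_le_burnt_row (π : ℤ) (s : ℤ → ℤ → Prop) (v a b : ℤ) :
    b - a ≤ 2 * (lineCount (fun u => s u v) a b +
      lineCount (fun u => Even (u + v + π) ∧ ¬ s u v) a b : ℤ) := by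
  simpa only [add_assoc] using length_le_burnt_add_unburnt (fun u => s u v) (v + π) a b

theorem length_le_burnt_col (π : ℤ) (s : ℤ → ℤ → Prop) (u c d : ℤ) :
    d - c ≤ 2 * (lineCount (fun v => s u v) c d +
      lineCount (fun v => Even (u + v + π) ∧ ¬ s u v) c d : ℤ) := by
  have := length_le_burnt_add_unburnt (fun v => s u v) (u + π) c d
  have e : ∀ v, v + (u + π) = u + v + π := fun v => by ring
  simpa only [e] using this

/-- Half of the places of each row are cells, and each cell burns or is an unburnt cell of the ring.
-/
theorem rows_le (π : Λ → ℤ) (S : Λ → ℤ → ℤ → Prop) {a b c d : ℤ} (hcd : c < d) :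
    Fintype.card Λ * (b - a) ≤ (rowSum S c a b + rowSum S d a b + ringSum π S a b c d : ℤ) := by
  unfold rowSum ringSum
  push_cast
  rw [← Finset.sum_add_distrib, ← Finset.sum_add_distrib, ← Finset.card_univ (α := Λ),
    ← nsmul_eq_mul, ← Finset.sum_const]
  refine Finset.sum_le_sum fun i _ => ?_
  have h1 := length_le_burnt_row (π i) (S i) c a b
  have h2 := length_le_burnt_row (π i) (S i) d a b
  have h3 := row_add_row_le_ringCount (fun u v => Even (u + v + π i) ∧ ¬ S i u v) (a := a) (b := b)
    hcd
  omega

theorem cols_le (π : Λ → ℤ) (S : Λ → ℤ → ℤ → Prop) {a b c d : ℤ} (hab : a < b) :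
    Fintype.card Λ * (d - c) ≤ (colSum S a c d + colSum S b c d + ringSum π S a b c d : ℤ) := by
  unfold colSum ringSum
  push_cast
  rw [← Finset.sum_add_distrib, ← Finset.sum_add_distrib, ← Finset.card_univ (α := Λ),
    ← nsmul_eq_mul, ← Finset.sum_const]
  refine Finset.sum_le_sum fun i _ => ?_
  have h1 := length_le_burnt_col (π i) (S i) a c d
  have h2 := length_le_burnt_col (π i) (S i) b c d
  have h3 := col_add_col_le_ringCount (fun u v => Even (u + v + π i) ∧ ¬ S i u v) (c := c) (d := d)
    hab
  omega

/-- As for two opposite sides, but the common corner may be counted twice, whence the extra `2H`. -/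
theorem row_col_le (π : Λ → ℤ) (S : Λ → ℤ → ℤ → Prop) {a b c d u v : ℤ} (hab : a ≤ b) (hcd : c ≤ d)
    (hv : v = c ∨ v = d) (hu : u = a ∨ u = b) :
    Fintype.card Λ * (b - a + (d - c)) ≤
      (2 * (rowSum S v a b + colSum S u c d + ringSum π S a b c d) + 2 * Fintype.card Λ : ℤ) := by
  unfold colSum rowSum ringSum
  have hc : (2 * Fintype.card Λ : ℤ) = ∑ i : Λ, (2 : ℤ) := by simp [mul_comm]
  have hc' : (Fintype.card Λ * (b - a + (d - c)) : ℤ) = ∑ i : Λ, (b - a + (d - c)) := by simp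
  push_cast
  rw [hc, hc', ← Finset.sum_add_distrib, ← Finset.sum_add_distrib, Finset.mul_sum,
    ← Finset.sum_add_distrib]
  refine Finset.sum_le_sum fun i _ => ?_
  have h1 := length_le_burnt_row (π i) (S i) v a b
  have h2 := length_le_burnt_col (π i) (S i) u c d
  have h3 := row_add_col_le_ringCount (fun u v => Even (u + v + π i) ∧ ¬ S i u v) hab hcd hv hu
  omega

/-- The obstacles in a rectangle and at its four sides. -/
theorem rectCount_cross_le (Q : Λ → ℤ → ℤ → Prop) {a b c d : ℤ} (k : ℕ) (hab : a ≤ b) (hcd : c ≤ d) :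
    rectCount Q a b c d + rectCount Q a b (c - k) (c - 1) + rectCount Q a b (d + 1) (d + k) +
      rectCount Q (b + 1) (b + k) c d + rectCount Q (a - k) (a - 1) c d ≤
      rectCount Q (a - k) (b + k) (c - k) (d + k) := by
  have e1 := rectCount_split_right Q (a - k) (b + k) (c := c - k) (m := c - 1) (d := d + k)
    (by omega) (by omega)
  have e2 := rectCount_split_right Q (a - k) (b + k) (c := c - 1 + 1) (m := d) (d := d + k)
    (by omega) (by omega)
  have e3 := rectCount_split_left Q (a := a - k) (m := a - 1) (b := b + k) (c - 1 + 1) d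
    (by omega) (by omega)
  have e4 := rectCount_split_left Q (a := a - 1 + 1) (m := b) (b := b + k) (c - 1 + 1) d
    (by omega) (by omega)
  have e5 : rectCount Q a b (c - k) (c - 1) ≤ rectCount Q (a - k) (b + k) (c - k) (c - 1) :=
    rectCount_mono (fun _ _ _ h => h) (by omega) (by omega) le_rfl le_rfl
  have e6 : rectCount Q a b (d + 1) (d + k) ≤ rectCount Q (a - k) (b + k) (d + 1) (d + k) :=
    rectCount_mono (fun _ _ _ h => h) (by omega) (by omega) le_rfl le_rfl
  simp only [sub_add_cancel] at e1 e2 e3 e4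
  omega

end

/-! ### The process of four fronts, and why no two are blocked together. -/

section

variable {Λ : Type*} [Fintype Λ]

variable {Γ : SimpleGraph Λ} {π : Λ → ℤ} {δ : Λ → Λ → ℤ} {B Q : ℕ → Λ → ℤ → ℤ → Prop}

theorem frontLow_nextPos (t : ℕ) (p : Fin 4 → ℤ) (n : Fin 4 → ℕ) (F : Fin 4) :
    frontLow (nextPos Γ δ B Q t p n) F ≤ frontLow p F ∧
      frontLow p F - 1 ≤ frontLow (nextPos Γ δ B Q t p n) F := by
  have hc0 := nextPos_cases (Γ := Γ) (δ := δ) (B := B) (Q := Q) t p n 0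
  have hc3 := nextPos_cases (Γ := Γ) (δ := δ) (B := B) (Q := Q) t p n 3
  fin_cases F <;> simp [frontLow] <;> omega

theorem frontHigh_nextPos (t : ℕ) (p : Fin 4 → ℤ) (n : Fin 4 → ℕ) (F : Fin 4) :
    frontHigh p F ≤ frontHigh (nextPos Γ δ B Q t p n) F ∧
      frontHigh (nextPos Γ δ B Q t p n) F ≤ frontHigh p F + 1 := by
  have hc1 := nextPos_cases (Γ := Γ) (δ := δ) (B := B) (Q := Q) t p n 1
  have hc2 := nextPos_cases (Γ := Γ) (δ := δ) (B := B) (Q := Q) t p n 2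
  fin_cases F <;> simp [frontHigh] <;> omega

variable (Γ δ B Q) in
/-- `ChainInv` for one of the fronts at the distances `p`, with chains `n`. -/
def FrontInv (t : ℕ) (p : Fin 4 → ℤ) (n : Fin 4 → ℕ) (F : Fin 4) : Prop :=
  ChainInv Γ δ (fun t => view F (B t)) (fun t => view F (Q t)) t (p F) (frontLow p F)
    (frontHigh p F) (n F)

/-- A chain reset to 0 has nothing to satisfy; otherwise the front advanced without a gain, and
`FrontFire.chainInv_succ` applies. -/
theorem Fire.frontInv_step (hf : Fire Γ π δ B Q)
    (hΓ : ∀ S : Finset Λ, S.Nonempty → S ≠ Finset.univ → ∃ i ∈ S, ∃ j ∉ S, Γ.Adj j i)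
    {t : ℕ} {p : Fin 4 → ℤ} {n : Fin 4 → ℕ} {F : Fin 4} (hlh : frontLow p F ≤ frontHigh p F)
    (h : FrontInv Γ δ B Q t p n F) :
    FrontInv Γ δ B Q (t + 1) (nextPos Γ δ B Q t p n) (nextChains Γ δ B Q t p n) F := by
  unfold FrontInv
  by_cases h0 : nextChains Γ δ B Q t p n F = 0
  · rw [h0]
    exact ⟨Nat.zero_le _, fun h => absurd h (lt_irrefl 0)⟩
  have h1 := h0
  unfold nextChains nextChain at h1
  have hal : ¬ FrontAligning Γ δ B Q t p F := fun h => h1 (if_pos h)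
  have e0 := hal
  unfold FrontAligning at e0
  rw [if_neg e0] at h1
  have hns : ¬ (n F = 0 ∧ (FrontShut B Q t p F ∨ FrontFull B t p F)) := fun h => h1 (if_pos h)
  have e1 := hns
  unfold FrontShut FrontFull at e1
  rw [if_neg e1] at h1
  have hg : ¬ Gaining (fun t => view F (B t)) (fun t => view F (Q t)) t (p F) (frontLow p F)
    (frontHigh p F) := fun h => h1 (if_pos h)
  have hadv : FrontAdvancing Γ δ B Q t p n F := by
    by_contra hna
    have := frontBlocked_of_waiting hna hal
    exact hns ⟨this.2.1, Or.inl this.2.2⟩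
  have hn : nextChains Γ δ B Q t p n F = n F + 1 := by
    unfold nextChains nextChain
    rw [if_neg e0, if_neg e1, if_neg hg]
  have hp : nextPos Γ δ B Q t p n F = p F + 1 := if_pos hadv
  rw [hn, hp]
  exact (hf.front F).chainInv_succ hΓ hlh (frontLow_nextPos t p n F).1 (frontLow_nextPos t p n F).2
    (frontHigh_nextPos t p n F).1 (frontHigh_nextPos t p n F).2 h hadv
    (fun h => hns ⟨h.1, Or.inr h.2⟩) hg

variable (Γ δ B Q π) in
/-- The invariants of the four fronts: `k F` is the number of steps in which `F` was blocked, and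
`w` is the number of wasting steps. -/
structure ProcessInv (R : ℕ) (t : ℕ) (p : Fin 4 → ℤ) (n : Fin 4 → ℕ) (k : Fin 4 → ℕ) (w : ℕ) :
    Prop where
  chain : ∀ F, FrontInv Γ δ B Q t p n F
  pos : ∀ F, (R : ℤ) ≤ p F
  burnt : ∀ F, p F = R ∨ ∃ s i x, view F (B s) i x (p F - 1)
  ledger_le : 6 * (Fintype.card Λ * w : ℤ) ≤ ledger B Q π t p n
  vertical : 2 * (Fintype.card Λ * R) + 2 * (Fintype.card Λ * t) ≤ verticalSum (B t) (Q t) p +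
    Fintype.card Λ * (k 0 + k 1) + 4 * (Fintype.card Λ * w)
  horizontal : 2 * (Fintype.card Λ * R) + 2 * (Fintype.card Λ * t) ≤ horizontalSum (B t) (Q t) p +
    Fintype.card Λ * (k 2 + k 3) + 4 * (Fintype.card Λ * w)
  width : (2 * R + 2 * t : ℤ) ≤ p 2 + p 3 + k 2 + k 3 + w
  height : (2 * R + 2 * t : ℤ) ≤ p 0 + p 1 + k 0 + k 1 + w
  total : k 0 + k 1 + k 2 + k 3 ≤ t

/-- That no two fronts are blocked keeps the total of blocked steps within `t`, and is also what
lets the sums of opposite fronts grow. -/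
theorem ProcessInv.step (hf : Fire Γ π δ B Q)
    (hΓ : ∀ S : Finset Λ, S.Nonempty → S ≠ Finset.univ → ∃ i ∈ S, ∃ j ∉ S, Γ.Adj j i)
    {R t : ℕ} (hR : 2 ≤ R) {p : Fin 4 → ℤ} {n k : Fin 4 → ℕ} {w : ℕ}
    (h : ProcessInv Γ π δ B Q R t p n k w)
    (hblk : ∀ F F', F ≠ F' → FrontBlocked Γ δ B Q t p n F → ¬ FrontBlocked Γ δ B Q t p n F') :
    ∃ k' w', ProcessInv Γ π δ B Q R (t + 1) (nextPos Γ δ B Q t p n) (nextChains Γ δ B Q t p n)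
      k' w' := by
  classical
  have hp0 := h.pos 0
  have hp1 := h.pos 1
  have hp2 := h.pos 2
  have hp3 := h.pos 3
  have hlh : ∀ F, frontLow p F ≤ frontHigh p F := by
    intro F
    fin_cases F <;> simp [frontLow, frontHigh] <;> omega
  have hgrow : ∀ F, p F + 1 ≤ nextPos Γ δ B Q t p n F +
      (if FrontBlocked Γ δ B Q t p n F then 1 else 0 : ℕ) +
      (if FrontWasting Γ δ B Q t p n F then 1 else 0 : ℕ) := by
    intro F
    unfold nextPos
    by_cases h1 : FrontAdvancing Γ δ B Q t p n F
    · rw [if_pos h1]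
      omega
    · by_cases h2 : FrontAligning Γ δ B Q t p F
      · rw [if_neg h1, if_pos (show FrontWasting Γ δ B Q t p n F from Or.inl h2)]
        omega
      · rw [if_neg h1, if_pos (frontBlocked_of_waiting h1 h2)]
        omega
  refine ⟨fun F => k F + if FrontBlocked Γ δ B Q t p n F then 1 else 0,
    w + waste Γ δ B Q t p n, ?_⟩
  constructor
  · exact fun F => hf.frontInv_step hΓ (hlh F) (h.chain F)
  · intro F
    have := h.pos F
    rcases nextPos_cases (Γ := Γ) (δ := δ) (B := B) (Q := Q) t p n F with h1 | h1 <;> omega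
  · intro F
    by_cases h1 : FrontAdvancing Γ δ B Q t p n F
    · right
      obtain ⟨i, x, hx⟩ := exists_of_advancing (h.chain F) h1
      refine ⟨t, i, x, ?_⟩
      have : nextPos Γ δ B Q t p n F = p F + 1 := if_pos h1
      rw [this, add_sub_cancel_right]
      exact hx
    · rw [nextPos_eq_iff.2 h1]
      exact h.burnt F
  · have h1 := hf.ledger_step (t := t) (p := p) (n := n) (by omega) (by omega)
      fun F => (h.chain F).1
    have h2 := h.ledger_le
    push_cast
    linarith
  · have h1 := hf.verticalSum_step (t := t) (p := p) (n := n) (by omega) (by omega)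
      fun h => hblk 0 1 (by decide) h.1 h.2
    have h2 := h.vertical
    nlinarith
  · have h1 := hf.horizontalSum_step (t := t) (p := p) (n := n) (by omega) (by omega)
      fun h => hblk 3 2 (by decide) h.1 h.2
    have h2 := h.horizontal
    nlinarith
  · have h1 := hgrow 2
    have h2 := hgrow 3
    have h3 := le_waste (Γ := Γ) (δ := δ) (B := B) (Q := Q) (t := t) (p := p) (n := n) 2 3 (by decide)
    have h4 := h.width
    push_cast at h1 h2 ⊢
    zify at h3
    linarith
  · have h1 := hgrow 0
    have h2 := hgrow 1
    have h3 := le_waste (Γ := Γ) (δ := δ) (B := B) (Q := Q) (t := t) (p := p) (n := n) 0 1 (by decide)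
    have h4 := h.height
    push_cast at h1 h2 ⊢
    zify at h3
    linarith
  · have h1 := h.total
    have h2 : (∑ F, if FrontBlocked Γ δ B Q t p n F then 1 else 0) ≤ 1 := by
      rw [← Finset.card_filter, Finset.card_le_one]
      intro F hF F' hF'
      simp only [Finset.mem_filter, Finset.mem_univ, true_and] at hF hF'
      by_contra hne
      exact hblk F F' hne hF hF'
    rw [Fin.sum_univ_four] at h2
    omega

/-- The size of an initial fire that suffices for `H` layers. -/
def startRadius (H : ℕ) : ℕ := 60 * (H * H) + 20 * H + 6 * leakBound H + 2

/-- Chains have at most `H` steps, so the credit of the four fronts is at most `28H²`. -/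
theorem ProcessInv.ledger_bound {R t : ℕ} {p : Fin 4 → ℤ} {n k : Fin 4 → ℕ} {w : ℕ}
    (h : ProcessInv Γ π δ B Q R t p n k w) :
    6 * (Fintype.card Λ * w : ℤ) + ringSum π (B t) (-p 3) (p 2) (-p 0) (p 1) ≤
      rectCount (Q t) (-p 3) (p 2) (-p 0) (p 1) + 28 * (Fintype.card Λ * Fintype.card Λ : ℤ) := by
  have h1 := h.ledger_le
  have h0 : ∀ F, (Fintype.card Λ * n F : ℤ) ≤ Fintype.card Λ * Fintype.card Λ := fun F => by
    exact_mod_cast Nat.mul_le_mul_left _ (h.chain F).1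
  have a0 := h0 0
  have a1 := h0 1
  have a2 := h0 2
  have a3 := h0 3
  unfold ledger boxCount at h1
  rw [Fin.sum_univ_four] at h1
  linarith

/-- Two shut fronts of any kind force twice the number of obstacles to reach about `3Ht + 4HR`,
where `R` is the initial radius. The budget allows `3Ht` plus a constant, and `startRadius` exceeds
all the constants. -/
theorem ProcessInv.not_blocked [Nonempty Λ] {t : ℕ} {p : Fin 4 → ℤ} {n k : Fin 4 → ℕ} {w : ℕ}
    (h : ProcessInv Γ π δ B Q (startRadius (Fintype.card Λ)) t p n k w)
    (hbud : ∀ a b c d, 2 * rectCount (Q t) a b c d ≤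
      3 * (Fintype.card Λ * (t + Fintype.card Λ + 1)))
    {F F' : Fin 4} (hne : F ≠ F') (hF : FrontBlocked Γ δ B Q t p n F)
    (hF' : FrontBlocked Γ δ B Q t p n F') : False := by
  have hH : 1 ≤ Fintype.card Λ := Fintype.card_pos
  have hp0 := h.pos 0
  have hp1 := h.pos 1
  have hp2 := h.pos 2
  have hp3 := h.pos 3
  have hR : 2 ≤ startRadius (Fintype.card Λ) := by unfold startRadius; omega
  -- The rectangle and the strips of depth `H` outside its sides are disjoint, so one budget bounds
  -- all their obstacles together.
  have hbox := rectCount_cross_le (Q t) (a := -p 3) (b := p 2) (c := -p 0) (d := p 1)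
    (Fintype.card Λ) (by omega) (by omega)
  have hb := hbud (-p 3 - Fintype.card Λ) (p 2 + Fintype.card Λ) (-p 0 - Fintype.card Λ)
    (p 1 + Fintype.card Λ)
  have hled := h.ledger_bound
  have hrows := rows_le π (B t) (a := -p 3) (b := p 2) (c := -p 0) (d := p 1) (by omega)
  have hcols := cols_le π (B t) (a := -p 3) (b := p 2) (c := -p 0) (d := p 1) (by omega)
  have hver : verticalSum (B t) (Q t) p ≤ rowSum (B t) (-p 0) (-p 3) (p 2) +
      rowSum (B t) (p 1) (-p 3) (p 2) + rectCount (Q t) (-p 3) (p 2) (-p 0) (p 1) +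
      rectCount (Q t) (-p 3 - Fintype.card Λ) (-p 3 - 1) (-p 0) (p 1) +
      rectCount (Q t) (p 2 + 1) (p 2 + Fintype.card Λ) (-p 0) (p 1) +
      2 * cutBound (Fintype.card Λ) := by
    unfold verticalSum oppositeSum cutCol
    omega
  have hhor : horizontalSum (B t) (Q t) p ≤ colSum (B t) (-p 3) (-p 0) (p 1) +
      colSum (B t) (p 2) (-p 0) (p 1) + rectCount (Q t) (-p 3) (p 2) (-p 0) (p 1) +
      rectCount (Q t) (-p 3) (p 2) (-p 0 - Fintype.card Λ) (-p 0 - 1) +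
      rectCount (Q t) (-p 3) (p 2) (p 1 + 1) (p 1 + Fintype.card Λ) +
      2 * cutBound (Fintype.card Λ) := by
    rw [← rectCount_swap (Q t) (-p 0) (p 1), ← rectCount_swap (Q t) (-p 0 - Fintype.card Λ),
      ← rectCount_swap (Q t) (p 1 + 1)]
    unfold horizontalSum oppositeSum cutCol
    change _ ≤ rowSum (fun i u v => B t i v u) (-p 3) (-p 0) (p 1) +
      rowSum (fun i u v => B t i v u) (p 2) (-p 0) (p 1) + _ + _ + _ + _
    omega
  have hrc : ∀ u v, (v = -p 0 ∨ v = p 1) → (u = -p 3 ∨ u = p 2) → _ := fun u v hv hu =>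
    row_col_le π (B t) (a := -p 3) (b := p 2) (c := -p 0) (d := p 1) (u := u) (v := v)
      (by omega) (by omega) hv hu
  have hver' := h.vertical
  have hhor' := h.horizontal
  have hw := h.width
  have hh := h.height
  have htot := h.total
  have hst : startRadius (Fintype.card Λ) = 60 * (Fintype.card Λ * Fintype.card Λ) +
    20 * Fintype.card Λ + 6 * leakBound (Fintype.card Λ) + 2 := rfl
  unfold cutBound at hver hhor
  set H := Fintype.card Λ with hHdef
  have hHR : startRadius H ≤ H * startRadius H := Nat.le_mul_of_pos_left _ hH
  have mw := mul_le_mul_of_nonneg_left hw (Int.natCast_nonneg H)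
  have mh := mul_le_mul_of_nonneg_left hh (Int.natCast_nonneg H)
  have mt := Nat.mul_le_mul_left H htot
  have z1 : (0 : ℤ) ≤ (H : ℤ) * w := by positivity
  have z2 : (0 : ℤ) ≤ (H : ℤ) * H := by positivity
  have z3 : (0 : ℤ) ≤ (leakBound H : ℤ) := by positivity
  have hq : ∀ a b c d, (0 : ℤ) ≤ (rectCount (Q t) a b c d : ℤ) := fun a b c d => by positivity
  have q0 := hq (-p 3) (p 2) (-p 0 - H) (-p 0 - 1)
  have q1 := hq (-p 3) (p 2) (p 1 + 1) (p 1 + H)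
  have q2 := hq (p 2 + 1) (p 2 + H) (-p 0) (p 1)
  have q3 := hq (-p 3 - H) (-p 3 - 1) (-p 0) (p 1)
  zify at hver' hhor' hver hhor hbox hb mt hHR hst hH
  -- Here `x` is twice the number of obstacles near the rectangle. The lower bound fails as the
  -- blocked steps total at most `t`.
  have key : ∀ x : ℤ, x ≤ 3 * (H * (t + H + 1)) →
      4 * (H * startRadius H : ℤ) + 4 * (H * t : ℤ) - H * (k 0 + k 1 + k 2 + k 3) -
        (56 * (H * H : ℤ) + 10 * H + 6 * leakBound H) ≤ x → False := by
    intro x h1 h2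
    linarith
  -- For opposite fronts, add the bounds from `verticalSum` and from the width. Each counts the
  -- obstacles inside and at the two shut fronts once, and the waste `4Hw + Hw` is covered by the
  -- `6Hw` of the ledger.
  have hv : FrontShut B Q t p 0 → FrontShut B Q t p 1 → False := by
    intro h0 h1
    have s0 := h0.bottom
    have s1 := h1.top
    zify at s0 s1
    refine key _ hb ?_
    linarith
  have hh : FrontShut B Q t p 2 → FrontShut B Q t p 3 → False := by
    intro h0 h1
    have s0 := h0.right
    have s1 := h1.left
    zify at s0 s1
    refine key _ hb ?_
    linarith
  -- For adjacent fronts, width and height together suffice, without the sums of opposite fronts.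
  have h02 : FrontShut B Q t p 0 → FrontShut B Q t p 2 → False := by
    intro h0 h1
    have s0 := h0.bottom
    have s1 := h1.right
    have s2 := hrc (p 2) (-p 0) (Or.inl rfl) (Or.inr rfl)
    zify at s0 s1
    refine key _ hb ?_
    linarith
  have h03 : FrontShut B Q t p 0 → FrontShut B Q t p 3 → False := by
    intro h0 h1
    have s0 := h0.bottom
    have s1 := h1.left
    have s2 := hrc (-p 3) (-p 0) (Or.inl rfl) (Or.inl rfl)
    zify at s0 s1
    refine key _ hb ?_
    linarith
  have h12 : FrontShut B Q t p 1 → FrontShut B Q t p 2 → False := by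
    intro h0 h1
    have s0 := h0.top
    have s1 := h1.right
    have s2 := hrc (p 2) (p 1) (Or.inr rfl) (Or.inr rfl)
    zify at s0 s1
    refine key _ hb ?_
    linarith
  have h13 : FrontShut B Q t p 1 → FrontShut B Q t p 3 → False := by
    intro h0 h1
    have s0 := h0.top
    have s1 := h1.left
    have s2 := hrc (-p 3) (p 1) (Or.inr rfl) (Or.inl rfl)
    zify at s0 s1
    refine key _ hb ?_
    linarith
  have hs := hF.shut
  have hs' := hF'.shut
  fin_cases F <;> fin_cases F'
  · exact hne rfl
  · exact hv hs hs'
  · exact h02 hs hs'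
  · exact h03 hs hs'
  · exact hv hs' hs
  · exact hne rfl
  · exact h12 hs hs'
  · exact h13 hs hs'
  · exact h02 hs' hs
  · exact h12 hs' hs
  · exact hne rfl
  · exact hh hs hs'
  · exact h03 hs' hs
  · exact h13 hs' hs
  · exact hh hs' hs
  · exact hne rfl

/-- The initial state of the fronts. -/
theorem processInv_zero {R : ℕ}
    (hB : ∀ i u v, |u| ≤ (R : ℤ) → |v| ≤ (R : ℤ) → Even (u + v + π i) → B 0 i u v) :
    ProcessInv Γ π δ B Q R 0 (fun _ => R) (fun _ => 0) (fun _ => 0) 0 := by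
  have hrow : ∀ v : ℤ, |v| ≤ (R : ℤ) → Fintype.card Λ * R ≤ rowSum (B 0) v (-R) R := by
    intro v hv
    unfold rowSum
    rw [← Finset.card_univ (α := Λ), ← smul_eq_mul, ← Finset.sum_const]
    refine Finset.sum_le_sum fun i _ => ?_
    have h1 := le_two_mul_lineCount_parity (v + π i) (-R) R
    have h2 : lineCount (fun u => Even (u + (v + π i))) (-R) R ≤
        lineCount (fun u => B 0 i u v) (-R) R :=
      lineCount_mono le_rfl le_rfl fun u h3 h4 h5 =>
        hB i u v (abs_le.2 ⟨h3, h4⟩) hv (by rwa [add_assoc])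
    omega
  have hcol : ∀ u : ℤ, |u| ≤ (R : ℤ) → Fintype.card Λ * R ≤ colSum (B 0) u (-R) R := by
    intro u hu
    unfold colSum
    rw [← Finset.card_univ (α := Λ), ← smul_eq_mul, ← Finset.sum_const]
    refine Finset.sum_le_sum fun i _ => ?_
    have h1 := le_two_mul_lineCount_parity (u + π i) (-R) R
    have h2 : lineCount (fun v => Even (v + (u + π i))) (-R) R ≤
        lineCount (fun v => B 0 i u v) (-R) R :=
      lineCount_mono le_rfl le_rfl fun v h3 h4 h5 =>
        hB i u v hu (abs_le.2 ⟨h3, h4⟩) (by rwa [add_comm u v, add_assoc])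
    omega
  have hRR : |(R : ℤ)| ≤ R := by simp
  have hRR' : |-(R : ℤ)| ≤ R := by simp
  constructor
  · exact fun F => ⟨Nat.zero_le _, fun h => absurd h (lt_irrefl 0)⟩
  · exact fun F => le_rfl
  · exact fun F => Or.inl rfl
  · have : ringSum π (B 0) (-R) R (-R) R = 0 :=
      Finset.sum_eq_zero fun i _ => ringCount_eq_zero fun u v hu hv h =>
        h.2 (hB i u v (abs_le.2 hu) (abs_le.2 hv) h.1)
    unfold ledger
    rw [this]
    simp
  · have h1 := hrow (-R) hRR'
    have h2 := hrow R hRR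
    unfold verticalSum oppositeSum
    simp only
    omega
  · have h1 := hcol (-R) hRR'
    have h2 := hcol R hRR
    unfold horizontalSum oppositeSum
    change _ ≤ colSum (B 0) (-R) (-R) R + colSum (B 0) R (-R) R + _ + _ + _ + _ + _
    omega
  · simp; omega
  · simp; omega
  · simp

/-- A fire that starts with a large rectangle spreads beyond all bounds, if the obstacles are few. -/
theorem Fire.unbounded [Nonempty Λ] (hf : Fire Γ π δ B Q)
    (hΓ : ∀ S : Finset Λ, S.Nonempty → S ≠ Finset.univ → ∃ i ∈ S, ∃ j ∉ S, Γ.Adj j i)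
    (hbud : ∀ t a b c d, 2 * rectCount (Q t) a b c d ≤
      3 * (Fintype.card Λ * (t + Fintype.card Λ + 1)))
    (hB : ∀ i u v, |u| ≤ (startRadius (Fintype.card Λ) : ℤ) →
      |v| ≤ (startRadius (Fintype.card Λ) : ℤ) → Even (u + v + π i) → B 0 i u v) (N : ℕ) :
    ∃ t i u v, B t i u v ∧ ((N : ℤ) ≤ |u| ∨ (N : ℤ) ≤ |v|) := by
  have hinv : ∀ t, ∃ p n k w,
      ProcessInv Γ π δ B Q (startRadius (Fintype.card Λ)) t p n k w := by
    intro t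
    induction t with
    | zero => exact ⟨_, _, _, _, processInv_zero hB⟩
    | succ t ih =>
      obtain ⟨p, n, k, w, h⟩ := ih
      obtain ⟨k', w', h'⟩ := h.step hf hΓ (by unfold startRadius; omega)
        fun F F' hne h1 h2 => h.not_blocked (hbud t) hne h1 h2
      exact ⟨_, _, _, _, h'⟩
  set H := Fintype.card Λ with hH
  have hH1 : 1 ≤ H := Fintype.card_pos
  set R := startRadius H with hR
  obtain ⟨p, n, k, w, h⟩ := hinv (4 * N + 4 * R + 40 * H + 20)
  set t := 4 * N + 4 * R + 40 * H + 20 with ht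
  have hled := h.ledger_bound
  have hb := hbud t (-p 3) (p 2) (-p 0) (p 1)
  -- The ledger and the budget limit the waste to about `t / 4`. With at most `t` blocked steps, the
  -- four distances still grow by at least about `5t / 2` in total.
  have hw : (w : ℤ) * 4 ≤ t + 20 * H + 1 := by
    have h1 : (0 : ℤ) ≤ ringSum π (B t) (-p 3) (p 2) (-p 0) (p 1) := by positivity
    zify at hb
    rw [← hH] at hled
    have h2 : (H : ℤ) * (12 * w) ≤ H * (3 * (t + H + 1) + 56 * H) := by linarith
    have h3 := le_of_mul_le_mul_left h2 (by exact_mod_cast hH1)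
    omega
  have h1 := h.width
  have h2 := h.height
  have h3 := h.total
  have hex : ∃ F, (N : ℤ) + R + 2 ≤ p F := by
    by_contra hcon
    push Not at hcon
    have a0 := hcon 0
    have a1 := hcon 1
    have a2 := hcon 2
    have a3 := hcon 3
    omega
  obtain ⟨F, hF⟩ := hex
  rcases h.burnt F with h4 | ⟨s, i, x, hx⟩
  · omega
  · fin_cases F
    · exact ⟨s, i, _, _, hx, Or.inr (le_abs.2 (Or.inr (by simp at hF ⊢; omega)))⟩
    · exact ⟨s, i, _, _, hx, Or.inr (le_abs.2 (Or.inl (by simp at hF ⊢; omega)))⟩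
    · exact ⟨s, i, _, _, hx, Or.inl (le_abs.2 (Or.inl (by simp at hF ⊢; omega)))⟩
    · exact ⟨s, i, _, _, hx, Or.inl (le_abs.2 (Or.inr (by simp at hF ⊢; omega)))⟩

end

/-! ### From the game on a grid to the abstract fire. -/

section

variable {V : Type*} {G : SimpleGraph V}

theorem burning_subset_succ (B₀ : Finset V) (P : ℕ → Finset V) (t : ℕ) :
    burning G B₀ P t ⊆ burning G B₀ P (t + 1) := Set.subset_union_left

theorem burning_mono (B₀ : Finset V) (P : ℕ → Finset V) : Monotone (burning G B₀ P) :=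
  monotone_nat_of_le_succ (burning_subset_succ B₀ P)

theorem mem_burning_succ_of_adj {B₀ : Finset V} {P : ℕ → Finset V} {t : ℕ} {x y : V}
    (hx : x ∈ burning G B₀ P t) (hxy : G.Adj x y) :
    y ∈ burning G B₀ P (t + 1) ∨ y ∈ P (t + 1) := by
  by_cases h : y ∈ P (t + 1)
  · exact Or.inr h
  · exact Or.inl (Or.inr ⟨h, x, hx, hxy⟩)

theorem IsLegalPlay.notMem_of_burning {f : ℕ → ℝ} {B₀ : Finset V} {P : ℕ → Finset V}
    (hP : IsLegalPlay G f B₀ P) {t : ℕ} {x : V} (hx : x ∈ burning G B₀ P t) (t' : ℕ) :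
    x ∉ P t' := by
  have key : ∀ t x, x ∈ burning G B₀ P t → x ∉ P t := by
    intro t
    induction t with
    | zero => intro x _; simp [hP.zero]
    | succ t ih =>
      rintro x (hx | hx)
      · exact fun h => hP.notBurning t x h (ih x hx) hx
      · exact hx.1
  rcases le_total t t' with h | h
  · exact key t' x (burning_mono B₀ P h hx)
  · exact fun h' => key t x hx (hP.mono h h')

variable {Λ : Type*}

/-- The vertices of `G` are the cells `(i, u, v)` of equal parity in the layers `i`. Neighbours
differ by at most one in the last two coordinates; diagonal neighbours in a layer are adjacent, and
so are certain cells in adjacent layers. -/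
structure IsGrid (G : SimpleGraph V) (Γ : SimpleGraph Λ) (π : Λ → ℤ) (δ : Λ → Λ → ℤ)
    (cell : V → Λ × ℤ × ℤ) : Prop where
  inj : Function.Injective cell
  surj : ∀ i u v, Even (u + v + π i) → ∃ x, cell x = (i, u, v)
  lat : ∀ x, Even ((cell x).2.1 + (cell x).2.2 + π (cell x).1)
  near : ∀ x y, G.Adj x y → |(cell y).2.1 - (cell x).2.1| ≤ 1 ∧ |(cell y).2.2 - (cell x).2.2| ≤ 1
  diag : ∀ x y i u v, cell x = (i, u, v) → ∀ ε ε' : ℤ, (ε = 1 ∨ ε = -1) → (ε' = 1 ∨ ε' = -1) →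
    cell y = (i, u + ε, v + ε') → G.Adj x y
  crossU : ∀ x y i j u v, Γ.Adj i j → cell x = (i, u, v) → cell y = (j, u + δ i j, v) → G.Adj x y
  crossV : ∀ x y i j u v, Γ.Adj i j → cell x = (i, u, v) → cell y = (j, u, v + δ i j) → G.Adj x y
  shift : ∀ i j, δ i j = 0 ∨ δ i j = 1
  parity : ∀ i j, Γ.Adj i j → Even (π i + π j + δ i j)

variable {Γ : SimpleGraph Λ} {π : Λ → ℤ} {δ : Λ → Λ → ℤ} {cell : V → Λ × ℤ × ℤ}

/-- A fire spreads by at most one cell per step. -/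
theorem IsGrid.abs_le_of_burning (hG : IsGrid G Γ π δ cell) {B₀ : Finset V} {r : ℕ}
    (hr : ∀ x ∈ B₀, |(cell x).2.1| ≤ (r : ℤ) ∧ |(cell x).2.2| ≤ (r : ℤ)) (P : ℕ → Finset V) (t : ℕ) :
    ∀ x ∈ burning G B₀ P t, |(cell x).2.1| ≤ (t + r : ℤ) ∧ |(cell x).2.2| ≤ (t + r : ℤ) := by
  induction t with
  | zero => simpa [burning] using hr
  | succ t ih =>
    rintro x (hx | ⟨-, y, hy, hyx⟩)
    · have := ih x hx
      push_cast
      constructor <;> linarith [this.1, this.2]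
    · have h1 := ih y hy
      have h2 := hG.near y x hyx
      simp only [abs_le] at h1 h2 ⊢
      push_cast
      omega

theorem exists_radius (cell : V → Λ × ℤ × ℤ) (B₀ : Finset V) :
    ∃ r : ℕ, ∀ x ∈ B₀, |(cell x).2.1| ≤ (r : ℤ) ∧ |(cell x).2.2| ≤ (r : ℤ) := by
  refine ⟨B₀.sup fun x => ((cell x).2.1.natAbs + (cell x).2.2.natAbs), fun x hx => ?_⟩
  have := Finset.le_sup (f := fun x => ((cell x).2.1.natAbs + (cell x).2.2.natAbs)) hx
  rw [Int.abs_eq_natAbs, Int.abs_eq_natAbs]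
  omega

/-- The cells of a set of vertices. -/
def cellSet (cell : V → Λ × ℤ × ℤ) (S : Set V) (i : Λ) (u v : ℤ) : Prop :=
  ∃ x ∈ S, cell x = (i, u, v)

variable [Fintype Λ]

theorem rectCount_cellSet_le (cell : V → Λ × ℤ × ℤ) (P : Finset V) (a b c d : ℤ) :
    rectCount (cellSet cell P) a b c d ≤ P.card := by
  classical
  unfold rectCount
  refine (Finset.card_le_card (t := P.image cell) ?_).trans Finset.card_image_le
  rintro ⟨i, u, v⟩ hx
  simp only [Finset.mem_filter, Finset.mem_image] at hx ⊢
  exact hx.2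

/-- The obstacles at time `t` are the cells protected by time `t + |Λ| + 1`; monotonicity of the
play gives the lookahead. This costs only a constant in the budget, and a cell that ever burns is
never protected, so the two sets stay disjoint. -/
theorem IsGrid.fire (hG : IsGrid G Γ π δ cell) {f : ℕ → ℝ} {B₀ : Finset V} {P : ℕ → Finset V}
    (hP : IsLegalPlay G f B₀ P) :
    Fire Γ π δ (fun t => cellSet cell (burning G B₀ P t))
      (fun t => cellSet cell (P (t + Fintype.card Λ + 1))) := by
  have spread : ∀ t t', t' ≤ t + Fintype.card Λ → ∀ x ∈ burning G B₀ P t', ∀ j u v,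
      Even (u + v + π j) → (∀ y, cell y = (j, u, v) → G.Adj x y) →
      cellSet cell (burning G B₀ P (t' + 1)) j u v ∨
        cellSet cell (P (t + Fintype.card Λ + 1)) j u v := by
    intro t t' ht x hx j u v he hadj
    obtain ⟨y, hy⟩ := hG.surj j u v he
    rcases mem_burning_succ_of_adj hx (hadj y hy) with h | h
    · exact Or.inl ⟨y, h, hy⟩
    · exact Or.inr ⟨y, hP.mono (by omega) h, hy⟩
  constructor
  · rintro t i u v ⟨x, hx, hc⟩
    exact ⟨x, burning_subset_succ B₀ P t hx, hc⟩
  · rintro t i u v ⟨x, hx, hc⟩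
    exact ⟨x, hP.mono (by omega) hx, hc⟩
  · rintro t t' i u v ⟨x, hx, hc⟩ ⟨y, hy, hc'⟩
    obtain rfl := hG.inj (hc.trans hc'.symm)
    exact hP.notMem_of_burning hx _ hy
  · rintro t i u v ⟨x, hx, hc⟩
    simpa [hc] using hG.lat x
  · rintro t t' ht i u v ⟨x, hx, hc⟩ ε ε' hε hε'
    refine spread t t' ht x hx i _ _ ?_ fun y hy => hG.diag x y i u v hc ε ε' hε hε' hy
    have := hG.lat x
    simp only [hc, Int.even_iff] at this ⊢
    omega
  · rintro t t' ht i j hij u v ⟨x, hx, hc⟩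
    refine spread t t' ht x hx j _ _ ?_ fun y hy => hG.crossU x y i j u v hij hc hy
    have h1 := hG.lat x
    have h2 := hG.parity i j hij
    simp only [hc, Int.even_iff] at h1 h2 ⊢
    omega
  · rintro t t' ht i j hij u v ⟨x, hx, hc⟩
    refine spread t t' ht x hx j _ _ ?_ fun y hy => hG.crossV x y i j u v hij hc hy
    have h1 := hG.lat x
    have h2 := hG.parity i j hij
    simp only [hc, Int.even_iff] at h1 h2 ⊢
    omega
  · exact hG.shift

theorem exists_adj_of_connected (hΓ : Γ.Connected) (S : Finset Λ) (hS : S.Nonempty)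
    (hS' : S ≠ Finset.univ) : ∃ i ∈ S, ∃ j ∉ S, Γ.Adj j i := by
  obtain ⟨i, hi⟩ := hS
  obtain ⟨j, hj⟩ : ∃ j, j ∉ S := by
    by_contra h
    push Not at h
    exact hS' (Finset.eq_univ_iff_forall.2 h)
  obtain ⟨p⟩ := hΓ.preconnected i j
  obtain ⟨d, -, h1, h2⟩ := p.exists_boundary_dart (S : Set Λ) (by simpa using hi) (by simpa using hj)
  exact ⟨d.fst, by simpa using h1, d.snd, by simpa using h2, d.adj.symm⟩

/-- A large fire on a grid with `H` layers cannot be contained with `3 / 2 * H` protections per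
step. -/
theorem IsGrid.exists_not_canContain (hG : IsGrid G Γ π δ cell) (hΓ : Γ.Connected) :
    ∃ B₀ : Finset V, ¬ CanContain G (fun t => 3 / 2 * (Fintype.card Λ : ℝ) * t) B₀ := by
  have := hΓ.nonempty
  set R := startRadius (Fintype.card Λ) with hR
  let B₀ : Finset V := Finset.preimage ((Finset.univ : Finset Λ) ×ˢ
    (Finset.Icc (-(R : ℤ)) R ×ˢ Finset.Icc (-(R : ℤ)) R)) cell hG.inj.injOn
  refine ⟨B₀, ?_⟩
  rintro ⟨P, hP, T, hT⟩
  have hr : ∀ x ∈ B₀, |(cell x).2.1| ≤ (R : ℤ) ∧ |(cell x).2.2| ≤ (R : ℤ) := by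
    intro x hx
    simp only [B₀, Finset.mem_preimage, Finset.mem_product, Finset.mem_univ, true_and,
      Finset.mem_Icc] at hx
    simp only [abs_le]
    exact hx
  obtain ⟨t, i, u, v, ⟨x, hx, hc⟩, hN⟩ := (hG.fire hP).unbounded (exists_adj_of_connected hΓ)
    (fun t a b c d => by
      have h1 := rectCount_cellSet_le cell (P (t + Fintype.card Λ + 1)) a b c d
      have h2 := hP.budget (t + Fintype.card Λ + 1)
      have h3 : (2 * (P (t + Fintype.card Λ + 1)).card : ℝ) ≤
          3 * (Fintype.card Λ * (t + Fintype.card Λ + 1)) := by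
        push_cast at h2
        linarith
      have h4 : 2 * (P (t + Fintype.card Λ + 1)).card ≤
          3 * (Fintype.card Λ * (t + Fintype.card Λ + 1)) := by exact_mod_cast h3
      omega)
    (fun i u v hu hv he => by
      obtain ⟨x, hx⟩ := hG.surj i u v he
      refine ⟨x, ?_, hx⟩
      simp only [burning, B₀, Finset.mem_coe, Finset.mem_preimage, hx, Finset.mem_product,
        Finset.mem_univ, true_and, Finset.mem_Icc]
      exact ⟨abs_le.1 hu, abs_le.1 hv⟩) (T + R + 1)
  have hstable : ∀ s, burning G B₀ P (T + s) = burning G B₀ P T := by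
    intro s
    induction s with
    | zero => rfl
    | succ s ih => rw [← ih]; exact hT _ (Nat.le_add_right T s)
  have hxT : x ∈ burning G B₀ P T := by
    rcases le_total t T with h | h
    · exact burning_mono B₀ P h hx
    · obtain ⟨s, rfl⟩ := Nat.exists_eq_add_of_le h
      rwa [hstable s] at hx
  -- A fire that stops at time `T` stays within distance `T + R`, contrary to the cell found at
  -- distance `T + R + 1` or more.
  have := hG.abs_le_of_burning hr P T x hxT
  rw [hc] at this
  simp only at this
  push_cast at hN
  omega

end

/-! ### Containment by a rectangular wall. -/

section

theorem ringCount_le_sides (z : ℤ → ℤ → Prop) (a b c d : ℤ) :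
    ringCount z a b c d ≤ lineCount (fun u => z u c) a b + lineCount (fun u => z u d) a b +
      lineCount (fun v => z a v) c d + lineCount (fun v => z b v) c d := by
  classical
  rw [lineCount_row_eq_card, lineCount_row_eq_card, lineCount_col_eq_card, lineCount_col_eq_card]
  unfold ringCount
  refine (Finset.card_le_card ?_).trans ((Finset.card_union_le _ _).trans
    (Nat.add_le_add_right ((Finset.card_union_le _ _).trans
      (Nat.add_le_add_right (Finset.card_union_le _ _) _)) _))
  rintro ⟨u, v⟩ hx
  have hx := Finset.mem_filter.1 hx
  simp only [Finset.mem_product, Finset.mem_Icc, OnRing, Finset.mem_union, Finset.mem_image,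
    Finset.mem_filter, Prod.mk.injEq] at hx ⊢
  obtain ⟨⟨hu, hv⟩, rfl | rfl | rfl | rfl, hz⟩ := hx
  · exact Or.inl (Or.inr ⟨v, ⟨hv, hz⟩, rfl, rfl⟩)
  · exact Or.inr ⟨v, ⟨hv, hz⟩, rfl, rfl⟩
  · exact Or.inl (Or.inl (Or.inl ⟨u, ⟨hu, hz⟩, rfl, rfl⟩))
  · exact Or.inl (Or.inl (Or.inr ⟨u, ⟨hu, hz⟩, rfl, rfl⟩))

/-- The cells of a line at the distance `e` from the origin that are within the distance `m`. -/
theorem two_mul_lineCount_near_le {s : ℤ → Prop} {q e m A A' : ℤ} (hA : 0 ≤ A) (hA' : 0 ≤ A')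
    (hm : 0 ≤ m) (hs : ∀ x, s x → Even (x + q) ∧ |x| ≤ m ∧ |e| ≤ m) :
    2 * (lineCount s (-A) A' : ℤ) ≤ if |e| ≤ m then min A m + min A' m + 2 else 0 := by
  split_ifs with h
  · have h1 : lineCount s (-A) A' ≤
        lineCount (fun x => Even (x + q)) (-min A m) (min A' m) := by
      apply Finset.card_le_card
      intro x hx
      simp only [Finset.mem_filter, Finset.mem_Icc] at hx ⊢
      have h2 := hs x hx.2
      rw [abs_le] at h2
      exact ⟨by omega, h2.1⟩
    have h2 := two_mul_lineCount_parity_le q (-min A m) (min A' m) (by omega)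
    omega
  · have : lineCount s (-A) A' = 0 := lineCount_eq_zero.2 fun x _ _ hx => h (hs x hx).2.2
    omega

/-- The number of wall cells within the distance `m`, twice, in a layer. -/
theorem two_mul_ringCount_near_le (π : ℤ) {S₁ S₂ S₃ S₄ m : ℤ} (h1 : 0 ≤ S₁) (h2 : 0 ≤ S₂)
    (h3 : 0 ≤ S₃) (h4 : 0 ≤ S₄) (hm : 0 ≤ m) :
    2 * (ringCount (fun u v => Even (u + v + π) ∧ |u| ≤ m ∧ |v| ≤ m) (-S₂) S₃ (-S₁) S₄ : ℤ) ≤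
      (if S₁ ≤ m then min S₂ m + min S₃ m + 2 else 0) +
      (if S₄ ≤ m then min S₂ m + min S₃ m + 2 else 0) +
      (if S₂ ≤ m then min S₁ m + min S₄ m + 2 else 0) +
      (if S₃ ≤ m then min S₁ m + min S₄ m + 2 else 0) := by
  have e0 := ringCount_le_sides (fun u v => Even (u + v + π) ∧ |u| ≤ m ∧ |v| ≤ m) (-S₂) S₃ (-S₁) S₄
  have e1 := two_mul_lineCount_near_le (s := fun u => Even (u + -S₁ + π) ∧ |u| ≤ m ∧ |-S₁| ≤ m)
    (q := -S₁ + π) (e := -S₁) h2 h3 hm (fun x hx => by rwa [← add_assoc])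
  have e2 := two_mul_lineCount_near_le (s := fun u => Even (u + S₄ + π) ∧ |u| ≤ m ∧ |S₄| ≤ m)
    (q := S₄ + π) (e := S₄) h2 h3 hm (fun x hx => by rwa [← add_assoc])
  have e3 := two_mul_lineCount_near_le (s := fun v => Even (-S₂ + v + π) ∧ |-S₂| ≤ m ∧ |v| ≤ m)
    (q := -S₂ + π) (e := -S₂) h1 h4 hm
    (fun x hx => ⟨by rw [← add_assoc, add_comm x]; exact hx.1, hx.2.2, hx.2.1⟩)
  have e4 := two_mul_lineCount_near_le (s := fun v => Even (S₃ + v + π) ∧ |S₃| ≤ m ∧ |v| ≤ m)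
    (q := S₃ + π) (e := S₃) h1 h4 hm
    (fun x hx => ⟨by rw [← add_assoc, add_comm x]; exact hx.1, hx.2.2, hx.2.1⟩)
  simp only [abs_neg, abs_of_nonneg h1, abs_of_nonneg h2, abs_of_nonneg h3, abs_of_nonneg h4]
    at e0 e1 e2 e3 e4
  omega

/-- The sizes of a wall for which its part within the distance `m = t + r` is small. -/
theorem exists_wall_sizes (r K : ℕ) (hK : 1 ≤ K) : ∃ S₁ S₂ S₃ S₄ : ℤ,
    (r : ℤ) < S₁ ∧ (r : ℤ) < S₂ ∧ (r : ℤ) < S₃ ∧ (r : ℤ) < S₄ ∧ ∀ t : ℕ,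
    K * ((if S₁ ≤ t + r then min S₂ (t + r) + min S₃ (t + r) + 2 else 0) +
      (if S₄ ≤ t + r then min S₂ (t + r) + min S₃ (t + r) + 2 else 0) +
      (if S₂ ≤ t + r then min S₁ (t + r) + min S₄ (t + r) + 2 else 0) +
      (if S₃ ≤ t + r then min S₁ (t + r) + min S₄ (t + r) + 2 else 0)) ≤
    ((3 * K + 2) * t : ℤ) := by
  obtain ⟨S₁, h1⟩ : ∃ S₁ : ℤ, S₁ = 3 * r + 2 := ⟨_, rfl⟩
  obtain ⟨A, hA⟩ : ∃ A : ℤ, A = K * (S₁ + 4 + 3 * r) := ⟨_, rfl⟩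
  obtain ⟨S₂, h2⟩ : ∃ S₂ : ℤ, S₂ = r + A + S₁ := ⟨_, rfl⟩
  obtain ⟨A', hA'⟩ : ∃ A' : ℤ, A' = K * (S₂ + 2 * S₁ + 6 + 3 * r) := ⟨_, rfl⟩
  obtain ⟨S₃, h3⟩ : ∃ S₃ : ℤ, S₃ = r + A' + S₂ := ⟨_, rfl⟩
  obtain ⟨S₄, h4⟩ : ∃ S₄ : ℤ, S₄ = 2 * (S₁ + S₂ + S₃) + 8 + 3 * r := ⟨_, rfl⟩
  have hA0 : 0 ≤ A := by rw [hA]; apply mul_nonneg <;> omega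
  have hA0' : 0 ≤ A' := by rw [hA']; apply mul_nonneg <;> omega
  refine ⟨S₁, S₂, S₃, S₄, by omega, by omega, by omega, by omega, fun t => ?_⟩
  set D := (if S₁ ≤ t + r then min S₂ (t + r) + min S₃ (t + r) + 2 else 0) +
      (if S₄ ≤ t + r then min S₂ (t + r) + min S₃ (t + r) + 2 else 0) +
      (if S₂ ≤ t + r then min S₁ (t + r) + min S₄ (t + r) + 2 else 0) +
      (if S₃ ≤ t + r then min S₁ (t + r) + min S₄ (t + r) + 2 else 0) with hD
  -- With at most one side, or with all four, `3t` suffices outright. With two or three sides there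
  -- is a constant excess.
  have hcase : D ≤ 3 * t ∨ (S₂ ≤ t + r ∧ D ≤ 3 * t + (S₁ + 4 + 3 * r)) ∨
      (S₃ ≤ t + r ∧ D ≤ 3 * t + (S₂ + 2 * S₁ + 6 + 3 * r)) := by
    clear hA hA'
    rw [hD]
    split_ifs <;> omega
  clear_value D
  have hK0 : (0 : ℤ) ≤ K := by omega
  rcases hcase with h | ⟨h0, h⟩ | ⟨h0, h⟩
  · have := mul_le_mul_of_nonneg_left h hK0
    linarith
  · have := mul_le_mul_of_nonneg_left h hK0
    rw [mul_add, ← hA] at this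
    linarith
  · have := mul_le_mul_of_nonneg_left h hK0
    rw [mul_add, ← hA'] at this
    linarith

variable {V : Type*} {G : SimpleGraph V}

/-- Every cell that ever burns has a time at which it is burning, and over a finite set these times
have a maximum. -/
theorem isContained_of_subset_finite {B₀ : Finset V} {P : ℕ → Finset V} {F : Set V}
    (hF : F.Finite) (h : ∀ t, burning G B₀ P t ⊆ F) : IsContained G B₀ P := by
  classical
  let τ : V → ℕ := fun x => if hx : ∃ t, x ∈ burning G B₀ P t then hx.choose else 0
  refine ⟨hF.toFinset.sup τ, fun t ht => ?_⟩
  refine Set.Subset.antisymm (fun x hx => ?_) (burning_subset_succ B₀ P t)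
  have hex : ∃ t, x ∈ burning G B₀ P t := ⟨_, hx⟩
  have h1 : τ x = hex.choose := dif_pos hex
  have h2 : τ x ≤ hF.toFinset.sup τ := Finset.le_sup (by simpa using h _ hx)
  refine burning_mono B₀ P (h2.trans ht) ?_
  rw [h1]
  exact hex.choose_spec

variable {Λ : Type*} [Fintype Λ] {Γ : SimpleGraph Λ} {π : Λ → ℤ} {δ : Λ → Λ → ℤ}
  {cell : V → Λ × ℤ × ℤ}

open Classical in
/-- The boundary cells of a rectangle within the distance `m` of the origin. -/
noncomputable def wall (π : Λ → ℤ) (a b c d m : ℤ) : Finset (Λ × ℤ × ℤ) :=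
  ((Finset.univ : Finset Λ) ×ˢ (Finset.Icc a b ×ˢ Finset.Icc c d)).filter fun x =>
    OnRing a b c d x.2.1 x.2.2 ∧ Even (x.2.1 + x.2.2 + π x.1) ∧ |x.2.1| ≤ m ∧ |x.2.2| ≤ m

theorem mem_wall {a b c d m : ℤ} {x : Λ × ℤ × ℤ} : x ∈ wall π a b c d m ↔
    ((a ≤ x.2.1 ∧ x.2.1 ≤ b) ∧ c ≤ x.2.2 ∧ x.2.2 ≤ d) ∧ OnRing a b c d x.2.1 x.2.2 ∧
      Even (x.2.1 + x.2.2 + π x.1) ∧ |x.2.1| ≤ m ∧ |x.2.2| ≤ m := by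
  simp [wall]

theorem card_wall (a b c d m : ℤ) : (wall π a b c d m).card =
    ∑ i, ringCount (fun u v => Even (u + v + π i) ∧ |u| ≤ m ∧ |v| ≤ m) a b c d := by
  classical
  unfold ringCount
  rw [← Finset.card_sigma]
  apply Finset.card_bij (fun x _ => ⟨x.1, x.2⟩)
  · rintro ⟨i, u, v⟩ hx
    rw [mem_wall] at hx
    simp only [Finset.mem_sigma, Finset.mem_univ, Finset.mem_filter, Finset.mem_product,
      Finset.mem_Icc, true_and]
    exact hx
  · rintro ⟨i, p⟩ _ ⟨i', p'⟩ _ h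
    simpa using h
  · rintro ⟨i, u, v⟩ hx
    simp only [Finset.mem_sigma, Finset.mem_univ, Finset.mem_filter, Finset.mem_product,
      Finset.mem_Icc, true_and] at hx
    exact ⟨(i, u, v), mem_wall.2 hx, rfl⟩

/-- A wall that is built in time contains the fire. -/
theorem IsGrid.canContain (hG : IsGrid G Γ π δ cell) [Nonempty Λ] {ε : ℝ} (hε : 0 < ε)
    (B₀ : Finset V) :
    CanContain G (fun t => (3 / 2 * (Fintype.card Λ : ℝ) + ε) * t) B₀ := by
  classical
  obtain ⟨r, hr⟩ := exists_radius cell B₀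
  -- The wall costs at most `H (3K + 2) t / (2K) = (3/2) H t + H t / K`, and `H / K ≤ ε`.
  obtain ⟨K, hK⟩ := exists_nat_ge ((Fintype.card Λ : ℝ) / ε)
  have hH : (0 : ℝ) < Fintype.card Λ := by exact_mod_cast Fintype.card_pos
  have hK0 : (0 : ℝ) < K := lt_of_lt_of_le (div_pos hH hε) hK
  have hK1 : 1 ≤ K := by exact_mod_cast hK0
  obtain ⟨S₁, S₂, S₃, S₄, h1, h2, h3, h4, hS⟩ := exists_wall_sizes r K hK1
  let P : ℕ → Finset V := fun t =>
    Finset.preimage (wall π (-S₂) S₃ (-S₁) S₄ (t + r)) cell hG.inj.injOn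
  have memP : ∀ t x, x ∈ P t ↔ cell x ∈ wall π (-S₂) S₃ (-S₁) S₄ (t + r) := fun t x =>
    Finset.mem_preimage
  -- The fire moves by at most one in either coordinate, so it cannot jump over the wall. A wall
  -- cell it could reach at time `t + 1` lies within distance `t + 1 + r` and is protected by then.
  have hinside : ∀ t, ∀ x ∈ burning G B₀ P t, (-S₂ < (cell x).2.1 ∧ (cell x).2.1 < S₃) ∧
      -S₁ < (cell x).2.2 ∧ (cell x).2.2 < S₄ := by
    intro t
    induction t with
    | zero =>
      intro x hx
      have := hr x hx
      simp only [abs_le] at this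
      omega
    | succ t ih =>
      intro x hx
      have hfar := hG.abs_le_of_burning hr P (t + 1) x hx
      rcases hx with hx | ⟨hxP, y, hy, hyx⟩
      · exact ih x hx
      · have hy' := ih y hy
        have hnear := hG.near y x hyx
        rw [memP, mem_wall] at hxP
        have hlat := hG.lat x
        by_contra hcon
        refine hxP ⟨?_, ?_, hlat, hfar⟩
        · simp only [abs_le] at hnear
          omega
        · simp only [abs_le] at hnear
          unfold OnRing
          omega
  refine ⟨P, ⟨?_, ?_, ?_, ?_⟩, ?_⟩
  · rw [Finset.eq_empty_iff_forall_notMem]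
    intro x hx
    rw [memP, mem_wall] at hx
    obtain ⟨-, h5, -, h6⟩ := hx
    unfold OnRing at h5
    simp only [abs_le] at h6
    omega
  · intro s t hst x hx
    rw [memP, mem_wall] at hx ⊢
    have : (s : ℤ) ≤ t := by exact_mod_cast hst
    exact ⟨hx.1, hx.2.1, hx.2.2.1, by linarith [hx.2.2.2.1], by linarith [hx.2.2.2.2]⟩
  · intro t x hx _ hx'
    rw [memP, mem_wall] at hx
    have h5 := hinside t x hx'
    have h6 := hx.2.1
    unfold OnRing at h6
    omega
  · intro t
    have h5 : (P t).card ≤ (wall π (-S₂) S₃ (-S₁) S₄ (t + r)).card := by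
      rw [← Finset.card_image_of_injective (P t) hG.inj]
      apply Finset.card_le_card
      intro y hy
      obtain ⟨x, hx, rfl⟩ := Finset.mem_image.1 hy
      exact (memP t x).1 hx
    rw [card_wall] at h5
    obtain ⟨D, hD⟩ : ∃ D : ℤ, D = (if S₁ ≤ t + r then min S₂ (t + r) + min S₃ (t + r) + 2 else 0) +
      (if S₄ ≤ t + r then min S₂ (t + r) + min S₃ (t + r) + 2 else 0) +
      (if S₂ ≤ t + r then min S₁ (t + r) + min S₄ (t + r) + 2 else 0) +
      (if S₃ ≤ t + r then min S₁ (t + r) + min S₄ (t + r) + 2 else 0) := ⟨_, rfl⟩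
    have h6 : 2 * ((P t).card : ℤ) ≤ Fintype.card Λ * D := by
      have : (2 * (∑ i, ringCount (fun u v => Even (u + v + π i) ∧ |u| ≤ (t + r : ℤ) ∧
          |v| ≤ (t + r : ℤ)) (-S₂) S₃ (-S₁) S₄ : ℕ) : ℤ) ≤ ∑ i : Λ, D := by
        push_cast
        rw [Finset.mul_sum]
        refine Finset.sum_le_sum fun i _ => ?_
        rw [hD]
        exact two_mul_ringCount_near_le (π i) (by omega) (by omega) (by omega) (by omega) (by omega)
      rw [Finset.sum_const, Finset.card_univ, nsmul_eq_mul] at this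
      have h7 : ((P t).card : ℤ) ≤ _ := Int.ofNat_le.2 h5
      linarith
    have h7 := hS t
    rw [← hD] at h7
    have h8 : 2 * ((P t).card : ℝ) ≤ Fintype.card Λ * (D : ℝ) := by exact_mod_cast h6
    have h9 : (K : ℝ) * D ≤ (3 * K + 2) * t := by exact_mod_cast h7
    rw [div_le_iff₀ hε] at hK
    have h10 : (0 : ℝ) ≤ t := Nat.cast_nonneg t
    have h11 : (K : ℝ) * (Fintype.card Λ * D) ≤ K * (3 * Fintype.card Λ * t + 2 * ε * t) := by
      nlinarith [mul_le_mul_of_nonneg_left h9 hH.le, mul_le_mul_of_nonneg_right hK h10]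
    have h12 := le_of_mul_le_mul_left h11 hK0
    linarith
  · refine isContained_of_subset_finite (F := cell ⁻¹' ((Finset.univ : Finset Λ) ×ˢ
      (Finset.Icc (-S₂) S₃ ×ˢ Finset.Icc (-S₁) S₄) : Finset (Λ × ℤ × ℤ)))
      ((Finset.finite_toSet _).preimage hG.inj.injOn) fun t x hx => ?_
    have := hinside t x hx
    simp only [Set.mem_preimage, Finset.mem_coe, Finset.mem_product, Finset.mem_univ, true_and,
      Finset.mem_Icc]
    omega

end

/-! ### The critical rate, and the two graphs as grids. -/

section

section Rate

variable {V : Type*} {G : SimpleGraph V}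

/-- Otherwise `ε = c' - c` would let the player contain, at the rate `c'`, a fire that cannot be
contained at that rate. -/
theorem IsCriticalProtectionRate.le {c c' : ℝ} (hc : IsCriticalProtectionRate G c)
    (hc' : IsCriticalProtectionRate G c') : c' ≤ c := by
  by_contra hlt
  push Not at hlt
  obtain ⟨B₀, hB₀⟩ := hc'.1
  have := hc.2 (c' - c) (sub_pos.2 hlt) B₀
  rw [add_sub_cancel] at this
  exact hB₀ this

theorem IsCriticalProtectionRate.iff_eq {c : ℝ} (hc : IsCriticalProtectionRate G c) (c' : ℝ) :
    IsCriticalProtectionRate G c' ↔ c' = c :=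
  ⟨fun h => le_antisymm (hc.le h) (h.le hc), fun h => h ▸ hc⟩

theorem IsGrid.isCriticalProtectionRate {Λ : Type*} [Fintype Λ] {Γ : SimpleGraph Λ} {π : Λ → ℤ}
    {δ : Λ → Λ → ℤ} {cell : V → Λ × ℤ × ℤ} (hG : IsGrid G Γ π δ cell) (hΓ : Γ.Connected) :
    IsCriticalProtectionRate G (3 / 2 * (Fintype.card Λ : ℝ)) :=
  have := hΓ.nonempty
  ⟨hG.exists_not_canContain hΓ, fun _ hε B₀ => hG.canContain hε B₀⟩

end Rate

theorem hasse_int_adj (a b : ℤ) : (SimpleGraph.hasse ℤ).Adj a b ↔ b = a + 1 ∨ a = b + 1 := by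
  rw [SimpleGraph.hasse_adj, Order.covBy_iff_add_one_eq, Order.covBy_iff_add_one_eq]
  constructor <;> rintro (h | h) <;> simp [h]

/-- The cells of the first graph: the diagonal coordinates of the plane. -/
def diagonalCell (h : ℕ) (x : (ℤ × ℤ) × Fin h) : Fin h × ℤ × ℤ :=
  (x.2, x.1.1 + x.1.2, x.1.1 - x.1.2)

/-- In the coordinates `x + y` and `x - y` the four moves in the plane become the four diagonal
moves, and moves between layers do not change the coordinates. -/
theorem isGrid_G₁ (h : ℕ) :
    IsGrid (G₁ h) (SimpleGraph.pathGraph h) (fun _ => 0) (fun _ _ => 0) (diagonalCell h) where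
  inj := by
    rintro ⟨⟨x, y⟩, k⟩ ⟨⟨x', y'⟩, k'⟩ hx
    simp only [diagonalCell, Prod.mk.injEq] at hx ⊢
    exact ⟨⟨by omega, by omega⟩, hx.1⟩
  surj := by
    intro i u v he
    obtain ⟨w, hw⟩ := he
    refine ⟨((w, u - w), i), ?_⟩
    simp only [diagonalCell, Prod.mk.injEq, true_and]
    omega
  lat := by
    rintro ⟨⟨x, y⟩, k⟩
    simp only [diagonalCell]
    exact ⟨x, by ring⟩
  near := by
    rintro ⟨⟨x, y⟩, k⟩ ⟨⟨x', y'⟩, k'⟩ hadj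
    simp only [G₁, SimpleGraph.boxProd_adj, hasse_int_adj] at hadj
    simp only [diagonalCell, abs_le]
    have : x' = x ∧ y' = y ∨ (x' = x + 1 ∨ x = x' + 1) ∧ y' = y ∨
        (y' = y + 1 ∨ y = y' + 1) ∧ x' = x := by
      rcases hadj with ⟨⟨h1, h2⟩ | ⟨h1, h2⟩, -⟩ | ⟨-, h1⟩
      · exact Or.inr (Or.inl ⟨h1, h2.symm⟩)
      · exact Or.inr (Or.inr ⟨h1, h2.symm⟩)
      · rw [Prod.mk.injEq] at h1
        exact Or.inl ⟨h1.1.symm, h1.2.symm⟩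
    omega
  diag := by
    rintro ⟨⟨x, y⟩, k⟩ ⟨⟨x', y'⟩, k'⟩ i u v hx ε ε' hε hε' hy
    simp only [diagonalCell, Prod.mk.injEq] at hx hy
    simp only [G₁, SimpleGraph.boxProd_adj, hasse_int_adj]
    refine Or.inl ⟨?_, hx.1.trans hy.1.symm⟩
    omega
  crossU := by
    rintro ⟨⟨x, y⟩, k⟩ ⟨⟨x', y'⟩, k'⟩ i j u v hij hx hy
    simp only [diagonalCell, Prod.mk.injEq] at hx hy
    simp only [G₁, SimpleGraph.boxProd_adj]
    obtain ⟨rfl, hx⟩ := hx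
    obtain ⟨rfl, hy⟩ := hy
    exact Or.inr ⟨hij, Prod.ext (by simp only; omega) (by simp only; omega)⟩
  crossV := by
    rintro ⟨⟨x, y⟩, k⟩ ⟨⟨x', y'⟩, k'⟩ i j u v hij hx hy
    simp only [diagonalCell, Prod.mk.injEq] at hx hy
    simp only [G₁, SimpleGraph.boxProd_adj]
    obtain ⟨rfl, hx⟩ := hx
    obtain ⟨rfl, hy⟩ := hy
    exact Or.inr ⟨hij, Prod.ext (by simp only; omega) (by simp only; omega)⟩
  shift := fun _ _ => Or.inl rfl
  parity := by simp

/-- The cells of the second graph: every layer is split by parity. -/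
def parityCell (h : ℕ) (x : (ℤ × ℤ) × Fin h) : (Fin h × Bool) × ℤ × ℤ :=
  ((x.2, decide ((x.1.1 + x.1.2) % 2 = 1)), x.1.1, x.1.2)

/-- Diagonal moves keep the parity of `x + y` and stay in a class; horizontal and vertical moves
switch the class of the same layer, with shift 1. Edges of the path keep position and class, with
shift 0. -/
theorem isGrid_G₂ (h : ℕ) :
    IsGrid (G₂ h) ((SimpleGraph.pathGraph h).boxProd (⊤ : SimpleGraph Bool))
      (fun i => if i.2 then 1 else 0) (fun i j => if i.2 = j.2 then 0 else 1) (parityCell h) where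
  inj := by
    rintro ⟨⟨x, y⟩, k⟩ ⟨⟨x', y'⟩, k'⟩ hx
    simp only [parityCell, Prod.mk.injEq] at hx ⊢
    exact ⟨hx.2, hx.1.1⟩
  surj := by
    rintro ⟨k, b⟩ u v he
    refine ⟨((u, v), k), ?_⟩
    simp only [parityCell, Prod.mk.injEq, true_and, and_true]
    rw [Int.even_iff] at he
    cases b
    · simp at he ⊢
      omega
    · simp at he ⊢
      omega
  lat := by
    rintro ⟨⟨x, y⟩, k⟩
    simp only [parityCell, decide_eq_true_eq]
    rw [Int.even_iff]
    split_ifs <;> omega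
  near := by
    rintro ⟨⟨x, y⟩, k⟩ ⟨⟨x', y'⟩, k'⟩ hadj
    simp only [G₂, SimpleGraph.boxProd_adj, SimpleGraph.strongProd, hasse_int_adj] at hadj
    simp only [parityCell, abs_le]
    rcases hadj with ⟨⟨-, h1, h2⟩, -⟩ | ⟨-, h1⟩
    · omega
    · rw [Prod.mk.injEq] at h1
      omega
  diag := by
    rintro ⟨⟨x, y⟩, k⟩ ⟨⟨x', y'⟩, k'⟩ i u v hx ε ε' hε hε' hy
    simp only [parityCell, Prod.mk.injEq] at hx hy
    simp only [G₂, SimpleGraph.boxProd_adj, SimpleGraph.strongProd, hasse_int_adj, ne_eq,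
      Prod.mk.injEq]
    refine Or.inl ⟨by omega, ?_⟩
    exact (Prod.ext_iff.1 (hx.1.trans hy.1.symm)).1
  crossU := by
    rintro ⟨⟨x, y⟩, k⟩ ⟨⟨x', y'⟩, k'⟩ ⟨i, b⟩ ⟨j, b'⟩ u v hij hx hy
    simp only [parityCell, Prod.mk.injEq] at hx hy
    simp only [G₂, SimpleGraph.boxProd_adj, SimpleGraph.strongProd, hasse_int_adj, ne_eq,
      SimpleGraph.top_adj, Prod.mk.injEq] at hij ⊢
    obtain ⟨⟨rfl, -⟩, hx⟩ := hx
    obtain ⟨⟨rfl, -⟩, hy⟩ := hy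
    rcases hij with ⟨h1, h2⟩ | ⟨h1, h2⟩
    · rw [if_pos h2] at hy
      exact Or.inr ⟨h1, by omega⟩
    · rw [if_neg h1] at hy
      exact Or.inl ⟨by omega, h2⟩
  crossV := by
    rintro ⟨⟨x, y⟩, k⟩ ⟨⟨x', y'⟩, k'⟩ ⟨i, b⟩ ⟨j, b'⟩ u v hij hx hy
    simp only [parityCell, Prod.mk.injEq] at hx hy
    simp only [G₂, SimpleGraph.boxProd_adj, SimpleGraph.strongProd, hasse_int_adj, ne_eq,
      SimpleGraph.top_adj, Prod.mk.injEq] at hij ⊢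
    obtain ⟨⟨rfl, -⟩, hx⟩ := hx
    obtain ⟨⟨rfl, -⟩, hy⟩ := hy
    rcases hij with ⟨h1, h2⟩ | ⟨h1, h2⟩
    · rw [if_pos h2] at hy
      exact Or.inr ⟨h1, by omega⟩
    · rw [if_neg h1] at hy
      exact Or.inl ⟨by omega, h2⟩
  shift := by
    intro i j
    split_ifs <;> simp
  parity := by
    rintro ⟨i, b⟩ ⟨j, b'⟩ hij
    simp only [SimpleGraph.boxProd_adj, SimpleGraph.top_adj, ne_eq] at hij
    rcases hij with ⟨-, h2⟩ | ⟨h1, -⟩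
    · subst h2
      cases b <;> simp
    · cases b <;> cases b' <;> simp at h1 ⊢

theorem pathGraph_connected_of_pos {h : ℕ} (hh : 1 ≤ h) : (SimpleGraph.pathGraph h).Connected := by
  obtain ⟨n, rfl⟩ := Nat.exists_eq_add_of_le' hh
  exact SimpleGraph.pathGraph_connected n

end

end Firefighter

theorem theorem1 (h : ℕ) (hh : 1 ≤ h) :
    (∀ c : ℝ, Firefighter.IsCriticalProtectionRate (Firefighter.G₁ h) c ↔
      c = 3 / 2 * (1 : ℝ) * (h : ℝ)) ∧
    (∀ c : ℝ, Firefighter.IsCriticalProtectionRate (Firefighter.G₂ h) c ↔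
      c = 3 / 2 * (2 : ℝ) * (h : ℝ)) := by
  have hpath := Firefighter.pathGraph_connected_of_pos hh
  refine ⟨fun c => ?_, fun c => ?_⟩
  · rw [((Firefighter.isGrid_G₁ h).isCriticalProtectionRate hpath).iff_eq, Fintype.card_fin, mul_one]
  · rw [((Firefighter.isGrid_G₂ h).isCriticalProtectionRate
      (hpath.boxProd SimpleGraph.connected_top)).iff_eq, Fintype.card_prod, Fintype.card_fin,
      Fintype.card_bool, Nat.cast_mul, Nat.cast_ofNat, mul_comm (h : ℝ), mul_assoc]
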